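/- **Setting.** Let $S$ be a non-compact (connected, Hausdorff) Riemann surface with a smooth Hermitian metric, written $h\,dz\otimes d\bar z$ in a local holomorphic coordinate $z$, and let $o\in S$. Let $\mathscr S$ be a nowhere-vanishing holomorphic $1$-form on $S$ such that $\hat x:=\int_o^x\mathscr S$ does not depend on the path (all integrals of $\mathscr S$ over closed curves vanish) and such that $\hat x=0$ only for $x=o$. For $r>0$ put $D(r)=\{x\in S:|\hat x|<r\}$ and $C(r)=\{x\in S:|\hat x|=r\}$. Suppose that $S$ is $\mathscr S$-exhausted: whenever $0<r_1<r_2<\cdots$ and $r_n\to\infty$, one has $S=\bigcup_n D(r_n)$, and either $\overline{D(r_n)}$ is compact and contained in $D(r_{n+1})$ for all $n$, or this holds for all $n$ smaller than some index $k$, while $D(r_n)=S$ for all $n\ge k$. Let $R=\sup\{r>0: C(r)\neq\emptyset\}\in(0,\infty]$ be the $\mathscr S$-radius, and fix $r_0\in(0,R)$. With $dd^c=\frac{\sqrt{-1}}{2\pi}\partial\bar\partial$, for a meromorphic function $f=[f_0:f_1]:S\to\mathbb P^1(\mathbb C)=\overline{\mathbb C}$, a value $a\in\overline{\mathbb C}$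 and $r_0<r<R$ define $$T_f(r)=\int_{r_0}^r\frac{dt}{t}\int_{D(t)}f^*\omega_{FS},\qquad f^*\omega_{FS}=dd^c\log(|f_0|^2+|f_1|^2)\ \ (f_0,f_1 \text{ local holomorphic without common zeros}),$$ $$T(r,\mathscr R)=\int_{r_0}^r\frac{dt}{t}\int_{D(t)}\mathscr R,\qquad \mathscr R=-dd^c\log h,$$ $$\overline N_f(r,a)=\int_{r_0}^r\frac{\overline n_f(t,a)}{t}\,dt,\qquad \overline n_f(t,a)=\#\{x\in D(t): f(x)=a\},$$ $$\|\mathscr S\|_{r,\sup}=\sup\{\|\mathscr S_x\|_h: |\hat x|<r\},\qquad \|\mathscr S_x\|_h=|\varphi|/\sqrt h\ \text{ if }\mathscr S=\varphi\,dz .$$ **Theorem I.** Let $\gamma\ge 0$ be a locally integrable function on $(0,R)$ with $\int_0^R\gamma(r)\,dr=\infty$, let $f$ be a nonconstant meromorphic function on $S$, and let $a_1,\dots,a_q$ be distinct values in $\overline{\mathbb C}$. Then there is a constant $C>0$ such that for every $\delta>0$ there is a measurable set $E_\delta\subset(0,R)$ with $\int_{E_\delta}\gamma(r)\,dr<\infty$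 such that $$(q-2)\,T_f(r)+T(r,\mathscr R)\ \le\ \sum_{j=1}^q\overline N_f(r,a_j)+C\Big(\log T_f(r)+\log\|\mathscr S\|_{r,\sup}+\log^+\gamma(r)+\delta\log r\Big)$$ holds for all $r\in(r_0,R)$ outside $E_\delta$, where $\log^+=\max(\log,0)$. -/

import Mathlib

open Set Filter Topology MeasureTheory
open scoped Manifold ContDiff

noncomputable section

/-! ### Tensors on a Riemann surface, in local holomorphic coordinates

A Riemann surface is a connected Hausdorff space `S` with a holomorphic atlas of charts
`e : OpenPartialHomeomorph S ℂ`.  A tensor is given by its coefficient in every chart of the atlas,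
subject to the usual transformation rule under a change of coordinates. -/

/-- A holomorphic `1`-form: in the chart `e`, with coordinate `z`, it is `coeff e z • dz`. -/
structure HolomorphicForm (S : Type*) [TopologicalSpace S] [ChartedSpace ℂ S] where
  coeff : OpenPartialHomeomorph S ℂ → ℂ → ℂ
  holomorphic : ∀ e ∈ atlas ℂ S, DifferentiableOn ℂ (coeff e) e.target
  compat : ∀ e ∈ atlas ℂ S, ∀ e' ∈ atlas ℂ S, ∀ x ∈ e.source ∩ e'.source,
    coeff e (e x) = coeff e' (e' x) * deriv (fun z => e' (e.symm z)) (e x)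

/-- A smooth Hermitian metric: in the chart `e`, with coordinate `z`, it is
`coeff e z • dz ⊗ dz̄`. -/
structure HermitianMetric (S : Type*) [TopologicalSpace S] [ChartedSpace ℂ S] where
  coeff : OpenPartialHomeomorph S ℂ → ℂ → ℝ
  pos : ∀ e ∈ atlas ℂ S, ∀ z ∈ e.target, 0 < coeff e z
  smooth : ∀ e ∈ atlas ℂ S, ContDiffOn ℝ ∞ (coeff e) e.target
  compat : ∀ e ∈ atlas ℂ S, ∀ e' ∈ atlas ℂ S, ∀ x ∈ e.source ∩ e'.source,
    coeff e (e x) = coeff e' (e' x) * ‖deriv (fun z => e' (e.symm z)) (e x)‖ ^ 2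

section Surface

variable {S : Type*} [TopologicalSpace S] [ChartedSpace ℂ S]

/-- The coefficient at `x` of a holomorphic form in the preferred chart at `x`. -/
def HolomorphicForm.coeffAt (Φ : HolomorphicForm S) (x : S) : ℂ :=
  Φ.coeff (chartAt ℂ x) (chartAt ℂ x x)

/-- The pointwise norm `‖Φ_x‖_h`: it is `|φ| / √h` if `Φ = φ dz` and the metric is `h dz ⊗ dz̄`. -/
def HolomorphicForm.normAt (Φ : HolomorphicForm S) (h : HermitianMetric S) (x : S) : ℝ :=
  ‖Φ.coeffAt x‖ / Real.sqrt (h.coeff (chartAt ℂ x) (chartAt ℂ x x))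

/-- The integral of a holomorphic form along a curve `c : [0, 1] → S`.  At time `t` the integrand
`Φ (c' t)` is computed in the preferred chart at `c t`. -/
def HolomorphicForm.curveInt (Φ : HolomorphicForm S) (c : ℝ → S) : ℂ :=
  ∫ t in (0 : ℝ)..1, Φ.coeffAt (c t) * deriv (fun s => chartAt ℂ (c t) (c s)) t

/-- `L x = ∫_o^x Φ` along every smooth curve: the integral of `Φ` over a smooth curve depends only
on the end points of the curve, and it is the increment of `L`; and `L o = 0`.
(In particular `Φ` has integral zero over every closed curve.) -/
def HolomorphicForm.IsIntegralFrom (Φ : HolomorphicForm S) (o : S) (L : S → ℂ) : Prop :=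
  L o = 0 ∧ ∀ c : ℝ → S, ContMDiffOn 𝓘(ℝ, ℝ) 𝓘(ℝ, ℂ) ∞ c (Icc 0 1) →
    Φ.curveInt c = L (c 1) - L (c 0)

open Classical in
/-- The function `x ↦ x̂ = ∫_o^x Φ`, if this integral is independent of the path
(and zero otherwise). -/
def HolomorphicForm.hat (Φ : HolomorphicForm S) (o : S) : S → ℂ :=
  if H : ∃ L : S → ℂ, Φ.IsIntegralFrom o L then H.choose else fun _ => 0

/-- The disc `{x : |x̂| < r}`. -/
def HolomorphicForm.disc (Φ : HolomorphicForm S) (o : S) (r : ℝ) : Set S :=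
  {x | ‖Φ.hat o x‖ < r}

/-- The circle `{x : |x̂| = r}`. -/
def HolomorphicForm.circle (Φ : HolomorphicForm S) (o : S) (r : ℝ) : Set S :=
  {x | ‖Φ.hat o x‖ = r}

/-- The nowhere-vanishing form `Φ` makes `S` a `Φ`-Riemann surface with respect to `o`: the function
`x̂ = ∫_o^x Φ` is well defined, and `o` is its only zero. -/
structure HolomorphicForm.IsSurfaceForm (Φ : HolomorphicForm S) (o : S) : Prop where
  ne_zero : ∀ x, Φ.coeffAt x ≠ 0
  pathIndependent : ∃ L : S → ℂ, Φ.IsIntegralFrom o L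
  hat_eq_zero_iff : ∀ x, Φ.hat o x = 0 ↔ x = o

/-- `S` is a `Φ`-exhausted Riemann surface with respect to `o`: for all radii increasing to infinity
the discs exhaust `S`, that is, they cover `S`, and either each of them is relatively compact in the
next one (the parabolic case), or this holds up to some index from which on the discs are all of `S`
(the hyperbolic case). -/
structure HolomorphicForm.IsExhausted (Φ : HolomorphicForm S) (o : S) : Prop
    extends Φ.IsSurfaceForm o where
  exhaustion : ∀ r : ℕ → ℝ, 0 < r 0 → StrictMono r → Tendsto r atTop atTop →
    (⋃ n, Φ.disc o (r n)) = univ ∧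
    ((∀ n, IsCompact (closure (Φ.disc o (r n))) ∧
        closure (Φ.disc o (r n)) ⊆ Φ.disc o (r (n + 1))) ∨
      ∃ k, (∀ n < k, IsCompact (closure (Φ.disc o (r n))) ∧
          closure (Φ.disc o (r n)) ⊆ Φ.disc o (r (n + 1))) ∧
        ∀ n ≥ k, Φ.disc o (r n) = univ)

/-- The radius `R = sup {r > 0 : the circle of radius r is non-empty}`, in `[0, ∞]`. -/
def HolomorphicForm.radius (Φ : HolomorphicForm S) (o : S) : ENNReal :=
  ⨆ (r : ℝ) (_ : 0 < r ∧ (Φ.circle o r).Nonempty), ENNReal.ofReal r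

/-- The open interval `(0, R)`. -/
def HolomorphicForm.radii (Φ : HolomorphicForm S) (o : S) : Set ℝ :=
  {r | 0 < r ∧ ENNReal.ofReal r < Φ.radius o}

/-- `sup {‖Φ_x‖_h : |x̂| < r}`. -/
def HolomorphicForm.supNorm (Φ : HolomorphicForm S) (o : S) (h : HermitianMetric S) (r : ℝ) : ℝ :=
  sSup (Φ.normAt h '' Φ.disc o r)

/-! ### Integration of `(1,1)`-forms

A real `(1,1)`-form is given by its coefficient family `η`: in the chart `e`, with coordinate
`z = x + i y`, the form is `η e z • dx ∧ dy`. -/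

open Classical in
/-- A sequence of points whose preferred charts cover `S`.  There is one as soon as `S` is
`σ`-compact (equivalently, second countable), see `iUnion_chartSeq`. -/
def chartSeq (o : S) : ℕ → S :=
  if H : ∃ p : ℕ → S, (⋃ n, (chartAt ℂ (p n)).source) = univ then H.choose else fun _ => o

theorem iUnion_chartSeq [SigmaCompactSpace S] (o : S) :
    (⋃ n, (chartAt ℂ (chartSeq o n)).source) = univ := by
  have H : ∃ p : ℕ → S, (⋃ n, (chartAt ℂ (p n)).source) = univ := by
    obtain ⟨s, hs, hU⟩ := countable_cover_nhds_of_sigmaCompact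
      (fun x : S => chart_source_mem_nhds ℂ x)
    have hne : s.Nonempty := by
      by_contra hcon
      rw [not_nonempty_iff_eq_empty] at hcon
      have ho : o ∈ (⋃ x ∈ s, (chartAt ℂ x).source) := by rw [hU]; trivial
      simp [hcon] at ho
    obtain ⟨p, rfl⟩ := hs.exists_eq_range hne
    exact ⟨p, by simpa using hU⟩
  unfold chartSeq
  rw [dif_pos H]
  exact H.choose_spec

/-- The part of `A` in the `n`-th chart domain and in none of the previous ones. -/
def chartPiece (o : S) (A : Set S) (n : ℕ) : Set S :=
  (A ∩ (chartAt ℂ (chartSeq o n)).source) \ ⋃ m < n, (chartAt ℂ (chartSeq o m)).source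

/-- The integral of a `(1,1)`-form `η` over a set `A`: cut `A` into countably many disjoint pieces,
each in the domain of one chart, and integrate the coefficient of `η` over the image of each piece
in the plane.  (For a form that is integrable on `A`, the result does not depend on the charts.) -/
def formIntegral (o : S) (η : OpenPartialHomeomorph S ℂ → ℂ → ℝ) (A : Set S) : ℝ :=
  ∑' n : ℕ, ∫ z in chartAt ℂ (chartSeq o n) '' chartPiece o A n, η (chartAt ℂ (chartSeq o n)) z

/-- The coefficient of `dd^c u = (i / 2π) ∂∂̄ u`, which is `(1 / 4π) (u_xx + u_yy) dx ∧ dy`. -/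
def ddc (u : ℂ → ℝ) (z : ℂ) : ℝ :=
  (4 * Real.pi)⁻¹ * Laplacian.laplacian u z

/-! ### Meromorphic functions, and Nevanlinna's functions -/

/-- The affine coordinate `ζ` of the Riemann sphere (with value `0` at `∞`). -/
def sphereCoord (p : OnePoint ℂ) : ℂ := p.elim 0 id

/-- The coordinate `1 / ζ` of the Riemann sphere about `∞` (with value `0` at `∞`). -/
def sphereCoordInv (p : OnePoint ℂ) : ℂ := p.elim 0 fun z => z⁻¹

/-- `f` is a holomorphic map to the Riemann sphere, i.e. (unless it is constantly `∞`)
a meromorphic function. -/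
structure IsMeromorphicMap (f : S → OnePoint ℂ) : Prop where
  continuous : Continuous f
  holomorphic : ∀ x, f x ≠ OnePoint.infty →
    MDifferentiableAt 𝓘(ℂ, ℂ) 𝓘(ℂ, ℂ) (fun y => sphereCoord (f y)) x
  holomorphic_inv : ∀ x, f x ≠ ((0 : ℂ) : OnePoint ℂ) →
    MDifferentiableAt 𝓘(ℂ, ℂ) 𝓘(ℂ, ℂ) (fun y => sphereCoordInv (f y)) x

open Classical in
/-- The pull-back `f^* ω_FS = dd^c log (|f₀|² + |f₁|²)`, where locally `f = [f₀ : f₁]`: one takes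
`[1 : f]` where `f` is finite, and `[1 / f : 1]` at the poles. -/
def fubiniStudyPullback (f : S → OnePoint ℂ) (e : OpenPartialHomeomorph S ℂ) (z : ℂ) : ℝ :=
  if f (e.symm z) ≠ OnePoint.infty then
    ddc (fun w => Real.log (1 + ‖sphereCoord (f (e.symm w))‖ ^ 2)) z
  else
    ddc (fun w => Real.log (‖sphereCoordInv (f (e.symm w))‖ ^ 2 + 1)) z

/-- The Ricci form `-dd^c log h`. -/
def HermitianMetric.ricciForm (h : HermitianMetric S) (e : OpenPartialHomeomorph S ℂ) (z : ℂ) : ℝ :=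
  -ddc (fun w => Real.log (h.coeff e w)) z

/-- The characteristic `∫_{r₀}^r (dt / t) ∫_{D(t)} η` of a `(1,1)`-form `η`. -/
def HolomorphicForm.characteristic (Φ : HolomorphicForm S) (o : S) (r₀ : ℝ)
    (η : OpenPartialHomeomorph S ℂ → ℂ → ℝ) (r : ℝ) : ℝ :=
  ∫ t in r₀..r, formIntegral o η (Φ.disc o t) / t

/-- The simple counting function `∫_{r₀}^r n̄(t, a) dt / t`, where `n̄(t, a)` is the number of points
of the disc `D(t)` at which `f` takes the value `a`, without multiplicities. -/
def HolomorphicForm.simpleCounting (Φ : HolomorphicForm S) (o : S) (r₀ : ℝ) (f : S → OnePoint ℂ)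
    (a : OnePoint ℂ) (r : ℝ) : ℝ :=
  ∫ t in r₀..r, ((Φ.disc o t ∩ f ⁻¹' {a}).ncard : ℝ) / t

end Surface

end

open scoped ComplexConjugate

/-! Since the form has no zeros, `x̂` is a local biholomorphism, and the exhaustion makes it proper
over every closed disc of radius less than `R`. As `0` has the single preimage `o`, connectedness of
discs makes `x̂` a bijection onto `|w| < R` (`ball_subset_range_hat`, `injective_hat`). The problem
thus becomes one about a map `F` from a disc or the plane to the sphere. The metric enters only
through `-2 log ‖𝒮‖_h`: as `log |φ|` is harmonic, the Ricci form is `-dd^c` of this function, and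
the Green–Jensen formula gives `T(r, ℛ) ≤ log ‖𝒮‖_{r,sup} + O(1)` (`characteristic_ricciForm_le`).

On smaller discs write `F = [f₀ : f₁]` without common zeros, `N = |f₀|² + |f₁|²`, `W` for the
Wronskian, `L_j` for the unit linear form vanishing at `a_j`, `K = |W|² / N²` and `X_j = |L_j|² /
N`. Then `log (K ∏ X_j⁻¹) = (q - 2) log N - 2 log |∏ L_j / W|`. Green–Jensen turns the first term
into `2 (q - 2) T_f`. Jensen's formula turns the second into at most `2 ∑ N̄_f(r, a_j)`, because `W`
loses at most one order of vanishing against each `L_j` (`greenAverage_add_le_circleAverage`). It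
remains to bound the circle mean of `log (K ∏ X_j⁻¹)` from above.

The values are distinct, so at most one `X_j` is small at a given point and the product is
controlled by a sum of the `K / X_j`. These are too singular; the weakened densities `K (1 - X_j) /
(X_j (2 - log X_j)²)` are dominated by the Laplacian of `-log (2 - log X_j) + log N`, up to the
factor 4, so their iterated integrals are `O(T_f) + O(1)`. The computation is made with `X_j + ε`
and passes to `ε = 0` by monotone convergence. The factors `(2 - log X_j)²` cost the logarithm of a
proximity function, hence `O(log T_f)` by the first main theorem. Concavity moves the logarithm
outside the circle mean, and Borel's growth lemma, used twice, bounds that mean by the iterated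
integral off a set of finite `γ`-mass (`exists_main_estimate`).

Finally, additive constants are absorbed into the exceptional set: where `log⁺ γ + δ log r` stays
below a bound, both `r` and `γ` are bounded, so this set has finite `γ`-mass
(`lintegral_posLog_add_log_lt`). This is why the constant `q + 3` does not depend on `δ`. -/

/-! ### Differentiation under the integral, and the Laplacian in the plane -/

theorem hasDerivAt_intervalIntegral_of_continuousOn {G G' : ℝ → ℝ → ℝ} {s : Set ℝ} (hs : IsOpen s)
    {a b : ℝ} (hG : ∀ t ∈ s, Continuous (G t))
    (hG' : ContinuousOn (Function.uncurry G') (s ×ˢ univ))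
    (hd : ∀ t ∈ s, ∀ θ, HasDerivAt (fun t => G t θ) (G' t θ) t) {t : ℝ} (ht : t ∈ s) :
    HasDerivAt (fun t => ∫ θ in a..b, G t θ) (∫ θ in a..b, G' t θ) t := by
  obtain ⟨ε, hε, hεs⟩ := Metric.nhds_basis_closedBall.mem_iff.1 (hs.mem_nhds ht)
  have hK : IsCompact (Metric.closedBall t ε ×ˢ uIcc a b) :=
    (isCompact_closedBall t ε).prod isCompact_uIcc
  obtain ⟨C, hC⟩ := hK.exists_bound_of_continuousOn
    (hG'.mono (prod_mono hεs (subset_univ _)))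
  have hcont : Continuous (G' t) := by
    have h1 : ContinuousOn (fun θ : ℝ => Function.uncurry G' (t, θ)) univ :=
      hG'.comp (by fun_prop) (fun θ _ => ⟨ht, trivial⟩)
    exact continuousOn_univ.1 h1
  refine (intervalIntegral.hasDerivAt_integral_of_dominated_loc_of_deriv_le
    (F := G) (F' := G') (bound := fun _ => C) (Metric.closedBall_mem_nhds t hε) ?_ ?_ ?_ ?_ ?_ ?_).2
  · filter_upwards [hs.mem_nhds ht] with x hx
    exact (hG x hx).aestronglyMeasurable
  · exact (hG t ht).intervalIntegrable _ _
  · exact hcont.aestronglyMeasurable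
  · exact Eventually.of_forall fun θ hθ x hx => hC (x, θ) ⟨hx, uIoc_subset_uIcc hθ⟩
  · exact intervalIntegrable_const
  · exact Eventually.of_forall fun θ _ x hx => hd x (hεs hx) θ

/-- The trace of the Hessian may be computed in any orthonormal frame. On a circle `e` will be the
radial direction and `i e` the tangential one. -/
theorem laplacian_eq_fderiv_fderiv_of_norm_one (u : ℂ → ℝ) (z : ℂ) {e : ℂ} (he : ‖e‖ = 1) :
    Laplacian.laplacian u z = fderiv ℝ (fderiv ℝ u) z e e
      + fderiv ℝ (fderiv ℝ u) z (Complex.I * e) (Complex.I * e) := by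
  have h1 : e.re * e.re + e.im * e.im = 1 := by
    have := Complex.sq_norm e
    rw [he, Complex.normSq_apply] at this
    linarith
  rw [InnerProductSpace.laplacian_eq_iteratedFDeriv_complexPlane]
  simp only [iteratedFDeriv_two_apply, Matrix.cons_val_zero, Matrix.cons_val_one]
  set B := fderiv ℝ (fderiv ℝ u) z
  have e1 : e = e.re • (1 : ℂ) + e.im • Complex.I := by
    simp [Complex.re_add_im]
  have e2 : Complex.I * e = (-e.im) • (1 : ℂ) + e.re • Complex.I := by
    apply Complex.ext <;> simp
  rw [e2]
  generalize e.re = a at *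
  generalize e.im = b at *
  rw [e1]
  simp only [map_add, map_smul, add_apply, smul_apply, smul_eq_mul]
  linear_combination (-(B 1 1 + B Complex.I Complex.I)) * h1

theorem laplacian_eq_fderiv_fderiv (u : ℂ → ℝ) (z : ℂ) :
    Laplacian.laplacian u z = fderiv ℝ (fderiv ℝ u) z 1 1
      + fderiv ℝ (fderiv ℝ u) z Complex.I Complex.I := by
  simpa using laplacian_eq_fderiv_fderiv_of_norm_one u z (e := 1) (by simp)

theorem continuousOn_laplacian {u : ℂ → ℝ} {U : Set ℂ} (hU : IsOpen U)
    (hu : ContDiffOn ℝ 2 u U) : ContinuousOn (Laplacian.laplacian u) U := by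
  have h1 : ContDiffOn ℝ 1 (fderiv ℝ u) U := hu.fderiv_of_isOpen hU (by norm_num)
  have h2 : ContinuousOn (fderiv ℝ (fderiv ℝ u)) U := h1.continuousOn_fderiv_of_isOpen hU le_rfl
  have : Laplacian.laplacian u = fun z => fderiv ℝ (fderiv ℝ u) z 1 1
      + fderiv ℝ (fderiv ℝ u) z Complex.I Complex.I := by
    ext z; exact laplacian_eq_fderiv_fderiv u z
  rw [this]
  fun_prop

/-! ### The Green–Jensen formula on a disc -/

section Jensen

variable {u : ℂ → ℝ} {ρ : ℝ}

theorem circleMap_zero_mem_ball {t : ℝ} (ht : t ∈ Ioo (-ρ) ρ) (θ : ℝ) :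
    circleMap 0 t θ ∈ Metric.ball (0 : ℂ) ρ := by
  simp [abs_lt.2 ht]

theorem hasDerivAt_circleMap_radius (c : ℂ) (t θ : ℝ) :
    HasDerivAt (fun t : ℝ => circleMap c t θ) (Complex.exp (θ * Complex.I)) t := by
  have h1 : HasDerivAt (fun t : ℝ => (t : ℂ)) 1 t := Complex.ofRealCLM.hasDerivAt
  simpa [circleMap] using (h1.mul_const (Complex.exp (θ * Complex.I))).const_add c

theorem continuousOn_comp_circleMap_uncurry {X : Type*} [TopologicalSpace X] {g : ℂ → X}
    (hg : ContinuousOn g (Metric.ball 0 ρ)) :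
    ContinuousOn (fun p : ℝ × ℝ => g (circleMap 0 p.1 p.2)) (Ioo (-ρ) ρ ×ˢ univ) :=
  hg.comp (by fun_prop) fun p hp => circleMap_zero_mem_ball hp.1 p.2

theorem continuous_comp_circleMap {X : Type*} [TopologicalSpace X] {g : ℂ → X}
    (hg : ContinuousOn g (Metric.ball 0 ρ)) {t : ℝ} (ht : t ∈ Ioo (-ρ) ρ) :
    Continuous (fun θ => g (circleMap 0 t θ)) :=
  hg.comp_continuous (continuous_circleMap 0 t) fun θ => circleMap_zero_mem_ball ht θ

/-- The derivative of the angular integral with respect to the radius. -/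
theorem hasDerivAt_integral_circleMap (hu : ContDiffOn ℝ 1 u (Metric.ball 0 ρ)) {t : ℝ}
    (ht : t ∈ Ioo (-ρ) ρ) :
    HasDerivAt (fun t => ∫ θ in (0 : ℝ)..2 * Real.pi, u (circleMap 0 t θ))
      (∫ θ in (0 : ℝ)..2 * Real.pi, fderiv ℝ u (circleMap 0 t θ) (Complex.exp (θ * Complex.I)))
      t := by
  have hfd : ContinuousOn (fderiv ℝ u) (Metric.ball 0 ρ) :=
    hu.continuousOn_fderiv_of_isOpen Metric.isOpen_ball le_rfl
  refine hasDerivAt_intervalIntegral_of_continuousOn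
    (G' := fun t θ => fderiv ℝ u (circleMap 0 t θ) (Complex.exp (θ * Complex.I)))
    isOpen_Ioo (fun t ht => continuous_comp_circleMap hu.continuousOn ht) ?_ ?_ ht
  · have := continuousOn_comp_circleMap_uncurry hfd
    exact this.clm_apply (by fun_prop)
  · intro t ht θ
    have hd : DifferentiableAt ℝ u (circleMap 0 t θ) :=
      (hu.contDiffAt (Metric.isOpen_ball.mem_nhds (circleMap_zero_mem_ball ht θ))).differentiableAt
        (by norm_num)
    exact hd.hasFDerivAt.comp_hasDerivAt t (hasDerivAt_circleMap_radius 0 t θ)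

theorem hasDerivAt_integral_radial (hu : ContDiffOn ℝ 2 u (Metric.ball 0 ρ)) {t : ℝ}
    (ht : t ∈ Ioo (-ρ) ρ) :
    HasDerivAt (fun t => ∫ θ in (0 : ℝ)..2 * Real.pi,
        fderiv ℝ u (circleMap 0 t θ) (Complex.exp (θ * Complex.I)))
      (∫ θ in (0 : ℝ)..2 * Real.pi, fderiv ℝ (fderiv ℝ u) (circleMap 0 t θ)
        (Complex.exp (θ * Complex.I)) (Complex.exp (θ * Complex.I))) t := by
  have h1 : ContDiffOn ℝ 1 (fderiv ℝ u) (Metric.ball 0 ρ) :=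
    hu.fderiv_of_isOpen Metric.isOpen_ball (by norm_num)
  have h2 : ContinuousOn (fderiv ℝ (fderiv ℝ u)) (Metric.ball 0 ρ) :=
    h1.continuousOn_fderiv_of_isOpen Metric.isOpen_ball le_rfl
  refine hasDerivAt_intervalIntegral_of_continuousOn
    (G' := fun t θ => fderiv ℝ (fderiv ℝ u) (circleMap 0 t θ)
        (Complex.exp (θ * Complex.I)) (Complex.exp (θ * Complex.I)))
    isOpen_Ioo (fun t ht => ?_) ?_ ?_ ht
  · have := continuous_comp_circleMap h1.continuousOn ht
    exact this.clm_apply (by fun_prop)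
  · have := continuousOn_comp_circleMap_uncurry h2
    exact (this.clm_apply (by fun_prop)).clm_apply (by fun_prop)
  · intro t ht θ
    have hd : DifferentiableAt ℝ (fderiv ℝ u) (circleMap 0 t θ) :=
      (h1.contDiffAt (Metric.isOpen_ball.mem_nhds (circleMap_zero_mem_ball ht θ))).differentiableAt
        (by norm_num)
    have := hd.hasFDerivAt.comp_hasDerivAt t (hasDerivAt_circleMap_radius 0 t θ)
    exact this.clm_apply (hasDerivAt_const t _) |>.congr_deriv (by simp)

/-- With `e = exp (i θ)`, the periodic function `θ ↦ Du(t e)(t i e)` has derivative `t² D²u(i e, i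
e) - t Du(e)`, whose integral over a period is zero. -/
theorem integral_angular_eq (hu : ContDiffOn ℝ 2 u (Metric.ball 0 ρ)) {t : ℝ}
    (ht : t ∈ Ioo (-ρ) ρ) (ht0 : t ≠ 0) :
    t * ∫ θ in (0 : ℝ)..2 * Real.pi, fderiv ℝ (fderiv ℝ u) (circleMap 0 t θ)
        (Complex.I * Complex.exp (θ * Complex.I)) (Complex.I * Complex.exp (θ * Complex.I)) =
      ∫ θ in (0 : ℝ)..2 * Real.pi,
        fderiv ℝ u (circleMap 0 t θ) (Complex.exp (θ * Complex.I)) := by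
  have h1 : ContDiffOn ℝ 1 (fderiv ℝ u) (Metric.ball 0 ρ) :=
    hu.fderiv_of_isOpen Metric.isOpen_ball (by norm_num)
  have h2 : ContinuousOn (fderiv ℝ (fderiv ℝ u)) (Metric.ball 0 ρ) :=
    h1.continuousOn_fderiv_of_isOpen Metric.isOpen_ball le_rfl
  have c1 := continuous_comp_circleMap h1.continuousOn ht
  have c2 := continuous_comp_circleMap h2 ht
  set e : ℝ → ℂ := fun θ => Complex.exp (θ * Complex.I) with he
  have ce : Continuous e := by fun_prop
  have de : ∀ θ, HasDerivAt e (Complex.I * e θ) θ := by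
    intro θ
    have h1 : HasDerivAt (fun t : ℝ => (t : ℂ)) 1 θ := Complex.ofRealCLM.hasDerivAt
    have := (h1.mul_const Complex.I).cexp
    simpa [he, mul_comm] using this
  have hcm : ∀ θ, circleMap 0 t θ = t • e θ := fun θ => by simp [circleMap, he]
  have dz : ∀ θ, HasDerivAt (fun θ => circleMap 0 t θ) (t • (Complex.I * e θ)) θ := by
    intro θ
    have := (de θ).const_smul t
    exact this.congr_of_eventuallyEq (Eventually.of_forall hcm)
  have key : ∫ θ in (0 : ℝ)..2 * Real.pi,
      (t * (t * fderiv ℝ (fderiv ℝ u) (circleMap 0 t θ) (Complex.I * e θ) (Complex.I * e θ))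
        - t * fderiv ℝ u (circleMap 0 t θ) (e θ)) = 0 := by
    have hder : ∀ θ ∈ uIcc (0 : ℝ) (2 * Real.pi), HasDerivAt
        (fun θ => fderiv ℝ u (circleMap 0 t θ) (t • (Complex.I * e θ)))
        (t * (t * fderiv ℝ (fderiv ℝ u) (circleMap 0 t θ) (Complex.I * e θ) (Complex.I * e θ))
        - t * fderiv ℝ u (circleMap 0 t θ) (e θ)) θ := by
      intro θ _
      have hd : DifferentiableAt ℝ (fderiv ℝ u) (circleMap 0 t θ) :=
        (h1.contDiffAt (Metric.isOpen_ball.mem_nhds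
          (circleMap_zero_mem_ball ht θ))).differentiableAt (by norm_num)
      have a1 := hd.hasFDerivAt.comp_hasDerivAt θ (dz θ)
      have a2 : HasDerivAt (fun θ => t • (Complex.I * e θ)) (t • (-e θ)) θ := by
        refine (((de θ).const_mul Complex.I).const_smul t).congr_deriv ?_
        rw [← mul_assoc, Complex.I_mul_I]; simp
      refine (a1.clm_apply a2).congr_deriv ?_
      simp only [map_smul, map_neg, smul_apply, smul_eq_mul, Function.comp]
      ring
    rw [intervalIntegral.integral_eq_sub_of_hasDerivAt hder]
    · simp [circleMap, he]
    · apply Continuous.intervalIntegrable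
      have b1 : Continuous fun θ => Complex.I * e θ := by fun_prop
      exact (continuous_const.mul (continuous_const.mul ((c2.clm_apply b1).clm_apply b1))).sub
        (continuous_const.mul (c1.clm_apply ce))
  have b1 : Continuous fun θ => Complex.I * e θ := by fun_prop
  have i1 : Continuous fun θ =>
      t * (t * fderiv ℝ (fderiv ℝ u) (circleMap 0 t θ) (Complex.I * e θ) (Complex.I * e θ)) :=
    continuous_const.mul (continuous_const.mul ((c2.clm_apply b1).clm_apply b1))
  have i2 : Continuous fun θ => t * fderiv ℝ u (circleMap 0 t θ) (e θ) :=
    continuous_const.mul (c1.clm_apply ce)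
  rw [intervalIntegral.integral_sub (i1.intervalIntegrable _ _) (i2.intervalIntegrable _ _),
    intervalIntegral.integral_const_mul, intervalIntegral.integral_const_mul,
    intervalIntegral.integral_const_mul, ← mul_sub] at key
  have := (mul_eq_zero.1 key).resolve_left ht0
  linarith

/-- **Green–Jensen formula** for a `C²` function on a disc. -/
theorem circleAverage_sub_circleAverage_eq (hu : ContDiffOn ℝ 2 u (Metric.ball 0 ρ)) {r₀ r : ℝ}
    (h0 : 0 < r₀) (h1 : r₀ ≤ r) (h2 : r < ρ) :
    Real.circleAverage u 0 r - Real.circleAverage u 0 r₀ =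
      ∫ t in r₀..r, (∫ τ in (0 : ℝ)..t,
        τ * Real.circleAverage (Laplacian.laplacian u) 0 τ) / t := by
  have hlap := continuousOn_laplacian Metric.isOpen_ball hu
  have hmean : ContinuousOn (Real.circleAverage (Laplacian.laplacian u) 0) (Ico 0 ρ) := by
    refine Real.ContinuousOn.circleAverage (hlap.mono fun z hz => ?_) fun r hr => hr.1
    simpa using hz.2
  set A : ℝ → ℝ := fun t => ∫ θ in (0 : ℝ)..2 * Real.pi,
    fderiv ℝ u (circleMap 0 t θ) (Complex.exp (θ * Complex.I)) with hA
  have dA : ∀ t ∈ Ioo (-ρ) ρ, HasDerivAt A _ t := fun t ht => hasDerivAt_integral_radial hu ht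
  have hfst : ContDiffOn ℝ 1 (fderiv ℝ u) (Metric.ball 0 ρ) :=
    hu.fderiv_of_isOpen Metric.isOpen_ball (by norm_num)
  have hsnd : ContinuousOn (fderiv ℝ (fderiv ℝ u)) (Metric.ball 0 ρ) :=
    hfst.continuousOn_fderiv_of_isOpen Metric.isOpen_ball le_rfl
  -- The product rule gives `A + t A'`. Here `A'` integrates the radial second derivative, and `A`
  -- equals `t` times the integral of the tangential one, so together they give the Laplacian.
  have hdt : ∀ t, 0 < t → t < ρ → HasDerivAt (fun t => t * A t)
      (2 * Real.pi * (t * Real.circleAverage (Laplacian.laplacian u) 0 t)) t := by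
    intro t ht htρ
    have htm : t ∈ Ioo (-ρ) ρ := ⟨by linarith, htρ⟩
    refine ((hasDerivAt_id' t).mul (dA t htm)).congr_deriv ?_
    rw [hA]
    simp only
    rw [← integral_angular_eq hu htm ht.ne', Real.circleAverage_def]
    have c2 := continuous_comp_circleMap hsnd htm
    have ce : Continuous fun θ : ℝ => Complex.exp (θ * Complex.I) := by fun_prop
    have ci : Continuous fun θ : ℝ => Complex.I * Complex.exp (θ * Complex.I) := by fun_prop
    have : ∀ θ : ℝ, Laplacian.laplacian u (circleMap 0 t θ) = _ := fun θ =>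
      laplacian_eq_fderiv_fderiv_of_norm_one u (circleMap 0 t θ)
        (e := Complex.exp (θ * Complex.I)) (Complex.norm_exp_ofReal_mul_I θ)
    simp only [this]
    rw [intervalIntegral.integral_add
      (((c2.clm_apply ce).clm_apply ce).intervalIntegrable _ _)
      (((c2.clm_apply ci).clm_apply ci).intervalIntegrable _ _)]
    simp only [smul_eq_mul]
    field_simp
    ring
  have hint : ∀ t, 0 < t → t < ρ → t * A t = 2 * Real.pi *
      ∫ τ in (0 : ℝ)..t, τ * Real.circleAverage (Laplacian.laplacian u) 0 τ := by
    intro t ht htρ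
    have hcont : ContinuousOn (fun t => t * A t) (Icc 0 t) := by
      intro s hs
      have hs' : s ∈ Ioo (-ρ) ρ := ⟨by linarith [hs.1], by linarith [hs.2]⟩
      exact (continuousAt_id.mul (dA s hs').continuousAt).continuousWithinAt
    have := intervalIntegral.integral_eq_sub_of_hasDerivAt_of_le ht.le hcont
      (fun s hs => hdt s hs.1 (hs.2.trans htρ)) ?_
    · rw [intervalIntegral.integral_const_mul] at this
      simp only [zero_mul, sub_zero] at this
      exact this.symm
    · apply ContinuousOn.intervalIntegrable
      rw [uIcc_of_le ht.le]
      exact continuousOn_const.mul (continuousOn_id.mul (hmean.mono fun s hs =>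
        ⟨hs.1, hs.2.trans_lt htρ⟩))
  have hmem : ∀ t ∈ Icc r₀ r, t ∈ Ioo (-ρ) ρ := fun t ht =>
    ⟨by linarith [ht.1], by linarith [ht.2]⟩
  have hM : ∀ t ∈ uIcc r₀ r, HasDerivAt (Real.circleAverage u 0)
      ((2 * Real.pi)⁻¹ * A t) t := by
    intro t ht
    rw [uIcc_of_le h1] at ht
    have := (hasDerivAt_integral_circleMap (hu.of_le (by norm_num)) (hmem t ht)).const_mul
      (2 * Real.pi)⁻¹
    exact this
  rw [← intervalIntegral.integral_eq_sub_of_hasDerivAt hM]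
  · apply intervalIntegral.integral_congr
    intro t ht
    rw [uIcc_of_le h1] at ht
    have ht0 : 0 < t := h0.trans_le ht.1
    have := hint t ht0 (ht.2.trans_lt h2)
    simp only
    rw [eq_div_iff ht0.ne', mul_assoc, mul_comm (A t) t, this]
    field_simp
  · apply ContinuousOn.intervalIntegrable
    rw [uIcc_of_le h1]
    exact continuousOn_const.mul fun t ht => (dA t (hmem t ht)).continuousAt.continuousWithinAt

end Jensen

/-! ### Laplacians of logarithms of sums of squared moduli -/

theorem laplacian_eq_fderiv_apply {u : ℂ → ℝ} {z : ℂ} (hu : ContDiffAt ℝ 2 u z) :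
    Laplacian.laplacian u z = fderiv ℝ (fun w => fderiv ℝ u w 1) z 1
      + fderiv ℝ (fun w => fderiv ℝ u w Complex.I) z Complex.I := by
  have h1 : DifferentiableAt ℝ (fderiv ℝ u) z :=
    (hu.fderiv_right (m := 1) (by norm_num)).differentiableAt (by norm_num)
  rw [laplacian_eq_fderiv_fderiv, fderiv_clm_apply h1 (by fun_prop),
    fderiv_clm_apply h1 (by fun_prop)]
  simp

theorem laplacian_log {u : ℂ → ℝ} {z : ℂ} (hu : ContDiffAt ℝ 2 u z) (hz : 0 < u z) :
    Laplacian.laplacian (fun w => Real.log (u w)) z = Laplacian.laplacian u z / u z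
      - ((fderiv ℝ u z 1) ^ 2 + (fderiv ℝ u z Complex.I) ^ 2) / u z ^ 2 := by
  have hlog : ContDiffAt ℝ 2 (fun w => Real.log (u w)) z := hu.log hz.ne'
  have hev : ∀ᶠ w in 𝓝 z, ∀ v, fderiv ℝ (fun w => Real.log (u w)) w v
      = (u w)⁻¹ * fderiv ℝ u w v := by
    filter_upwards [hu.eventually (by simp), hu.continuousAt.eventually_ne hz.ne'] with w hw hw0 v
    rw [fderiv.log (hw.differentiableAt (by norm_num)) hw0]
    simp
  have hd : DifferentiableAt ℝ u z := hu.differentiableAt (by norm_num)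
  have hd' : DifferentiableAt ℝ (fderiv ℝ u) z :=
    (hu.fderiv_right (m := 1) (by norm_num)).differentiableAt (by norm_num)
  have key : ∀ v, fderiv ℝ (fun w => fderiv ℝ (fun w => Real.log (u w)) w v) z v
      = (u z)⁻¹ * fderiv ℝ (fun w => fderiv ℝ u w v) z v - (fderiv ℝ u z v) ^ 2 / u z ^ 2 := by
    intro v
    have e : (fun w => fderiv ℝ (fun w => Real.log (u w)) w v)
        =ᶠ[𝓝 z] fun w => (u w)⁻¹ * fderiv ℝ u w v := by
      filter_upwards [hev] with w hw using hw v
    rw [e.fderiv_eq]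
    have h1 : HasFDerivAt (fun w => (u w)⁻¹) _ z :=
      (hasDerivAt_inv hz.ne').comp_hasFDerivAt z hd.hasFDerivAt
    have h2 : HasFDerivAt (fun w => fderiv ℝ u w v) _ z :=
      (hd'.clm_apply (differentiableAt_const v)).hasFDerivAt
    rw [(h1.fun_mul h2).fderiv]
    simp only [add_apply, smul_apply, smul_eq_mul]
    field_simp
    ring
  rw [laplacian_eq_fderiv_apply hlog, key, key, laplacian_eq_fderiv_apply hu]
  ring

theorem hasFDerivAt_real_of_differentiableAt {k : ℂ → ℂ} {z : ℂ} (hk : DifferentiableAt ℂ k z) :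
    HasFDerivAt k ((deriv k z • (1 : ℂ →L[ℂ] ℂ)).restrictScalars ℝ) z := by
  have := hk.hasDerivAt.hasFDerivAt.restrictScalars ℝ
  convert! this using 1
  ext; simp [mul_comm]

theorem fderiv_norm_sq_comp_apply {g : ℂ → ℂ} {z : ℂ} (hg : DifferentiableAt ℂ g z) (v : ℂ) :
    fderiv ℝ (fun w => ‖g w‖ ^ 2) z v = 2 * (conj (g z) * deriv g z * v).re := by
  rw [(hasFDerivAt_real_of_differentiableAt hg).norm_sq.fderiv]
  simp [Complex.inner]
  ring

theorem contDiffAt_norm_sq {g : ℂ → ℂ} {z : ℂ} (hg : AnalyticAt ℂ g z) {n : WithTop ℕ∞} :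
    ContDiffAt ℝ n (fun w => ‖g w‖ ^ 2) z :=
  (hg.restrictScalars (𝕜 := ℝ)).contDiffAt.norm_sq ℝ

theorem laplacian_norm_sq {g : ℂ → ℂ} {z : ℂ} (hg : AnalyticAt ℂ g z) :
    Laplacian.laplacian (fun w => ‖g w‖ ^ 2) z = 4 * ‖deriv g z‖ ^ 2 := by
  rw [laplacian_eq_fderiv_apply (contDiffAt_norm_sq hg)]
  have key : ∀ v, fderiv ℝ (fun w => fderiv ℝ (fun w => ‖g w‖ ^ 2) w v) z v
      = 2 * ((conj (deriv g z * v) * deriv g z * v).re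
        + (conj (g z) * deriv (deriv g) z * v ^ 2).re) := by
    intro v
    have e : (fun w => fderiv ℝ (fun w => ‖g w‖ ^ 2) w v)
        =ᶠ[𝓝 z] fun w => 2 * Complex.reCLM (conj (g w) * deriv g w * v) := by
      filter_upwards [hg.eventually_analyticAt] with w hw
      exact fderiv_norm_sq_comp_apply hw.differentiableAt v
    rw [e.fderiv_eq]
    have h1 := hasFDerivAt_real_of_differentiableAt hg.differentiableAt
    have h2 := hasFDerivAt_real_of_differentiableAt hg.deriv.differentiableAt
    have h3 : HasFDerivAt (fun w => conj (g w)) _ z :=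
      (Complex.conjCLE.toContinuousLinearMap.hasFDerivAt).comp z h1
    have h4 := ((Complex.reCLM.hasFDerivAt.comp z ((h3.fun_mul h2).mul_const v)).const_mul 2).fderiv
    simp only [Function.comp_def] at h4
    rw [h4]
    simp [pow_two]
    ring
  rw [key, key]
  have := Complex.sq_norm (deriv g z)
  rw [Complex.normSq_apply] at this
  rw [this]
  simp [pow_two]
  ring

/-- The weighted sum `α |g₀|² + β |g₁|²`. -/
noncomputable def weightedNormSq (g₀ g₁ : ℂ → ℂ) (α β : ℝ) (z : ℂ) : ℝ :=
  α * ‖g₀ z‖ ^ 2 + β * ‖g₁ z‖ ^ 2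

/-- The Wronskian `g₀ g₁' - g₀' g₁`. -/
noncomputable def wronskian (g₀ g₁ : ℂ → ℂ) (z : ℂ) : ℂ :=
  g₀ z * deriv g₁ z - deriv g₀ z * g₁ z

section Weighted

variable {g₀ g₁ : ℂ → ℂ} {z : ℂ} {α β : ℝ}

theorem contDiffAt_weightedNormSq (h₀ : AnalyticAt ℂ g₀ z) (h₁ : AnalyticAt ℂ g₁ z)
    {n : WithTop ℕ∞} : ContDiffAt ℝ n (weightedNormSq g₀ g₁ α β) z :=
  (contDiffAt_const.mul (contDiffAt_norm_sq h₀)).add (contDiffAt_const.mul (contDiffAt_norm_sq h₁))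

theorem fderiv_weightedNormSq_apply (h₀ : AnalyticAt ℂ g₀ z) (h₁ : AnalyticAt ℂ g₁ z) (v : ℂ) :
    fderiv ℝ (weightedNormSq g₀ g₁ α β) z v =
      2 * ((α * (conj (g₀ z) * deriv g₀ z) + β * (conj (g₁ z) * deriv g₁ z)) * v).re := by
  have d₀ : DifferentiableAt ℝ (fun w => ‖g₀ w‖ ^ 2) z :=
    (contDiffAt_norm_sq (n := 1) h₀).differentiableAt (by norm_num)
  have d₁ : DifferentiableAt ℝ (fun w => ‖g₁ w‖ ^ 2) z :=
    (contDiffAt_norm_sq (n := 1) h₁).differentiableAt (by norm_num)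
  have := ((d₀.hasFDerivAt.const_mul α).add (d₁.hasFDerivAt.const_mul β)).fderiv
  have e : weightedNormSq g₀ g₁ α β =
    (fun w => α * ‖g₀ w‖ ^ 2) + (fun w => β * ‖g₁ w‖ ^ 2) := rfl
  rw [e, this]
  simp only [add_apply, smul_apply, smul_eq_mul,
    fderiv_norm_sq_comp_apply h₀.differentiableAt, fderiv_norm_sq_comp_apply h₁.differentiableAt]
  simp
  ring

theorem laplacian_weightedNormSq (h₀ : AnalyticAt ℂ g₀ z) (h₁ : AnalyticAt ℂ g₁ z) :
    Laplacian.laplacian (weightedNormSq g₀ g₁ α β) z =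
      4 * (α * ‖deriv g₀ z‖ ^ 2 + β * ‖deriv g₁ z‖ ^ 2) := by
  have e : weightedNormSq g₀ g₁ α β =
    α • (fun w => ‖g₀ w‖ ^ 2) + β • (fun w => ‖g₁ w‖ ^ 2) := by
    ext w; simp [weightedNormSq]
  have c₀ : ContDiffAt ℝ 2 (α • fun w => ‖g₀ w‖ ^ 2) z := (contDiffAt_norm_sq h₀).const_smul α
  have c₁ : ContDiffAt ℝ 2 (β • fun w => ‖g₁ w‖ ^ 2) z := (contDiffAt_norm_sq h₁).const_smul β
  rw [e, c₀.laplacian_add c₁,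
    InnerProductSpace.laplacian_smul _ (contDiffAt_norm_sq h₀),
    InnerProductSpace.laplacian_smul _ (contDiffAt_norm_sq h₁),
    laplacian_norm_sq h₀, laplacian_norm_sq h₁]
  simp
  ring

theorem re_sq_add_re_mul_I_sq (P : ℂ) :
    (2 * (P * 1).re) ^ 2 + (2 * (P * Complex.I).re) ^ 2 = 4 * ‖P‖ ^ 2 := by
  rw [Complex.sq_norm, Complex.normSq_apply]
  simp
  ring

/-- Lagrange's identity: the defect in the Cauchy–Schwarz inequality for the vectors `(g₀, g₁)` and
`(g₀', g₁')`, with weights `α` and `β`, is `α β |g₀ g₁' - g₀' g₁|²`. -/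
theorem laplacian_log_weightedNormSq (h₀ : AnalyticAt ℂ g₀ z) (h₁ : AnalyticAt ℂ g₁ z)
    (hpos : 0 < weightedNormSq g₀ g₁ α β z) :
    Laplacian.laplacian (fun w => Real.log (weightedNormSq g₀ g₁ α β w)) z =
      4 * (α * β) * ‖wronskian g₀ g₁ z‖ ^ 2 / weightedNormSq g₀ g₁ α β z ^ 2 := by
  rw [laplacian_log (contDiffAt_weightedNormSq h₀ h₁) hpos, laplacian_weightedNormSq h₀ h₁,
    fderiv_weightedNormSq_apply h₀ h₁, fderiv_weightedNormSq_apply h₀ h₁, re_sq_add_re_mul_I_sq]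
  rw [div_sub_div _ _ hpos.ne' (by positivity), div_eq_div_iff (by positivity) (by positivity)]
  have key : (4 * (α * ‖deriv g₀ z‖ ^ 2 + β * ‖deriv g₁ z‖ ^ 2)) * weightedNormSq g₀ g₁ α β z
      - 4 * ‖α * (conj (g₀ z) * deriv g₀ z) + β * (conj (g₁ z) * deriv g₁ z)‖ ^ 2
      = 4 * (α * β) * ‖wronskian g₀ g₁ z‖ ^ 2 := by
    simp only [weightedNormSq, wronskian, Complex.sq_norm, Complex.normSq_apply]
    simp
    ring
  linear_combination (weightedNormSq g₀ g₁ α β z ^ 3) * key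

/-- The potential used in the proof of the second main theorem: the Laplacian of `-log y`, where
`y = A + log N - log N_ε`, is bounded below by a multiple of the Fubini-Study density with a
pole of almost maximal order at the zeros of `g₀`. -/
theorem le_laplacian_neg_log (h₀ : AnalyticAt ℂ g₀ z) (h₁ : AnalyticAt ℂ g₁ z) {ε A : ℝ}
    (hε : 0 < ε) (hN : 0 < weightedNormSq g₀ g₁ 1 1 z)
    (hy : 1 ≤ A + Real.log (weightedNormSq g₀ g₁ 1 1 z)
      - Real.log (weightedNormSq g₀ g₁ (1 + ε) ε z)) :
    4 * (‖wronskian g₀ g₁ z‖ ^ 2 * ‖g₀ z‖ ^ 2 * ‖g₁ z‖ ^ 2 /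
        (weightedNormSq g₀ g₁ 1 1 z ^ 2 * weightedNormSq g₀ g₁ (1 + ε) ε z ^ 2 *
          (A + Real.log (weightedNormSq g₀ g₁ 1 1 z)
            - Real.log (weightedNormSq g₀ g₁ (1 + ε) ε z)) ^ 2)) ≤
      Laplacian.laplacian (fun w => -Real.log (A + Real.log (weightedNormSq g₀ g₁ 1 1 w)
        - Real.log (weightedNormSq g₀ g₁ (1 + ε) ε w))) z
      + Laplacian.laplacian (fun w => Real.log (weightedNormSq g₀ g₁ 1 1 w)) z := by
  set N := weightedNormSq g₀ g₁ 1 1 with hNdef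
  set M := weightedNormSq g₀ g₁ (1 + ε) ε with hMdef
  have hM : 0 < M z := by
    have : M z = ‖g₀ z‖ ^ 2 + ε * N z := by simp only [hNdef, hMdef, weightedNormSq]; ring
    rw [this]; positivity
  set y : ℂ → ℝ := fun w => A + Real.log (N w) - Real.log (M w) with hydef
  have cN : ContDiffAt ℝ 2 N z := contDiffAt_weightedNormSq h₀ h₁
  have cM : ContDiffAt ℝ 2 M z := contDiffAt_weightedNormSq h₀ h₁
  have clN : ContDiffAt ℝ 2 (fun w => Real.log (N w)) z := cN.log hN.ne'
  have clM : ContDiffAt ℝ 2 (fun w => Real.log (M w)) z := cM.log hM.ne'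
  have cy : ContDiffAt ℝ 2 y z := (contDiffAt_const.add clN).sub clM
  have hy0 : 0 < y z := lt_of_lt_of_le one_pos hy
  have Ly : Laplacian.laplacian y z = 4 * (1 * 1) * ‖wronskian g₀ g₁ z‖ ^ 2 / N z ^ 2
      - 4 * ((1 + ε) * ε) * ‖wronskian g₀ g₁ z‖ ^ 2 / M z ^ 2 := by
    have e : y = (fun _ => A) + (fun w => Real.log (N w)) - fun w => Real.log (M w) := rfl
    have cA : ContDiffAt ℝ 2 (fun _ : ℂ => A) z := contDiffAt_const
    have cAN : ContDiffAt ℝ 2 ((fun _ : ℂ => A) + fun w => Real.log (N w)) z := cA.add clN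
    rw [e, cAN.laplacian_sub clM, cA.laplacian_add clN, InnerProductSpace.laplacian_const,
      laplacian_log_weightedNormSq h₀ h₁ hN, laplacian_log_weightedNormSq h₀ h₁ hM]
    simp [hNdef, hMdef]
  have Dy : ∀ v, fderiv ℝ y z v = 2 * ((((1 : ℝ) * (conj (g₀ z) * deriv g₀ z)
        + (1 : ℝ) * (conj (g₁ z) * deriv g₁ z)) / (N z : ℂ)
      - (((1 + ε : ℝ) : ℂ) * (conj (g₀ z) * deriv g₀ z) + (ε : ℝ) * (conj (g₁ z) * deriv g₁ z))
        / (M z : ℂ)) * v).re := by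
    intro v
    have dN : HasFDerivAt (fun w => Real.log (N w)) _ z :=
      (cN.differentiableAt (by norm_num)).hasFDerivAt.log hN.ne'
    have dM : HasFDerivAt (fun w => Real.log (M w)) _ z :=
      (cM.differentiableAt (by norm_num)).hasFDerivAt.log hM.ne'
    have := ((dN.const_add A).sub dM).fderiv
    have e : y = (fun w => A + Real.log (N w)) - fun w => Real.log (M w) := rfl
    rw [e, this]
    simp only [sub_apply, smul_apply, smul_eq_mul, hNdef, hMdef]
    rw [fderiv_weightedNormSq_apply h₀ h₁, fderiv_weightedNormSq_apply h₀ h₁, sub_mul,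
      Complex.sub_re, div_mul_eq_mul_div, div_mul_eq_mul_div, Complex.div_ofReal_re,
      Complex.div_ofReal_re]
    ring
  have Gy : (fderiv ℝ y z 1) ^ 2 + (fderiv ℝ y z Complex.I) ^ 2 =
      4 * (‖wronskian g₀ g₁ z‖ ^ 2 * ‖g₀ z‖ ^ 2 * ‖g₁ z‖ ^ 2 / (N z ^ 2 * M z ^ 2)) := by
    rw [Dy, Dy, re_sq_add_re_mul_I_sq]
    have hNc : (N z : ℂ) ≠ 0 := by exact_mod_cast hN.ne'
    have hMc : (M z : ℂ) ≠ 0 := by exact_mod_cast hM.ne'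
    rw [div_sub_div _ _ hNc hMc]
    -- The `ε`-terms of `M = |g₀|² + ε N` cancel against `N`, and only the crossed products of `g₀`
    -- and `g₁` survive.
    have : (((1 : ℝ) * (conj (g₀ z) * deriv g₀ z) + (1 : ℝ) * (conj (g₁ z) * deriv g₁ z))
          * (M z : ℂ) - (N z : ℂ) * (((1 + ε : ℝ) : ℂ) * (conj (g₀ z) * deriv g₀ z)
          + (ε : ℝ) * (conj (g₁ z) * deriv g₁ z)))
        = conj (g₀ z) * conj (g₁ z) * wronskian g₀ g₁ z := by
      simp only [hNdef, hMdef, weightedNormSq, wronskian]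
      push_cast
      rw [← Complex.conj_mul', ← Complex.conj_mul']
      ring
    rw [this, norm_div]
    simp only [norm_mul, RCLike.norm_conj, Complex.norm_real, Real.norm_eq_abs, div_pow, mul_pow,
      sq_abs]
    ring
  have e : (fun w => -Real.log (A + Real.log (N w) - Real.log (M w)))
      = -(fun w => Real.log (y w)) := rfl
  rw [e, InnerProductSpace.laplacian_neg, Pi.neg_apply, laplacian_log cy hy0, Ly, Gy,
    laplacian_log_weightedNormSq h₀ h₁ hN]
  change 4 * (_ / (_ * _ * y z ^ 2)) ≤ _
  set w2 := ‖wronskian g₀ g₁ z‖ ^ 2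
  have hw2 : 0 ≤ w2 := by positivity
  -- In `Δ(-log y) = -Δy / y + |∇y|² / y²` the gradient term is the desired bound. The other one is
  -- compensated by `Δ log N`, because `Δy ≤ Δ log N` and `y ≥ 1`.
  have h1 : 4 * (1 * 1) * w2 / N z ^ 2 - (4 * (1 * 1) * w2 / N z ^ 2
      - 4 * ((1 + ε) * ε) * w2 / M z ^ 2) / y z ≥ 0 := by
    have a1 : 0 ≤ 4 * (1 * 1) * w2 / N z ^ 2 := by positivity
    have a2 : 0 ≤ 4 * ((1 + ε) * ε) * w2 / M z ^ 2 := by positivity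
    have a3 : (4 * (1 * 1) * w2 / N z ^ 2 - 4 * ((1 + ε) * ε) * w2 / M z ^ 2) / y z
        ≤ 4 * (1 * 1) * w2 / N z ^ 2 := by
      rw [div_le_iff₀ hy0]
      nlinarith
    linarith
  have h2 : 4 * (w2 * ‖g₀ z‖ ^ 2 * ‖g₁ z‖ ^ 2 / (N z ^ 2 * M z ^ 2 * y z ^ 2))
      = 4 * (w2 * ‖g₀ z‖ ^ 2 * ‖g₁ z‖ ^ 2 / (N z ^ 2 * M z ^ 2)) / y z ^ 2 := by
    field_simp
  rw [h2]
  linarith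

end Weighted

/-! ### Holomorphic changes of variable and polar coordinates -/

theorem fderiv_fderiv_add_mul_I (u : ℂ → ℝ) (z a : ℂ) :
    fderiv ℝ (fderiv ℝ u) z a a + fderiv ℝ (fderiv ℝ u) z (Complex.I * a) (Complex.I * a) =
      ‖a‖ ^ 2 * Laplacian.laplacian u z := by
  rcases eq_or_ne a 0 with rfl | ha
  · simp
  have hn : ‖a‖ ≠ 0 := norm_ne_zero_iff.2 ha
  have h1 : ‖(‖a‖⁻¹ : ℝ) • a‖ = 1 := by rw [norm_smul]; simp [hn]
  have e : a = ‖a‖ • ((‖a‖⁻¹ : ℝ) • a) := by rw [smul_smul, mul_inv_cancel₀ hn, one_smul]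
  rw [laplacian_eq_fderiv_fderiv_of_norm_one u z h1]
  generalize (‖a‖⁻¹ : ℝ) • a = b at *
  generalize ‖a‖ = c at *
  subst e
  rw [mul_smul_comm]
  simp only [map_smul, smul_apply, smul_eq_mul]
  ring

/-- The chain rule for the Laplacian and a holomorphic change of variables. -/
theorem laplacian_comp_analyticAt {u : ℂ → ℝ} {k : ℂ → ℂ} {z : ℂ} (hk : AnalyticAt ℂ k z)
    (hu : ContDiffAt ℝ 2 u (k z)) :
    Laplacian.laplacian (fun w => u (k w)) z =
      ‖deriv k z‖ ^ 2 * Laplacian.laplacian u (k z) := by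
  have hkr : ContDiffAt ℝ 2 k z := (hk.restrictScalars (𝕜 := ℝ)).contDiffAt
  have hev : ∀ᶠ w in 𝓝 z, ∀ v, fderiv ℝ (fun w => u (k w)) w v
      = fderiv ℝ u (k w) (deriv k w * v) := by
    filter_upwards [hk.eventually_analyticAt,
      hk.continuousAt.eventually (hu.eventually (by simp))] with w hw hw' v
    have := ((hw'.differentiableAt (by norm_num)).hasFDerivAt.comp w
      (hasFDerivAt_real_of_differentiableAt hw.differentiableAt)).fderiv
    simp only [Function.comp_def] at this
    rw [this]
    simp
  have hd' : DifferentiableAt ℝ (fderiv ℝ u) (k z) :=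
    (hu.fderiv_right (m := 1) (by norm_num)).differentiableAt (by norm_num)
  have key : ∀ v, fderiv ℝ (fun w => fderiv ℝ (fun w => u (k w)) w v) z v
      = fderiv ℝ (fderiv ℝ u) (k z) (deriv k z * v) (deriv k z * v)
        + fderiv ℝ u (k z) (deriv (deriv k) z * v ^ 2) := by
    intro v
    have e : (fun w => fderiv ℝ (fun w => u (k w)) w v)
        =ᶠ[𝓝 z] fun w => fderiv ℝ u (k w) (deriv k w * v) := by
      filter_upwards [hev] with w hw using hw v
    rw [e.fderiv_eq]
    have h1 := hd'.hasFDerivAt.comp z (hasFDerivAt_real_of_differentiableAt hk.differentiableAt)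
    have h2 := (hasFDerivAt_real_of_differentiableAt hk.deriv.differentiableAt).mul_const v
    have h3 := (h1.clm_apply h2).fderiv
    simp only [Function.comp_def] at h3
    rw [h3]
    simp
    have : v * (deriv (deriv k) z * v) = deriv (deriv k) z * v ^ 2 := by ring
    rw [this]
    ring
  have hc : ContDiffAt ℝ 2 (fun w => u (k w)) z := hu.comp z hkr
  rw [laplacian_eq_fderiv_apply hc, key, key, ← fderiv_fderiv_add_mul_I u (k z) (deriv k z)]
  -- The first-order terms, which contain `k''`, cancel between the directions `1` and `i`, as `i² =
  -- -1`.
  have : deriv (deriv k) z * Complex.I ^ 2 = -(deriv (deriv k) z * 1 ^ 2) := by simp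
  rw [this, map_neg, mul_comm Complex.I]
  simp
  ring

theorem polarCoord_symm_eq_circleMap (p : ℝ × ℝ) :
    Complex.polarCoord.symm p = circleMap 0 p.1 p.2 := by
  rw [Complex.polarCoord_symm_apply, circleMap, Complex.exp_mul_I]
  simp

theorem setIntegral_ball_eq_integral_circleAverage {g : ℂ → ℝ} {ρ t : ℝ}
    (hg : ContinuousOn g (Metric.ball 0 ρ)) (ht0 : 0 ≤ t) (ht : t < ρ) :
    ∫ z in Metric.ball (0 : ℂ) t, g z =
      2 * Real.pi * ∫ τ in (0 : ℝ)..t, τ * Real.circleAverage g 0 τ := by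
  rw [← integral_indicator measurableSet_ball, ← Complex.integral_comp_polarCoord_symm]
  have e1 : ∫ p in polarCoord.target, p.1 •
      (Metric.ball (0 : ℂ) t).indicator g (Complex.polarCoord.symm p)
      = ∫ p in Ioo 0 t ×ˢ Ioo (-Real.pi) Real.pi, p.1 * g (circleMap 0 p.1 p.2) := by
    have hsub : Ioo 0 t ×ˢ Ioo (-Real.pi) Real.pi ⊆ polarCoord.target :=
      prod_mono Ioo_subset_Ioi_self le_rfl
    rw [setIntegral_eq_of_subset_of_forall_sdiff_eq_zero
      (polarCoord.open_target.measurableSet) hsub]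
    · refine setIntegral_congr_fun (measurableSet_Ioo.prod measurableSet_Ioo) fun p hp => ?_
      have : circleMap 0 p.1 p.2 ∈ Metric.ball (0 : ℂ) t :=
        circleMap_zero_mem_ball ⟨by linarith [hp.1.1], hp.1.2⟩ p.2
      simp only [polarCoord_symm_eq_circleMap, indicator_of_mem this, smul_eq_mul]
    · intro p hp
      have : circleMap 0 p.1 p.2 ∉ Metric.ball (0 : ℂ) t := by
        intro hmem
        have h1 : 0 < p.1 := hp.1.1
        refine hp.2 ⟨⟨h1, ?_⟩, hp.1.2⟩
        simpa [abs_of_pos h1] using hmem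
      simp only [polarCoord_symm_eq_circleMap, indicator_of_notMem this, smul_zero]
  rw [e1, Measure.volume_eq_prod, setIntegral_prod]
  · rw [intervalIntegral.integral_of_le ht0, integral_Ioc_eq_integral_Ioo, ← integral_const_mul]
    refine setIntegral_congr_fun measurableSet_Ioo fun τ hτ => ?_
    simp only
    rw [integral_const_mul, Real.circleAverage_eq_integral_add (-Real.pi), smul_eq_mul,
      intervalIntegral.integral_comp_add_right (fun θ => g (circleMap 0 τ θ)),
      ← integral_Ioc_eq_integral_Ioo, ← intervalIntegral.integral_of_le (by linarith [Real.pi_pos])]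
    have : 2 * Real.pi + -Real.pi = Real.pi := by ring
    rw [this, zero_add]
    field_simp
  · have hc : ContinuousOn (fun p : ℝ × ℝ => p.1 * g (circleMap 0 p.1 p.2))
        (Icc 0 t ×ˢ Icc (-Real.pi) Real.pi) := by
      refine continuousOn_fst.mul ((continuousOn_comp_circleMap_uncurry hg).mono ?_)
      exact prod_mono (fun s hs => ⟨by linarith [hs.1], by linarith [hs.2]⟩) (subset_univ _)
    have := hc.integrableOn_compact (μ := volume) (isCompact_Icc.prod isCompact_Icc)
    exact this.mono_set (prod_mono Ioo_subset_Icc_self Ioo_subset_Icc_self)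

/-! ### Jensen's formula -/

/-- This form covers points inside, on and outside the circle alike, and shows that a zero at `u`
contributes a nondecreasing function of `r`. -/
theorem circleAverage_log_norm_sub_eq_log_max {r : ℝ} (hr : 0 < r) (u : ℂ) :
    Real.circleAverage (fun z => Real.log ‖z - u‖) 0 r = Real.log (max r ‖u‖) := by
  rw [circleAverage_log_norm_sub_const_eq_log_radius_add_posLog hr.ne', zero_sub, norm_neg]
  rcases le_total ‖u‖ r with h | h
  · rw [max_eq_left h, Real.posLog_eq_zero_iff _ |>.2, add_zero]
    rw [abs_of_nonneg (by positivity), inv_mul_le_iff₀ hr]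
    simpa using h
  · have hu : 0 < ‖u‖ := hr.trans_le h
    rw [max_eq_right h, Real.posLog_eq_log, Real.log_mul (by positivity) hu.ne', Real.log_inv]
    · ring
    · rw [abs_of_nonneg (by positivity), le_inv_mul_iff₀ hr]
      simpa using h

/-- **Jensen's formula** with the dependence on the radius made explicit. -/
theorem exists_circleAverage_log_norm_eq_sum {Q : ℂ → ℂ} {ρ : ℝ}
    (hQ : MeromorphicOn Q (Metric.closedBall 0 ρ))
    (hne : ∀ u ∈ Metric.closedBall (0 : ℂ) ρ, meromorphicOrderAt Q u ≠ ⊤) :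
    ∃ (s : Finset ℂ) (c : ℝ), (∀ u ∈ s, u ∈ Metric.closedBall (0 : ℂ) ρ) ∧
      ∀ r, 0 < r → r ≤ ρ → Real.circleAverage (fun z => Real.log ‖Q z‖) 0 r =
        ∑ u ∈ s, (meromorphicOrderAt Q u).untop₀ * Real.log (max r ‖u‖) + c := by
  have hfin := (MeromorphicOn.divisor Q (Metric.closedBall 0 ρ)).finiteSupport
    (isCompact_closedBall 0 ρ)
  obtain ⟨g, hg, hg0, hQg⟩ := hQ.extract_zeros_poles (fun u => hne u u.2) hfin
  have hmem : ∀ u ∈ hfin.toFinset, u ∈ Metric.closedBall (0 : ℂ) ρ := fun u hu =>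
    (MeromorphicOn.divisor Q (Metric.closedBall 0 ρ)).supportWithinDomain (by simpa using hu)
  -- The factor `g` is holomorphic without zeros on the closed disc, so every circle average of `log
  -- |g|` is `log |g 0|`.
  refine ⟨hfin.toFinset, Real.log ‖g 0‖, hmem, fun r hr hrρ => ?_⟩
  have hsub : Metric.closedBall (0 : ℂ) |r| ⊆ Metric.closedBall 0 ρ := by
    rw [abs_of_pos hr]; exact Metric.closedBall_subset_closedBall hrρ
  have hlog := MeromorphicOn.extract_zeros_poles_log hg0 hQg
  have hcg : CircleIntegrable (fun z => Real.log ‖g z‖) 0 r :=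
    MeromorphicOn.circleIntegrable_log_norm fun z hz =>
      (hg z (hsub (Metric.sphere_subset_closedBall hz))).meromorphicAt
  have hcu : ∀ u : ℂ, CircleIntegrable (fun z => Real.log ‖z - u‖) 0 r := fun u =>
    MeromorphicOn.circleIntegrable_log_norm fun z hz => by fun_prop
  -- The factorization of `Q` holds only off a discrete set, which circle averages do not see.
  have e1 : Real.circleAverage (fun z => Real.log ‖Q z‖) 0 r =
      Real.circleAverage ((∑ᶠ u, fun z => (MeromorphicOn.divisor Q (Metric.closedBall 0 ρ) u : ℝ)
        * Real.log ‖z - u‖) + fun z => Real.log ‖g z‖) 0 r :=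
    Real.circleAverage_congr_codiscreteWithin (codiscreteWithin_mono
      (Metric.sphere_subset_closedBall.trans hsub) hlog) hr.ne'
  have e2 : (∑ᶠ u, fun z => (MeromorphicOn.divisor Q (Metric.closedBall 0 ρ) u : ℝ)
        * Real.log ‖z - u‖) = ∑ u ∈ hfin.toFinset, fun z : ℂ =>
        (MeromorphicOn.divisor Q (Metric.closedBall 0 ρ) u : ℝ) * Real.log ‖z - u‖ := by
    apply finsum_eq_sum_of_support_subset
    intro u hu
    simp only [Finite.coe_toFinset, Function.mem_support] at hu ⊢
    contrapose! hu
    ext z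
    simp [hu]
  have hci : ∀ u, CircleIntegrable (fun z : ℂ =>
      (MeromorphicOn.divisor Q (Metric.closedBall 0 ρ) u : ℝ) * Real.log ‖z - u‖) 0 r :=
    fun u => (hcu u).const_mul _
  rw [e1, e2, Real.circleAverage_add (CircleIntegrable.sum _ fun u _ => hci u) hcg,
    Real.circleAverage_sum fun u _ => hci u,
    AnalyticOnNhd.circleAverage_log_norm_of_ne_zero (hg.mono hsub)
      fun u hu => hg0 ⟨u, hsub hu⟩]
  congr 1
  refine Finset.sum_congr rfl fun u hu => ?_
  have := Real.circleAverage_fun_smul (a := (MeromorphicOn.divisor Q (Metric.closedBall 0 ρ) u : ℝ))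
    (f := fun z => Real.log ‖z - u‖) (c := 0) (R := r)
  simp only [smul_eq_mul] at this
  rw [this, circleAverage_log_norm_sub_eq_log_max hr,
    MeromorphicOn.divisor_apply hQ (hmem u hu)]

/-! ### Reduced pairs, linear forms and the Wronskian -/

/-- A pair of holomorphic functions without common zeros on the disc of radius `ρ`: a reduced
representation of a holomorphic map to the Riemann sphere. -/
structure IsReducedPair (f₀ f₁ : ℂ → ℂ) (ρ : ℝ) : Prop where
  analytic_fst : AnalyticOnNhd ℂ f₀ (Metric.ball 0 ρ)
  analytic_snd : AnalyticOnNhd ℂ f₁ (Metric.ball 0 ρ)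
  ne_zero : ∀ z ∈ Metric.ball (0 : ℂ) ρ, f₀ z ≠ 0 ∨ f₁ z ≠ 0

noncomputable def linForm (b : ℂ × ℂ) (f₀ f₁ : ℂ → ℂ) (z : ℂ) : ℂ := b.1 * f₀ z + b.2 * f₁ z

/-- For a unit form `b`, passing from `(f₀, f₁)` to the values of `b` and `orthVec b` is a unitary
change of coordinates of determinant one. It preserves both the norm and the Wronskian, so every
value can be treated like the zero of the first coordinate. -/
noncomputable def orthVec (b : ℂ × ℂ) : ℂ × ℂ := (-conj b.2, conj b.1)

/-- The determinant of two linear forms. -/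
def formDet (b b' : ℂ × ℂ) : ℂ := b.1 * b'.2 - b.2 * b'.1

/-- The Fubini-Study density, up to the factor `1 / π`. -/
noncomputable def fsDensity (f₀ f₁ : ℂ → ℂ) (z : ℂ) : ℝ :=
  ‖wronskian f₀ f₁ z‖ ^ 2 / weightedNormSq f₀ f₁ 1 1 z ^ 2

/-- The square of the chordal distance to the zero of the linear form `b`. -/
noncomputable def chordalSq (b : ℂ × ℂ) (f₀ f₁ : ℂ → ℂ) (z : ℂ) : ℝ :=
  ‖linForm b f₀ f₁ z‖ ^ 2 / weightedNormSq f₀ f₁ 1 1 z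

theorem formDet_orthVec {b : ℂ × ℂ} (hb : ‖b.1‖ ^ 2 + ‖b.2‖ ^ 2 = 1) :
    formDet b (orthVec b) = 1 := by
  simp only [formDet, orthVec]
  have : ((‖b.1‖ ^ 2 + ‖b.2‖ ^ 2 : ℝ) : ℂ) = 1 := by rw [hb]; simp
  push_cast at this
  rw [← Complex.mul_conj', ← Complex.mul_conj'] at this
  linear_combination this

theorem weightedNormSq_linForm {b : ℂ × ℂ} (hb : ‖b.1‖ ^ 2 + ‖b.2‖ ^ 2 = 1) (f₀ f₁ : ℂ → ℂ)
    (z : ℂ) : weightedNormSq (linForm b f₀ f₁) (linForm (orthVec b) f₀ f₁) 1 1 z =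
      weightedNormSq f₀ f₁ 1 1 z := by
  have : weightedNormSq (linForm b f₀ f₁) (linForm (orthVec b) f₀ f₁) 1 1 z =
      (‖b.1‖ ^ 2 + ‖b.2‖ ^ 2) * weightedNormSq f₀ f₁ 1 1 z := by
    simp only [weightedNormSq, linForm, orthVec, Complex.sq_norm, Complex.normSq_apply]
    simp
    ring
  rw [this, hb, one_mul]

theorem weightedNormSq_linForm_add {b : ℂ × ℂ} (hb : ‖b.1‖ ^ 2 + ‖b.2‖ ^ 2 = 1) (f₀ f₁ : ℂ → ℂ)
    (ε : ℝ) (z : ℂ) :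
    weightedNormSq (linForm b f₀ f₁) (linForm (orthVec b) f₀ f₁) (1 + ε) ε z =
      ‖linForm b f₀ f₁ z‖ ^ 2 + ε * weightedNormSq f₀ f₁ 1 1 z := by
  rw [← weightedNormSq_linForm hb]
  simp only [weightedNormSq]
  ring

theorem norm_linForm_orthVec_sq {b : ℂ × ℂ} (hb : ‖b.1‖ ^ 2 + ‖b.2‖ ^ 2 = 1) (f₀ f₁ : ℂ → ℂ)
    (z : ℂ) : ‖linForm (orthVec b) f₀ f₁ z‖ ^ 2 =
      weightedNormSq f₀ f₁ 1 1 z - ‖linForm b f₀ f₁ z‖ ^ 2 := by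
  rw [← weightedNormSq_linForm hb]
  simp only [weightedNormSq]
  ring

theorem AnalyticAt.linForm {f₀ f₁ : ℂ → ℂ} {z : ℂ} (h₀ : AnalyticAt ℂ f₀ z)
    (h₁ : AnalyticAt ℂ f₁ z) (b : ℂ × ℂ) : AnalyticAt ℂ (linForm b f₀ f₁) z :=
  (analyticAt_const.mul h₀).add (analyticAt_const.mul h₁)

theorem AnalyticAt.wronskian {f₀ f₁ : ℂ → ℂ} {z : ℂ} (h₀ : AnalyticAt ℂ f₀ z)
    (h₁ : AnalyticAt ℂ f₁ z) : AnalyticAt ℂ (wronskian f₀ f₁) z :=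
  (h₀.mul h₁.deriv).sub (h₀.deriv.mul h₁)

theorem wronskian_linForm {f₀ f₁ : ℂ → ℂ} {z : ℂ} (h₀ : AnalyticAt ℂ f₀ z)
    (h₁ : AnalyticAt ℂ f₁ z) (b b' : ℂ × ℂ) :
    wronskian (linForm b f₀ f₁) (linForm b' f₀ f₁) z = formDet b b' * wronskian f₀ f₁ z := by
  have hd : ∀ c : ℂ × ℂ, deriv (linForm c f₀ f₁) z = c.1 * deriv f₀ z + c.2 * deriv f₁ z :=
    fun c => ((h₀.differentiableAt.hasDerivAt.const_mul c.1).add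
      (h₁.differentiableAt.hasDerivAt.const_mul c.2)).deriv
  simp only [wronskian, hd, formDet, linForm]
  ring

/-- Both terms of `L M' - L' M` vanish at least to the order of `L'`, which is one less than that of
`L`. This is the source of counting without multiplicities. -/
theorem analyticOrderAt_le_wronskian {L M : ℂ → ℂ} {u : ℂ} (hL : AnalyticAt ℂ L u)
    (hM : AnalyticAt ℂ M u) (h0 : L u = 0) :
    analyticOrderAt L u ≤ analyticOrderAt (wronskian L M) u + 1 := by
  have hdL : analyticOrderAt (deriv L) u + 1 = analyticOrderAt L u := by
    have := hL.analyticOrderAt_deriv_add_one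
    simpa [h0] using this
  have h1 : analyticOrderAt (deriv L) u ≤ analyticOrderAt (wronskian L M) u := by
    have e : wronskian L M = (L * deriv M) - (deriv L * M) := rfl
    rw [e]
    refine le_trans (le_min ?_ ?_) le_analyticOrderAt_sub
    · rw [analyticOrderAt_mul hL hM.deriv]
      refine le_trans ?_ le_self_add
      rw [← hdL]
      exact le_self_add
    · rw [analyticOrderAt_mul hL.deriv hM]
      exact le_self_add
  rw [← hdL]
  gcongr

theorem finite_zeros_of_analyticOnNhd {L : ℂ → ℂ} {ρ r : ℝ}
    (hL : AnalyticOnNhd ℂ L (Metric.ball 0 ρ)) (hr : r < ρ)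
    (hne : ∃ z ∈ Metric.ball (0 : ℂ) ρ, L z ≠ 0) :
    {z | z ∈ Metric.closedBall (0 : ℂ) r ∧ L z = 0}.Finite := by
  by_contra hinf
  obtain ⟨x, hx, hacc⟩ := Set.Infinite.exists_accPt_of_subset_isCompact hinf
    (isCompact_closedBall (0 : ℂ) r) fun z hz => hz.1
  have hxρ : x ∈ Metric.ball (0 : ℂ) ρ := Metric.closedBall_subset_ball hr hx
  obtain ⟨z, hz, hz0⟩ := hne
  refine hz0 (hL.eqOn_zero_of_preconnected_of_frequently_eq_zero
    (convex_ball 0 ρ).isPreconnected hxρ ?_ hz)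
  exact (accPt_iff_frequently_nhdsNE.1 hacc).mono fun w hw => hw.2

namespace IsReducedPair

variable {f₀ f₁ : ℂ → ℂ} {ρ : ℝ}

theorem normSq_pos (h : IsReducedPair f₀ f₁ ρ) {z : ℂ} (hz : z ∈ Metric.ball (0 : ℂ) ρ) :
    0 < weightedNormSq f₀ f₁ 1 1 z := by
  simp only [weightedNormSq, one_mul]
  rcases h.ne_zero z hz with h | h
  · have := norm_pos_iff.2 h; positivity
  · have := norm_pos_iff.2 h; positivity

theorem analyticAt_linForm (h : IsReducedPair f₀ f₁ ρ) (b : ℂ × ℂ) :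
    AnalyticOnNhd ℂ (linForm b f₀ f₁) (Metric.ball 0 ρ) := fun z hz =>
  (h.analytic_fst z hz).linForm (h.analytic_snd z hz) b

theorem analyticAt_wronskian (h : IsReducedPair f₀ f₁ ρ) :
    AnalyticOnNhd ℂ (wronskian f₀ f₁) (Metric.ball 0 ρ) := fun z hz =>
  (h.analytic_fst z hz).wronskian (h.analytic_snd z hz)

theorem eq_zero_of_linForm_eq_zero {b b' : ℂ × ℂ} (hdet : formDet b b' ≠ 0) {z : ℂ}
    (h1 : linForm b f₀ f₁ z = 0) (h2 : linForm b' f₀ f₁ z = 0) : f₀ z = 0 ∧ f₁ z = 0 := by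
  simp only [linForm, formDet] at *
  constructor
  · refine (mul_eq_zero.1 (?_ : (b.1 * b'.2 - b.2 * b'.1) * f₀ z = 0)).resolve_left hdet
    linear_combination b'.2 * h1 - b.2 * h2
  · refine (mul_eq_zero.1 (?_ : (b.1 * b'.2 - b.2 * b'.1) * f₁ z = 0)).resolve_left hdet
    linear_combination b.1 * h2 - b'.1 * h1

theorem exists_linForm_ne_zero (h : IsReducedPair f₀ f₁ ρ)
    (hW : ∃ z ∈ Metric.ball (0 : ℂ) ρ, wronskian f₀ f₁ z ≠ 0) {b : ℂ × ℂ}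
    (hb : ‖b.1‖ ^ 2 + ‖b.2‖ ^ 2 = 1) :
    ∃ z ∈ Metric.ball (0 : ℂ) ρ, linForm b f₀ f₁ z ≠ 0 := by
  by_contra! hall
  obtain ⟨z, hz, hWz⟩ := hW
  have h1 := wronskian_linForm (h.analytic_fst z hz) (h.analytic_snd z hz) b (orthVec b)
  rw [formDet_orthVec hb, one_mul] at h1
  have hev : linForm b f₀ f₁ =ᶠ[𝓝 z] fun _ => 0 := by
    filter_upwards [Metric.isOpen_ball.mem_nhds hz] with w hw using hall w hw
  apply hWz
  rw [← h1, wronskian, hall z hz, hev.deriv_eq]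
  simp

/-- The order of vanishing of the product of the linear forms exceeds that of the Wronskian by at
most one, and only at the zeros of the linear forms. -/
theorem order_quotient_le (h : IsReducedPair f₀ f₁ ρ) {q : ℕ} {b : Fin q → ℂ × ℂ}
    (hb : ∀ j, ‖(b j).1‖ ^ 2 + ‖(b j).2‖ ^ 2 = 1)
    (hdet : ∀ i j, i ≠ j → formDet (b i) (b j) ≠ 0)
    (hW : ∃ z ∈ Metric.ball (0 : ℂ) ρ, wronskian f₀ f₁ z ≠ 0) {u : ℂ}
    (hu : u ∈ Metric.ball (0 : ℂ) ρ) :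
    MeromorphicAt (fun z => (∏ j, linForm (b j) f₀ f₁ z) / wronskian f₀ f₁ z) u ∧
    meromorphicOrderAt (fun z => (∏ j, linForm (b j) f₀ f₁ z) / wronskian f₀ f₁ z) u ≠ ⊤ ∧
    (meromorphicOrderAt (fun z => (∏ j, linForm (b j) f₀ f₁ z) / wronskian f₀ f₁ z) u).untop₀ ≤
      ((∑ j, if linForm (b j) f₀ f₁ u = 0 then 1 else 0 : ℕ) : ℤ) := by
  have hpre := (convex_ball (0 : ℂ) ρ).isPreconnected
  have aL : ∀ j, AnalyticAt ℂ (linForm (b j) f₀ f₁) u := fun j => h.analyticAt_linForm (b j) u hu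
  have aW : AnalyticAt ℂ (wronskian f₀ f₁) u := h.analyticAt_wronskian u hu
  have oW : analyticOrderAt (wronskian f₀ f₁) u ≠ ⊤ := by
    obtain ⟨z, hz, hz0⟩ := hW
    refine h.analyticAt_wronskian.analyticOrderAt_ne_top_of_isPreconnected hpre hz hu ?_
    rw [(h.analyticAt_wronskian z hz).analyticOrderAt_eq_zero.2 hz0]; simp
  have oL : ∀ j, analyticOrderAt (linForm (b j) f₀ f₁) u ≠ ⊤ := by
    intro j
    obtain ⟨z, hz, hz0⟩ := h.exists_linForm_ne_zero hW (hb j)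
    refine (h.analyticAt_linForm (b j)).analyticOrderAt_ne_top_of_isPreconnected hpre hz hu ?_
    rw [(h.analyticAt_linForm (b j) z hz).analyticOrderAt_eq_zero.2 hz0]; simp
  have aP : AnalyticAt ℂ (fun z => ∏ j, linForm (b j) f₀ f₁ z) u :=
    Finset.analyticAt_fun_prod _ fun j _ => aL j
  have hdiv : (fun z => (∏ j, linForm (b j) f₀ f₁ z) / wronskian f₀ f₁ z) =
      (fun z => ∏ j, linForm (b j) f₀ f₁ z) * (wronskian f₀ f₁)⁻¹ := by
    ext z; simp [div_eq_mul_inv]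
  rw [hdiv, meromorphicOrderAt_mul aP.meromorphicAt aW.meromorphicAt.inv, meromorphicOrderAt_inv]
  refine ⟨aP.meromorphicAt.mul aW.meromorphicAt.inv, ?_⟩
  rw [aP.meromorphicOrderAt_eq, aW.meromorphicOrderAt_eq]
  lift analyticOrderAt (wronskian f₀ f₁) u to ℕ using oW with w hw
  have hprod : ∃ p : ℕ, analyticOrderAt (fun z => ∏ j, linForm (b j) f₀ f₁ z) u = p ∧
      p ≤ w + ∑ j, if linForm (b j) f₀ f₁ u = 0 then 1 else 0 := by
    by_cases hz : ∃ k, linForm (b k) f₀ f₁ u = 0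
    · obtain ⟨k, hk⟩ := hz
      -- Two independent linear forms vanishing at `u` would force a common zero of `f₀` and `f₁`;
      -- so the product has the order of a single form.
      have hother : ∀ j, j ≠ k → linForm (b j) f₀ f₁ u ≠ 0 := by
        intro j hj hj0
        obtain ⟨h1, h2⟩ := eq_zero_of_linForm_eq_zero (hdet j k hj) hj0 hk
        exact (h.ne_zero u hu).elim (fun h => h h1) (fun h => h h2)
      have e : (fun z => ∏ j, linForm (b j) f₀ f₁ z) = linForm (b k) f₀ f₁ *
          fun z => ∏ j ∈ Finset.univ.erase k, linForm (b j) f₀ f₁ z := by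
        ext z
        exact (Finset.mul_prod_erase _ (fun j => linForm (b j) f₀ f₁ z) (Finset.mem_univ k)).symm
      have a2 : AnalyticAt ℂ (fun z => ∏ j ∈ Finset.univ.erase k, linForm (b j) f₀ f₁ z) u :=
        Finset.analyticAt_fun_prod _ fun j _ => aL j
      have o2 : analyticOrderAt (fun z => ∏ j ∈ Finset.univ.erase k, linForm (b j) f₀ f₁ z) u = 0 :=
        a2.analyticOrderAt_eq_zero.2 (Finset.prod_ne_zero_iff.2 fun j hj =>
          hother j (Finset.ne_of_mem_erase hj))
      have hwr : analyticOrderAt (wronskian (linForm (b k) f₀ f₁)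
          (linForm (orthVec (b k)) f₀ f₁)) u = w := by
        rw [hw]
        apply analyticOrderAt_congr
        filter_upwards [Metric.isOpen_ball.mem_nhds hu] with z hz
        rw [wronskian_linForm (h.analytic_fst z hz) (h.analytic_snd z hz), formDet_orthVec (hb k),
          one_mul]
      have hle := analyticOrderAt_le_wronskian (aL k)
        (h.analyticAt_linForm (orthVec (b k)) u hu) hk
      rw [hwr] at hle
      have hne := oL k
      rw [e, analyticOrderAt_mul (aL k) a2, o2, add_zero]
      lift analyticOrderAt (linForm (b k) f₀ f₁) u to ℕ using hne with p hp
      refine ⟨p, rfl, ?_⟩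
      have h1 : p ≤ w + 1 := by exact_mod_cast hle
      have h2 : 1 ≤ ∑ j, if linForm (b j) f₀ f₁ u = 0 then 1 else 0 := by
        refine le_trans (by simp [hk]) (Finset.single_le_sum
          (f := fun j => if linForm (b j) f₀ f₁ u = 0 then 1 else 0)
          (fun j _ => Nat.zero_le _) (Finset.mem_univ k))
      omega
    · push Not at hz
      refine ⟨0, ?_, Nat.zero_le _⟩
      exact aP.analyticOrderAt_eq_zero.2 (Finset.prod_ne_zero_iff.2 fun j _ => hz j)
  obtain ⟨p, hp, hple⟩ := hprod
  rw [hp]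
  have e1 : (ENat.map (fun n : ℕ => (n : ℤ)) (p : ℕ∞)) = ((p : ℤ) : WithTop ℤ) := rfl
  have e2 : (ENat.map (fun n : ℕ => (n : ℤ)) (w : ℕ∞)) = ((w : ℤ) : WithTop ℤ) := rfl
  have e3 : ((p : ℤ) : WithTop ℤ) + -((w : ℤ) : WithTop ℤ) = ((p - w : ℤ) : WithTop ℤ) := rfl
  rw [e1, e2, e3]
  refine ⟨WithTop.coe_ne_top, ?_⟩
  rw [WithTop.untop₀_coe]
  have : (p : ℤ) ≤ w + ((∑ j, if linForm (b j) f₀ f₁ u = 0 then 1 else 0 : ℕ) : ℤ) := by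
    exact_mod_cast hple
  linarith

end IsReducedPair

/-! ### The iterated radial integral -/

/-- The iterated integral `∫_{r₁}^r (∫_0^t τ M_τ(g) dτ) dt / t`, with `M_τ(g)` the average of `g` over
the circle of radius `τ`. -/
noncomputable def greenAverage (g : ℂ → ℝ) (r₁ r : ℝ) : ℝ :=
  ∫ t in r₁..r, (∫ τ in (0 : ℝ)..t, τ * Real.circleAverage g 0 τ) / t

section GreenAverage

variable {g g' : ℂ → ℝ} {ρ r₁ r : ℝ}

theorem continuousOn_circleAverage_Ico (hg : ContinuousOn g (Metric.ball 0 ρ)) :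
    ContinuousOn (Real.circleAverage g 0) (Ico 0 ρ) := by
  refine Real.ContinuousOn.circleAverage (hg.mono fun z hz => ?_) fun r hr => hr.1
  simpa using hz.2

theorem continuousOn_mul_circleAverage_Icc (hg : ContinuousOn g (Metric.ball 0 ρ)) {t : ℝ}
    (ht : t < ρ) : ContinuousOn (fun τ => τ * Real.circleAverage g 0 τ) (Icc 0 t) :=
  continuousOn_id.mul ((continuousOn_circleAverage_Ico hg).mono fun _ hs =>
    ⟨hs.1, hs.2.trans_lt ht⟩)

theorem intervalIntegrable_mul_circleAverage (hg : ContinuousOn g (Metric.ball 0 ρ)) {t : ℝ}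
    (h0 : 0 ≤ t) (ht : t < ρ) :
    IntervalIntegrable (fun τ => τ * Real.circleAverage g 0 τ) volume 0 t := by
  apply ContinuousOn.intervalIntegrable
  rw [uIcc_of_le h0]
  exact continuousOn_mul_circleAverage_Icc hg ht

theorem continuousOn_integral_circleAverage_div (hg : ContinuousOn g (Metric.ball 0 ρ))
    (h0 : 0 < r₁) (h1 : r₁ ≤ r) (h2 : r < ρ) :
    ContinuousOn (fun t => (∫ τ in (0 : ℝ)..t, τ * Real.circleAverage g 0 τ) / t) (Icc r₁ r) := by
  refine ContinuousOn.div ?_ continuousOn_id fun t ht => (h0.trans_le ht.1).ne'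
  have hr : 0 ≤ r := h0.le.trans h1
  have := intervalIntegral.continuousOn_primitive_interval' (a := 0)
    (intervalIntegrable_mul_circleAverage hg hr h2) (by simp)
  rw [uIcc_of_le hr] at this
  exact this.mono (Icc_subset_Icc_left h0.le)

theorem intervalIntegrable_integral_circleAverage_div (hg : ContinuousOn g (Metric.ball 0 ρ))
    (h0 : 0 < r₁) (h1 : r₁ ≤ r) (h2 : r < ρ) : IntervalIntegrable
      (fun t => (∫ τ in (0 : ℝ)..t, τ * Real.circleAverage g 0 τ) / t) volume r₁ r := by
  apply ContinuousOn.intervalIntegrable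
  rw [uIcc_of_le h1]
  exact continuousOn_integral_circleAverage_div hg h0 h1 h2

theorem circleIntegrable_of_continuousOn_ball (hg : ContinuousOn g (Metric.ball 0 ρ)) {t : ℝ}
    (h0 : 0 ≤ t) (ht : t < ρ) : CircleIntegrable g 0 t :=
  (hg.mono (Metric.sphere_subset_closedBall.trans (Metric.closedBall_subset_ball ht))).circleIntegrable
    h0

theorem greenAverage_congr (h : EqOn g g' (Metric.ball 0 ρ)) (h0 : 0 < r₁) (h1 : r₁ ≤ r)
    (h2 : r < ρ) : greenAverage g r₁ r = greenAverage g' r₁ r := by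
  refine intervalIntegral.integral_congr fun t ht => ?_
  rw [uIcc_of_le h1] at ht
  have ht0 := h0.trans_le ht.1
  congr 1
  refine intervalIntegral.integral_congr fun τ hτ => ?_
  rw [uIcc_of_le ht0.le] at hτ
  congr 1
  refine Real.circleAverage_congr_sphere (h.mono ?_)
  rw [abs_of_nonneg hτ.1]
  exact Metric.sphere_subset_closedBall.trans
    (Metric.closedBall_subset_ball (hτ.2.trans_lt (ht.2.trans_lt h2)))

theorem greenAverage_mono (hg : ContinuousOn g (Metric.ball 0 ρ))
    (hg' : ContinuousOn g' (Metric.ball 0 ρ)) (h : ∀ z ∈ Metric.ball (0 : ℂ) ρ, g z ≤ g' z)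
    (h0 : 0 < r₁) (h1 : r₁ ≤ r) (h2 : r < ρ) : greenAverage g r₁ r ≤ greenAverage g' r₁ r := by
  refine intervalIntegral.integral_mono_on h1
    (intervalIntegrable_integral_circleAverage_div hg h0 h1 h2)
    (intervalIntegrable_integral_circleAverage_div hg' h0 h1 h2) fun t ht => ?_
  have ht0 := h0.trans_le ht.1
  have htρ := ht.2.trans_lt h2
  refine div_le_div_of_nonneg_right (intervalIntegral.integral_mono_on ht0.le
    (intervalIntegrable_mul_circleAverage hg ht0.le htρ)
    (intervalIntegrable_mul_circleAverage hg' ht0.le htρ) fun τ hτ => ?_) ht0.le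
  refine mul_le_mul_of_nonneg_left (Real.circleAverage_mono
    (circleIntegrable_of_continuousOn_ball hg hτ.1 (hτ.2.trans_lt htρ))
    (circleIntegrable_of_continuousOn_ball hg' hτ.1 (hτ.2.trans_lt htρ)) fun z hz => h z ?_) hτ.1
  rw [abs_of_nonneg hτ.1] at hz
  exact Metric.closedBall_subset_ball (hτ.2.trans_lt htρ) (Metric.sphere_subset_closedBall hz)

theorem greenAverage_const_mul (c : ℝ) (g : ℂ → ℝ) (r₁ r : ℝ) :
    greenAverage (fun z => c * g z) r₁ r = c * greenAverage g r₁ r := by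
  have : ∀ τ, Real.circleAverage (fun z => c * g z) 0 τ = c * Real.circleAverage g 0 τ := fun τ => by
    have := Real.circleAverage_fun_smul (a := c) (f := g) (c := 0) (R := τ)
    simpa only [smul_eq_mul] using this
  simp only [greenAverage, this, ← intervalIntegral.integral_const_mul]
  congr 1 with t
  rw [mul_div_assoc', ← intervalIntegral.integral_const_mul]
  congr 2 with τ
  ring

theorem greenAverage_add (hg : ContinuousOn g (Metric.ball 0 ρ))
    (hg' : ContinuousOn g' (Metric.ball 0 ρ)) (h0 : 0 < r₁) (h1 : r₁ ≤ r) (h2 : r < ρ) :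
    greenAverage (fun z => g z + g' z) r₁ r = greenAverage g r₁ r + greenAverage g' r₁ r := by
  rw [greenAverage, greenAverage, greenAverage, ← intervalIntegral.integral_add
    (intervalIntegrable_integral_circleAverage_div hg h0 h1 h2)
    (intervalIntegrable_integral_circleAverage_div hg' h0 h1 h2)]
  refine intervalIntegral.integral_congr fun t ht => ?_
  rw [uIcc_of_le h1] at ht
  have ht0 := h0.trans_le ht.1
  have htρ := ht.2.trans_lt h2
  rw [← add_div, ← intervalIntegral.integral_add
    (intervalIntegrable_mul_circleAverage hg ht0.le htρ)
    (intervalIntegrable_mul_circleAverage hg' ht0.le htρ)]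
  congr 1
  refine intervalIntegral.integral_congr fun τ hτ => ?_
  rw [uIcc_of_le ht0.le] at hτ
  rw [Real.circleAverage_fun_add (circleIntegrable_of_continuousOn_ball hg hτ.1 (hτ.2.trans_lt htρ))
    (circleIntegrable_of_continuousOn_ball hg' hτ.1 (hτ.2.trans_lt htρ)), mul_add]

theorem greenAverage_nonneg (hg0 : ∀ z ∈ Metric.ball (0 : ℂ) ρ, 0 ≤ g z)
    (h0 : 0 < r₁) (h1 : r₁ ≤ r) (h2 : r < ρ) : 0 ≤ greenAverage g r₁ r := by
  refine intervalIntegral.integral_nonneg h1 fun t ht => ?_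
  have ht0 := h0.trans_le ht.1
  refine div_nonneg (intervalIntegral.integral_nonneg ht0.le fun τ hτ => ?_) ht0.le
  refine mul_nonneg hτ.1 (Real.circleAverage_nonneg_of_nonneg fun z hz => hg0 z ?_)
  rw [abs_of_nonneg hτ.1] at hz
  exact Metric.closedBall_subset_ball (hτ.2.trans_lt (ht.2.trans_lt h2))
    (Metric.sphere_subset_closedBall hz)

theorem greenAverage_add_adjacent (hg : ContinuousOn g (Metric.ball 0 ρ)) {r₀ : ℝ}
    (h0 : 0 < r₀) (h1 : r₀ ≤ r₁) (h2 : r₁ ≤ r) (h3 : r < ρ) :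
    greenAverage g r₀ r₁ + greenAverage g r₁ r = greenAverage g r₀ r :=
  intervalIntegral.integral_add_adjacent_intervals
    (intervalIntegrable_integral_circleAverage_div hg h0 h1 (h2.trans_lt h3))
    (intervalIntegrable_integral_circleAverage_div hg (h0.trans_le h1) h2 h3)

end GreenAverage

theorem log_max_norm_mono {r₁ r : ℝ} (h0 : 0 < r₁) (h1 : r₁ ≤ r) (u : ℂ) :
    Real.log (max r₁ ‖u‖) ≤ Real.log (max r ‖u‖) :=
  Real.log_le_log (lt_max_of_lt_left h0) (max_le_max_right _ h1)

/-- In Jensen's formula a holomorphic function has only nonnegative orders, and each term increases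
with the radius. -/
theorem circleAverage_log_norm_mono {H : ℂ → ℂ} {ρ r₁ r : ℝ}
    (hH : AnalyticOnNhd ℂ H (Metric.ball 0 ρ)) (hne : ∃ z ∈ Metric.ball (0 : ℂ) ρ, H z ≠ 0)
    (h0 : 0 < r₁) (h1 : r₁ ≤ r) (h2 : r < ρ) :
    Real.circleAverage (fun z => Real.log ‖H z‖) 0 r₁ ≤
      Real.circleAverage (fun z => Real.log ‖H z‖) 0 r := by
  have hsub : Metric.closedBall (0 : ℂ) r ⊆ Metric.ball 0 ρ := Metric.closedBall_subset_ball h2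
  have hord : ∀ u ∈ Metric.closedBall (0 : ℂ) r, analyticOrderAt H u ≠ ⊤ := by
    intro u hu
    obtain ⟨z, hz, hz0⟩ := hne
    refine hH.analyticOrderAt_ne_top_of_isPreconnected (convex_ball 0 ρ).isPreconnected hz
      (hsub hu) ?_
    rw [(hH z hz).analyticOrderAt_eq_zero.2 hz0]; simp
  obtain ⟨s, c, hs, hsum⟩ := exists_circleAverage_log_norm_eq_sum
    (Q := H) (ρ := r) (fun u hu => (hH u (hsub hu)).meromorphicAt) (fun u hu => by
      rw [(hH u (hsub hu)).meromorphicOrderAt_eq]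
      simpa using hord u hu)
  rw [hsum r₁ h0 h1, hsum r (h0.trans_le h1) le_rfl]
  gcongr with u hu
  · have := (hH u (hsub (hs u hu))).meromorphicOrderAt_nonneg
    have h3 : 0 ≤ (meromorphicOrderAt H u).untop₀ := by simpa using WithTop.untop₀_nonneg.2 this
    exact_mod_cast h3

/-! ### Jensen's formula for the forms, the Wronskian and the norm -/

namespace IsReducedPair

variable {f₀ f₁ : ℂ → ℂ} {ρ r₁ r : ℝ}

/-- Jensen's formula for `∏ L_j / W`: the order at `u` is at most the number of forms vanishing
there, so every zero of a form is charged once. Further zeros of `W` only help, and so do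
superfluous points of `Z j`, since all increments are nonnegative. -/
theorem circleAverage_log_quotient_sub_le (h : IsReducedPair f₀ f₁ ρ) {q : ℕ} {b : Fin q → ℂ × ℂ}
    (hb : ∀ j, ‖(b j).1‖ ^ 2 + ‖(b j).2‖ ^ 2 = 1)
    (hdet : ∀ i j, i ≠ j → formDet (b i) (b j) ≠ 0)
    (hW : ∃ z ∈ Metric.ball (0 : ℂ) ρ, wronskian f₀ f₁ z ≠ 0)
    (h0 : 0 < r₁) (h1 : r₁ ≤ r) (h2 : r < ρ) (Z : Fin q → Finset ℂ)
    (hZ : ∀ j, ∀ u ∈ Metric.closedBall (0 : ℂ) r, linForm (b j) f₀ f₁ u = 0 → u ∈ Z j) :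
    Real.circleAverage (fun z => Real.log
        ‖(∏ j, linForm (b j) f₀ f₁ z) / wronskian f₀ f₁ z‖) 0 r
      - Real.circleAverage (fun z => Real.log
        ‖(∏ j, linForm (b j) f₀ f₁ z) / wronskian f₀ f₁ z‖) 0 r₁
      ≤ ∑ j, ∑ u ∈ Z j, (Real.log (max r ‖u‖) - Real.log (max r₁ ‖u‖)) := by
  have hsub : Metric.closedBall (0 : ℂ) r ⊆ Metric.ball 0 ρ := Metric.closedBall_subset_ball h2
  have hord := fun u (hu : u ∈ Metric.closedBall (0 : ℂ) r) =>
    h.order_quotient_le hb hdet hW (hsub hu)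
  obtain ⟨s, c, hs, hsum⟩ := exists_circleAverage_log_norm_eq_sum
    (fun u hu => (hord u hu).1) (fun u hu => (hord u hu).2.1)
  rw [hsum r₁ h0 h1, hsum r (h0.trans_le h1) le_rfl]
  set d : ℂ → ℝ := fun u => Real.log (max r ‖u‖) - Real.log (max r₁ ‖u‖) with hd
  have hd0 : ∀ u, 0 ≤ d u := fun u => sub_nonneg.2 (log_max_norm_mono h0 h1 u)
  set o : ℂ → ℤ := fun u => (meromorphicOrderAt
    (fun z => (∏ j, linForm (b j) f₀ f₁ z) / wronskian f₀ f₁ z) u).untop₀ with ho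
  have e1 : ∑ u ∈ s, (o u : ℝ) * Real.log (max r ‖u‖) + c
      - (∑ u ∈ s, (o u : ℝ) * Real.log (max r₁ ‖u‖) + c) = ∑ u ∈ s, (o u : ℝ) * d u := by
    simp only [hd, mul_sub, Finset.sum_sub_distrib]; ring
  rw [e1]
  calc ∑ u ∈ s, (o u : ℝ) * d u
      ≤ ∑ u ∈ s, (∑ j, if linForm (b j) f₀ f₁ u = 0 then d u else 0) := by
        refine Finset.sum_le_sum fun u hu => ?_
        have h3 : (o u : ℝ) ≤ ∑ j, if linForm (b j) f₀ f₁ u = 0 then (1 : ℝ) else 0 := by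
          have := (hord u (hs u hu)).2.2
          have h4 : (o u : ℝ) ≤
              (((∑ j, if linForm (b j) f₀ f₁ u = 0 then 1 else 0 : ℕ) : ℤ) : ℝ) := by
            exact_mod_cast this
          refine h4.trans (le_of_eq ?_)
          push_cast
          rfl
        refine (mul_le_mul_of_nonneg_right h3 (hd0 u)).trans (le_of_eq ?_)
        rw [Finset.sum_mul]
        refine Finset.sum_congr rfl fun j _ => ?_
        split_ifs <;> simp
    _ = ∑ j, ∑ u ∈ s with linForm (b j) f₀ f₁ u = 0, d u := by
        rw [Finset.sum_comm]
        simp only [Finset.sum_filter]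
    _ ≤ ∑ j, ∑ u ∈ Z j, d u := by
        refine Finset.sum_le_sum fun j _ => ?_
        refine Finset.sum_le_sum_of_subset_of_nonneg (fun u hu => ?_) fun u _ _ => hd0 u
        rw [Finset.mem_filter] at hu
        exact hZ j u (hs u hu.1) hu.2

theorem continuousOn_normSq (h : IsReducedPair f₀ f₁ ρ) :
    ContinuousOn (weightedNormSq f₀ f₁ 1 1) (Metric.ball 0 ρ) := fun z hz =>
  (contDiffAt_weightedNormSq (n := 1) (h.analytic_fst z hz)
    (h.analytic_snd z hz)).continuousAt.continuousWithinAt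

theorem continuousOn_fsDensity (h : IsReducedPair f₀ f₁ ρ) :
    ContinuousOn (fsDensity f₀ f₁) (Metric.ball 0 ρ) :=
  ((h.analyticAt_wronskian.continuousOn.norm).pow 2).div (h.continuousOn_normSq.pow 2)
    fun _ hz => (pow_pos (h.normSq_pos hz) 2).ne'

theorem continuousOn_chordalSq (h : IsReducedPair f₀ f₁ ρ) (b : ℂ × ℂ) :
    ContinuousOn (chordalSq b f₀ f₁) (Metric.ball 0 ρ) :=
  (((h.analyticAt_linForm b).continuousOn.norm).pow 2).div h.continuousOn_normSq
    fun _ hz => (h.normSq_pos hz).ne'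

theorem chordalSq_le_one (h : IsReducedPair f₀ f₁ ρ) {b : ℂ × ℂ}
    (hb : ‖b.1‖ ^ 2 + ‖b.2‖ ^ 2 = 1) {z : ℂ} (hz : z ∈ Metric.ball (0 : ℂ) ρ) :
    chordalSq b f₀ f₁ z ≤ 1 := by
  rw [chordalSq, div_le_one (h.normSq_pos hz)]
  have := norm_linForm_orthVec_sq hb f₀ f₁ z
  nlinarith [sq_nonneg ‖linForm (orthVec b) f₀ f₁ z‖]

/-- Green–Jensen with `Δ log N = 4 K`. The characteristic will be `2 * greenAverage K`, so the mean
of `log N` grows by twice the characteristic. -/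
theorem circleAverage_log_normSq_sub (h : IsReducedPair f₀ f₁ ρ) (h0 : 0 < r₁) (h1 : r₁ ≤ r)
    (h2 : r < ρ) :
    Real.circleAverage (fun z => Real.log (weightedNormSq f₀ f₁ 1 1 z)) 0 r
      - Real.circleAverage (fun z => Real.log (weightedNormSq f₀ f₁ 1 1 z)) 0 r₁
      = 4 * greenAverage (fsDensity f₀ f₁) r₁ r := by
  rw [circleAverage_sub_circleAverage_eq (ρ := ρ) (fun z hz => ?_) h0 h1 h2]
  · rw [← greenAverage_const_mul]
    refine greenAverage_congr (ρ := ρ) (fun z hz => ?_) h0 h1 h2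
    rw [laplacian_log_weightedNormSq (h.analytic_fst z hz) (h.analytic_snd z hz)
      (h.normSq_pos hz), fsDensity]
    ring
  · exact ((contDiffAt_weightedNormSq (h.analytic_fst z hz)
      (h.analytic_snd z hz)).log (h.normSq_pos hz).ne').contDiffWithinAt

end IsReducedPair

/-! ### The logarithmically weakened singular density -/

/-- The regularized density `K x (1 - x) / ((x + ε)² (2 - log (x + ε))²)`. -/
noncomputable def regDensity (ε K x : ℝ) : ℝ :=
  K * (x * (1 - x) / ((x + ε) ^ 2 * (2 - Real.log (x + ε)) ^ 2))

/-- The constant 2 is chosen for `x = X + ε` with `X, ε ≤ 1`: the potential `log (2 - log x)` is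
then nonnegative. -/
theorem one_le_two_sub_log {x : ℝ} (hx : 0 < x) (hx2 : x ≤ 2) : 1 ≤ 2 - Real.log x := by
  have := Real.log_le_sub_one_of_pos hx
  linarith

namespace IsReducedPair

variable {f₀ f₁ : ℂ → ℂ} {ρ r₁ r : ℝ}

theorem chordalSq_nonneg (h : IsReducedPair f₀ f₁ ρ) (b : ℂ × ℂ) {z : ℂ}
    (hz : z ∈ Metric.ball (0 : ℂ) ρ) : 0 ≤ chordalSq b f₀ f₁ z :=
  div_nonneg (sq_nonneg _) (h.normSq_pos hz).le

theorem continuousOn_regDensity (h : IsReducedPair f₀ f₁ ρ) {b : ℂ × ℂ}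
    (hb : ‖b.1‖ ^ 2 + ‖b.2‖ ^ 2 = 1) {ε : ℝ} (hε : 0 < ε) (hε1 : ε ≤ 1) :
    ContinuousOn (fun z => regDensity ε (fsDensity f₀ f₁ z) (chordalSq b f₀ f₁ z))
      (Metric.ball 0 ρ) := by
  have hX := h.continuousOn_chordalSq b
  have hpos : ∀ z ∈ Metric.ball (0 : ℂ) ρ, 0 < chordalSq b f₀ f₁ z + ε := fun z hz =>
    add_pos_of_nonneg_of_pos (h.chordalSq_nonneg b hz) hε
  have hXε : ContinuousOn (fun z => chordalSq b f₀ f₁ z + ε) (Metric.ball 0 ρ) :=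
    hX.add continuousOn_const
  refine h.continuousOn_fsDensity.mul ((hX.mul (continuousOn_const.sub hX)).div
    ((hXε.pow 2).mul ((continuousOn_const.sub (hXε.log fun z hz => (hpos z hz).ne')).pow 2))
    fun z hz => ?_)
  have h1 := hpos z hz
  have h2 := one_le_two_sub_log h1 (by linarith [h.chordalSq_le_one hb hz])
  positivity

theorem log_add_eq (h : IsReducedPair f₀ f₁ ρ) {b : ℂ × ℂ} (hb : ‖b.1‖ ^ 2 + ‖b.2‖ ^ 2 = 1)
    {ε : ℝ} (hε : 0 < ε) {z : ℂ} (hz : z ∈ Metric.ball (0 : ℂ) ρ) :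
    2 - Real.log (chordalSq b f₀ f₁ z + ε) =
      2 + Real.log (weightedNormSq (linForm b f₀ f₁) (linForm (orthVec b) f₀ f₁) 1 1 z)
        - Real.log (weightedNormSq (linForm b f₀ f₁) (linForm (orthVec b) f₀ f₁) (1 + ε) ε z) := by
  have hN := h.normSq_pos hz
  rw [weightedNormSq_linForm hb, weightedNormSq_linForm_add hb, chordalSq, div_add' _ _ _ hN.ne',
    Real.log_div (by positivity) hN.ne']
  ring

/-- The integrated curvature estimate for the potential `-log (2 - log (X + ε))`. -/
theorem four_mul_greenAverage_regDensity_le (h : IsReducedPair f₀ f₁ ρ) {b : ℂ × ℂ}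
    (hb : ‖b.1‖ ^ 2 + ‖b.2‖ ^ 2 = 1) {ε : ℝ} (hε : 0 < ε) (hε1 : ε ≤ 1) (h0 : 0 < r₁)
    (h1 : r₁ ≤ r) (h2 : r < ρ) :
    4 * greenAverage (fun z => regDensity ε (fsDensity f₀ f₁ z) (chordalSq b f₀ f₁ z)) r₁ r ≤
      4 * greenAverage (fsDensity f₀ f₁) r₁ r
        + Real.circleAverage (fun z => Real.log (2 - Real.log (chordalSq b f₀ f₁ z + ε))) 0 r₁ := by
  set g₀ := linForm b f₀ f₁ with hg₀
  set g₁ := linForm (orthVec b) f₀ f₁ with hg₁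
  have a₀ := h.analyticAt_linForm b
  have a₁ := h.analyticAt_linForm (orthVec b)
  set P : ℂ → ℝ := fun w => -Real.log (2 + Real.log (weightedNormSq g₀ g₁ 1 1 w)
        - Real.log (weightedNormSq g₀ g₁ (1 + ε) ε w)) with hP
  set V : ℂ → ℝ := fun w => Real.log (weightedNormSq g₀ g₁ 1 1 w) with hV
  have hNeq : ∀ z, weightedNormSq g₀ g₁ 1 1 z = weightedNormSq f₀ f₁ 1 1 z :=
    weightedNormSq_linForm hb f₀ f₁
  have hN : ∀ z ∈ Metric.ball (0 : ℂ) ρ, 0 < weightedNormSq g₀ g₁ 1 1 z := fun z hz => by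
    rw [hNeq]; exact h.normSq_pos hz
  have hM : ∀ z ∈ Metric.ball (0 : ℂ) ρ, 0 < weightedNormSq g₀ g₁ (1 + ε) ε z := fun z hz => by
    rw [weightedNormSq_linForm_add hb]; have := h.normSq_pos hz; positivity
  have hy : ∀ z ∈ Metric.ball (0 : ℂ) ρ, 1 ≤ 2 + Real.log (weightedNormSq g₀ g₁ 1 1 z)
        - Real.log (weightedNormSq g₀ g₁ (1 + ε) ε z) := fun z hz => by
    rw [← h.log_add_eq hb hε hz]
    have := h.chordalSq_nonneg b hz
    exact one_le_two_sub_log (by linarith) (by linarith [h.chordalSq_le_one hb hz])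
  have cV : ContDiffOn ℝ 2 V (Metric.ball 0 ρ) := fun z hz =>
    ((contDiffAt_weightedNormSq (a₀ z hz) (a₁ z hz)).log (hN z hz).ne').contDiffWithinAt
  have cP : ContDiffOn ℝ 2 P (Metric.ball 0 ρ) := fun z hz => by
    refine ContDiffAt.contDiffWithinAt (ContDiffAt.neg (ContDiffAt.log ?_
      (lt_of_lt_of_le one_pos (hy z hz)).ne'))
    exact (contDiffAt_const.add ((contDiffAt_weightedNormSq (a₀ z hz) (a₁ z hz)).log
      (hN z hz).ne')).sub ((contDiffAt_weightedNormSq (a₀ z hz) (a₁ z hz)).log (hM z hz).ne')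
  have hGP := circleAverage_sub_circleAverage_eq cP h0 h1 h2
  have hGV := circleAverage_sub_circleAverage_eq cV h0 h1 h2
  have hV4 : greenAverage (Laplacian.laplacian V) r₁ r = 4 * greenAverage (fsDensity f₀ f₁) r₁ r := by
    rw [← h.circleAverage_log_normSq_sub h0 h1 h2, greenAverage, ← hGV]
    simp only [hV, hNeq]
  have hGP' : greenAverage (Laplacian.laplacian P) r₁ r =
      Real.circleAverage P 0 r - Real.circleAverage P 0 r₁ := hGP.symm
  have hlP := continuousOn_laplacian Metric.isOpen_ball cP
  have hlV := continuousOn_laplacian Metric.isOpen_ball cV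
  have hmono : greenAverage (fun z => 4 * regDensity ε (fsDensity f₀ f₁ z) (chordalSq b f₀ f₁ z))
      r₁ r ≤ greenAverage (fun z => Laplacian.laplacian P z + Laplacian.laplacian V z) r₁ r := by
    refine greenAverage_mono (ρ := ρ) (continuousOn_const.mul (h.continuousOn_regDensity hb hε hε1))
      (hlP.add hlV) (fun z hz => ?_) h0 h1 h2
    refine le_trans (le_of_eq ?_) (le_laplacian_neg_log (a₀ z hz) (a₁ z hz) hε (hN z hz) (hy z hz))
    rw [← h.log_add_eq hb hε hz, regDensity, fsDensity, norm_linForm_orthVec_sq hb,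
      wronskian_linForm (h.analytic_fst z hz) (h.analytic_snd z hz), formDet_orthVec hb, one_mul,
      weightedNormSq_linForm_add hb, hNeq]
    have hN' := (h.normSq_pos hz).ne'
    have hyz := (lt_of_lt_of_le one_pos (hy z hz)).ne'
    rw [← h.log_add_eq hb hε hz] at hyz
    have hXε : chordalSq b f₀ f₁ z + ε ≠ 0 :=
      (add_pos_of_nonneg_of_pos (h.chordalSq_nonneg b hz) hε).ne'
    have e1 : ‖linForm b f₀ f₁ z‖ ^ 2 = chordalSq b f₀ f₁ z * weightedNormSq f₀ f₁ 1 1 z := by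
      rw [chordalSq]; field_simp
    rw [e1]
    generalize chordalSq b f₀ f₁ z = x at *
    generalize 2 - Real.log (x + ε) = y at *
    generalize weightedNormSq f₀ f₁ 1 1 z = n at *
    have e2 : x * n + ε * n = (x + ε) * n := by ring
    rw [e2]
    field_simp
  rw [greenAverage_const_mul, greenAverage_add (ρ := ρ) hlP hlV h0 h1 h2, hV4, hGP']
    at hmono
  -- The outer boundary term has the good sign, as `P = -log y` with `y ≥ 1`; only the term at the
  -- fixed radius `r₁` remains.
  have hPr : Real.circleAverage P 0 r ≤ 0 := by
    refine Real.circleAverage_mono_on_of_le_circle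
      (circleIntegrable_of_continuousOn_ball cP.continuousOn (h0.le.trans h1) h2) fun z hz => ?_
    rw [abs_of_pos (h0.trans_le h1)] at hz
    have := Real.log_nonneg (hy z (Metric.closedBall_subset_ball h2
      (Metric.sphere_subset_closedBall hz)))
    simp only [hP]
    linarith
  have hPr₁ : Real.circleAverage P 0 r₁ =
      -Real.circleAverage (fun z => Real.log (2 - Real.log (chordalSq b f₀ f₁ z + ε))) 0 r₁ := by
    have := Real.circleAverage_fun_smul (a := (-1 : ℝ))
      (f := fun z => Real.log (2 - Real.log (chordalSq b f₀ f₁ z + ε))) (c := 0) (R := r₁)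
    simp only [smul_eq_mul, neg_mul, one_mul] at this
    rw [← this]
    refine Real.circleAverage_congr_sphere fun z hz => ?_
    rw [abs_of_pos h0] at hz
    have hz' : z ∈ Metric.ball (0 : ℂ) ρ := Metric.closedBall_subset_ball (h1.trans_lt h2)
      (Metric.sphere_subset_closedBall hz)
    simp only [hP]
    rw [h.log_add_eq hb hε hz']
  rw [hPr₁] at hmono
  linarith

end IsReducedPair

/-! ### Borel's growth lemma -/

section Borel

variable {J : Set ℝ} {a : ℝ} {g γ : ℝ → ENNReal} {δ : ℝ}

theorem monotone_one_add_lintegral_Ioo (a : ℝ) (g : ℝ → ENNReal) :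
    Monotone fun r => 1 + ∫⁻ t in Ioo a r, g t := fun _ _ h =>
  add_le_add le_rfl (lintegral_mono_set (Ioo_subset_Ioo_right h))

/-- The sublevel set is an interval starting at `a`. Up to at most one point it is the directed
union of the intervals `(a, x)` with `x` a rational point of it, and on each of these the integral
of `g` is at most `s`. -/
theorem lintegral_sublevel_le (hJa : ∀ r ∈ J, a < r)
    (hJd : ∀ r ∈ J, ∀ t, a < t → t ≤ r → t ∈ J) (s : ENNReal) :
    ∫⁻ r in {r ∈ J | 1 + ∫⁻ t in Ioo a r, g t ≤ s}, g r ≤ s := by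
  set A := {r ∈ J | 1 + ∫⁻ t in Ioo a r, g t ≤ s} with hA
  have hAd : ∀ r ∈ A, ∀ t, a < t → t ≤ r → t ∈ A := fun r hr t h1 h2 =>
    ⟨hJd r hr.1 t h1 h2, (monotone_one_add_lintegral_Ioo a g h2).trans hr.2⟩
  set T : Set ℝ := ⋃ x : {x : ℚ // (x : ℝ) ∈ A}, Ioo a (x : ℝ) with hT
  have hsub : (A \ T).Subsingleton := by
    have key : ∀ x ∈ A \ T, ∀ y ∈ A \ T, ¬ x < y := by
      intro x hx y hy hxy
      obtain ⟨c, hc1, hc2⟩ := exists_rat_btwn hxy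
      exact hx.2 (mem_iUnion.2 ⟨⟨c, hAd y hy.1 c ((hJa x hx.1.1).trans hc1) hc2.le⟩,
        hJa x hx.1.1, hc1⟩)
    intro x hx y hy
    exact le_antisymm (not_lt.1 (key y hy x hx)) (not_lt.1 (key x hx y hy))
  have hae : A ≤ᵐ[volume] T := by
    have h0 : volume (A \ T) = 0 := hsub.measure_zero volume
    exact ae_le_set.2 h0
  refine (lintegral_mono_set' hae).trans ?_
  rw [hT, setLIntegral_iUnion_of_directed]
  · refine iSup_le fun x => le_trans ?_ x.2.2
    exact le_add_self
  · intro x y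
    rcases le_total (x : ℚ) (y : ℚ) with h | h
    · exact ⟨y, Ioo_subset_Ioo_right (by exact_mod_cast h), le_rfl⟩
    · exact ⟨x, le_rfl, Ioo_subset_Ioo_right (by exact_mod_cast h)⟩

/-- For a smooth primitive `Y` this is the convergence of `∫ Y' Y^(-1-δ)`. In general split
according to `2^n ≤ Y ≤ 2^(n+1)`: such a piece contributes at most `2^(n+1) · 2^(-n(1+δ)) = 2 ·
(2^(-δ))^n`, a term of a geometric series. -/
theorem lintegral_mul_rpow_neg_lt_top (hJ : MeasurableSet J) (hJa : ∀ r ∈ J, a < r)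
    (hJd : ∀ r ∈ J, ∀ t, a < t → t ≤ r → t ∈ J) (hg : Measurable g)
    (hfin : ∀ r ∈ J, ∫⁻ t in Ioo a r, g t < ⊤) (hδ : 0 < δ) :
    ∫⁻ r in J, g r * (1 + ∫⁻ t in Ioo a r, g t) ^ (-(1 + δ)) < ⊤ := by
  set Y : ℝ → ENNReal := fun r => 1 + ∫⁻ t in Ioo a r, g t with hY
  have hYm : Measurable Y := (monotone_one_add_lintegral_Ioo a g).measurable
  set A : ℕ → Set ℝ := fun n => {r ∈ J | Y r ≤ 2 ^ (n + 1)} with hA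
  have hAm : ∀ n, MeasurableSet (A n) := fun n => hJ.inter (hYm measurableSet_Iic)
  set c : ℕ → ENNReal := fun n => ((2 : ENNReal) ^ n) ^ (-(1 + δ)) with hc
  have hpt : ∀ r ∈ J, g r * Y r ^ (-(1 + δ)) ≤ ∑' n, (A n).indicator (fun r => g r * c n) r := by
    intro r hr
    have hYtop : Y r ≠ ⊤ := (ENNReal.add_lt_top.2 ⟨ENNReal.one_lt_top, hfin r hr⟩).ne
    have hY1 : 1 ≤ (Y r).toReal := by
      rw [← ENNReal.toReal_one]
      exact ENNReal.toReal_mono hYtop le_self_add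
    obtain ⟨n, h1, h2⟩ := exists_nat_pow_near hY1 one_lt_two
    have h1' : (2 : ENNReal) ^ n ≤ Y r := by
      rw [← ENNReal.ofReal_toReal hYtop]
      refine le_trans (le_of_eq ?_) (ENNReal.ofReal_le_ofReal h1)
      rw [ENNReal.ofReal_pow (by norm_num)]; simp
    have h2' : Y r ≤ (2 : ENNReal) ^ (n + 1) := by
      rw [← ENNReal.ofReal_toReal hYtop]
      refine le_trans (ENNReal.ofReal_le_ofReal h2.le) (le_of_eq ?_)
      rw [ENNReal.ofReal_pow (by norm_num)]; simp
    refine le_trans ?_ (ENNReal.le_tsum n)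
    rw [indicator_of_mem (show r ∈ A n from ⟨hr, h2'⟩)]
    gcongr
    simp only [hc]
    rw [ENNReal.rpow_neg, ENNReal.rpow_neg]
    gcongr
  calc ∫⁻ r in J, g r * Y r ^ (-(1 + δ))
      ≤ ∫⁻ r in J, ∑' n, (A n).indicator (fun r => g r * c n) r :=
        setLIntegral_mono' hJ hpt
    _ ≤ ∫⁻ r, ∑' n, (A n).indicator (fun r => g r * c n) r := setLIntegral_le_lintegral _ _
    _ = ∑' n, ∫⁻ r in A n, g r * c n := by
        rw [lintegral_tsum fun n => ((hg.mul_const _).indicator (hAm n)).aemeasurable]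
        simp only [lintegral_indicator (hAm _)]
    _ ≤ ∑' n : ℕ, 2 * ((2 : ENNReal) ^ (-δ)) ^ n := by
        refine ENNReal.tsum_le_tsum fun n => ?_
        rw [lintegral_mul_const _ hg]
        refine (mul_le_mul_left (lintegral_sublevel_le hJa hJd _) _).trans (le_of_eq ?_)
        simp only [hc]
        rw [← ENNReal.rpow_natCast, ← ENNReal.rpow_natCast, ← ENNReal.rpow_natCast,
          ← ENNReal.rpow_mul, ← ENNReal.rpow_mul, ← ENNReal.rpow_add _ _ (by simp) (by simp)]
        nth_rw 2 [← ENNReal.rpow_one 2]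
        rw [← ENNReal.rpow_add _ _ (by simp) (by simp)]
        congr 1
        push_cast
        ring
    _ < ⊤ := by
        rw [ENNReal.tsum_mul_left, ENNReal.tsum_geometric]
        refine ENNReal.mul_lt_top (by simp) ?_
        rw [ENNReal.inv_lt_top]
        refine tsub_pos_of_lt ?_
        rw [ENNReal.rpow_neg, ENNReal.inv_lt_one]
        exact ENNReal.one_lt_rpow (by norm_num) hδ

/-- Where the inequality fails, `γ < g Y^(-1-δ)`-type domination holds: `γ` is at most `g Y^(-(1 +
δ))`, whose integral is finite. -/
theorem exists_borel_exceptional_set (hJ : MeasurableSet J) (hJa : ∀ r ∈ J, a < r)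
    (hJd : ∀ r ∈ J, ∀ t, a < t → t ≤ r → t ∈ J) (hg : Measurable g)
    (hfin : ∀ r ∈ J, ∫⁻ t in Ioo a r, g t < ⊤) (hγ : Measurable γ) (hδ : 0 < δ) :
    ∃ E ⊆ J, MeasurableSet E ∧ ∫⁻ r in E, γ r < ⊤ ∧
      ∀ r ∈ J, r ∉ E → g r ≤ γ r * (1 + ∫⁻ t in Ioo a r, g t) ^ (1 + δ) := by
  set Y : ℝ → ENNReal := fun r => 1 + ∫⁻ t in Ioo a r, g t with hY
  have hYm : Measurable Y := (monotone_one_add_lintegral_Ioo a g).measurable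
  have hm : MeasurableSet {r | γ r * Y r ^ (1 + δ) < g r} :=
    measurableSet_lt (hγ.mul (hYm.pow_const _)) hg
  refine ⟨{r ∈ J | γ r * Y r ^ (1 + δ) < g r}, fun r hr => hr.1, hJ.inter hm, ?_,
    fun r hr hrE => not_lt.1 fun h => hrE ⟨hr, h⟩⟩
  refine lt_of_le_of_lt ?_ (lintegral_mul_rpow_neg_lt_top hJ hJa hJd hg hfin hδ)
  refine le_trans (setLIntegral_mono' (hJ.inter hm) fun r hr => ?_)
    (lintegral_mono_set fun r hr => hr.1)
  have hYtop : Y r ≠ ⊤ := (ENNReal.add_lt_top.2 ⟨ENNReal.one_lt_top, hfin r hr.1⟩).ne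
  have hY0 : Y r ≠ 0 := (lt_of_lt_of_le one_pos le_self_add).ne'
  have h1 : γ r = γ r * Y r ^ (1 + δ) * Y r ^ (-(1 + δ)) := by
    rw [mul_assoc, ← ENNReal.rpow_add _ _ hY0 hYtop]; simp
  rw [h1]
  exact mul_le_mul_left hr.2.le _

/-- The iterated growth lemma, for the functions `Γ(t) = ∫_0^t g` and
`F(r) = ∫_a^r Γ(t) dt / t`. -/
theorem exists_iterated_borel_exceptional_set (hJ : MeasurableSet J) (ha : 0 < a)
    (hJa : ∀ r ∈ J, a < r) (hJd : ∀ r ∈ J, ∀ t, a < t → t ≤ r → t ∈ J)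
    (hJu : ∀ r ∈ J, ∃ r' ∈ J, r < r') (hg : Measurable g)
    (hfin : ∀ r ∈ J, ∫⁻ t in Ioo a r, (∫⁻ τ in Ioo 0 t, g τ) / ENNReal.ofReal t < ⊤)
    (hγ : Measurable γ) (hδ : 0 < δ) :
    ∃ E ⊆ J, MeasurableSet E ∧ ∫⁻ r in E, γ r < ⊤ ∧ ∀ r ∈ J, r ∉ E →
      ∫⁻ τ in Ioo 0 r, g τ < ⊤ ∧
      g r ≤ γ r * (1 + ∫⁻ τ in Ioo 0 r, g τ) ^ (1 + δ) ∧
      (∫⁻ τ in Ioo 0 r, g τ) / ENNReal.ofReal r ≤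
        γ r * (1 + ∫⁻ t in Ioo a r, (∫⁻ τ in Ioo 0 t, g τ) / ENNReal.ofReal t) ^ (1 + δ) := by
  set Γ : ℝ → ENNReal := fun t => ∫⁻ τ in Ioo 0 t, g τ with hΓ
  have hΓmono : Monotone Γ := fun _ _ h => lintegral_mono_set (Ioo_subset_Ioo_right h)
  -- If `Γ r` were infinite, `Γ t / t` would be infinite on the whole interval `(r, r')`, against
  -- the finiteness of the outer integral at `r'`.
  have hΓfin : ∀ r ∈ J, Γ r < ⊤ := by
    intro r hr
    obtain ⟨r', hr', hrr'⟩ := hJu r hr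
    have har := hJa r hr
    have h1 : ∫⁻ _ in Ioo r r', Γ r / ENNReal.ofReal r' ≤
        ∫⁻ t in Ioo a r', Γ t / ENNReal.ofReal t := by
      refine le_trans (setLIntegral_mono' measurableSet_Ioo fun t ht => ?_)
        (lintegral_mono_set (Ioo_subset_Ioo_left har.le))
      exact ENNReal.div_le_div (hΓmono ht.1.le) (ENNReal.ofReal_le_ofReal ht.2.le)
    have h2 := h1.trans_lt (hfin r' hr')
    rw [setLIntegral_const, Real.volume_Ioo] at h2
    by_contra htop
    rw [not_lt, top_le_iff] at htop
    rw [htop, ENNReal.top_div_of_ne_top ENNReal.ofReal_ne_top, ENNReal.top_mul] at h2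
    · exact lt_irrefl _ h2
    · simpa using hrr'
  obtain ⟨E₁, hE₁, hE₁m, hE₁γ, h1⟩ := exists_borel_exceptional_set (g := fun t =>
    Γ t / ENNReal.ofReal t) hJ hJa hJd (hΓmono.measurable.div ENNReal.measurable_ofReal) hfin hγ hδ
  have hle : ∀ r, ∫⁻ t in Ioo a r, g t ≤ Γ r := fun r =>
    lintegral_mono_set (Ioo_subset_Ioo_left ha.le)
  obtain ⟨E₂, hE₂, hE₂m, hE₂γ, h2⟩ := exists_borel_exceptional_set hJ hJa hJd hg
    (fun r hr => (hle r).trans_lt (hΓfin r hr)) hγ hδ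
  refine ⟨E₁ ∪ E₂, union_subset hE₁ hE₂, hE₁m.union hE₂m,
    (lintegral_union_le _ _ _).trans_lt (ENNReal.add_lt_top.2 ⟨hE₁γ, hE₂γ⟩), fun r hr hrE => ?_⟩
  rw [mem_union, not_or] at hrE
  refine ⟨hΓfin r hr, (h2 r hr hrE.2).trans ?_, h1 r hr hrE.1⟩
  gcongr

/-- The growth lemma in logarithmic form. -/
theorem log_le_of_iterated_borel {r c G F Γ : ℝ} (hδ : 0 < δ) (hδ1 : δ ≤ 1)
    (hr : 0 < r) (hc : 1 ≤ c) (hG : 0 < G) (hΓ : 0 ≤ Γ) (hF : 0 ≤ F)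
    (h1 : ENNReal.ofReal G ≤ ENNReal.ofReal c * (1 + ENNReal.ofReal Γ) ^ (1 + δ))
    (h2 : ENNReal.ofReal Γ / ENNReal.ofReal r ≤
      ENNReal.ofReal c * (1 + ENNReal.ofReal F) ^ (1 + δ)) :
    Real.log G ≤ 3 * Real.log c + (1 + δ) * Real.log (1 + r) + 4 * Real.log (1 + F) := by
  have hc0 : 0 < c := one_pos.trans_le hc
  have conv : ∀ x : ℝ, 0 ≤ x → ENNReal.ofReal c * (1 + ENNReal.ofReal x) ^ (1 + δ) =
      ENNReal.ofReal (c * (1 + x) ^ (1 + δ)) := by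
    intro x hx
    rw [ENNReal.ofReal_mul hc0.le, ← ENNReal.ofReal_one, ← ENNReal.ofReal_add zero_le_one hx,
      ENNReal.ofReal_rpow_of_pos (by linarith)]
  rw [conv _ hΓ, ENNReal.ofReal_le_ofReal_iff (by positivity)] at h1
  rw [conv _ hF, ← ENNReal.ofReal_div_of_pos hr, ENNReal.ofReal_le_ofReal_iff (by positivity),
    div_le_iff₀ hr] at h2
  have hB : 1 ≤ c * (1 + F) ^ (1 + δ) := by
    have : 1 ≤ (1 + F) ^ (1 + δ) := Real.one_le_rpow (by linarith) (by linarith)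
    nlinarith
  have h3 : 1 + Γ ≤ (1 + r) * (c * (1 + F) ^ (1 + δ)) := by nlinarith
  have l1 := Real.log_le_log hG h1
  have l3 := Real.log_le_log (by linarith : 0 < 1 + Γ) h3
  rw [Real.log_mul hc0.ne' (by positivity), Real.log_rpow (by linarith)] at l1
  rw [Real.log_mul (by linarith) (by positivity), Real.log_mul hc0.ne' (by positivity),
    Real.log_rpow (by linarith)] at l3
  have hlc : 0 ≤ Real.log c := Real.log_nonneg hc
  have hlF : 0 ≤ Real.log (1 + F) := Real.log_nonneg (by linarith)
  have l4 := mul_le_mul_of_nonneg_left l3 (by linarith : 0 ≤ 1 + δ)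
  -- Inserting the bound for `1 + Γ` gives the coefficients `1 + (1 + δ) ≤ 3` and `(1 + δ)² ≤ 4`.
  -- The coefficient `1 + δ` of `log (1 + r)` is kept exact: it must later cancel `log r` up to `δ
  -- log r`.
  have l5 : (1 + δ) * (1 + δ) ≤ 4 := by nlinarith
  nlinarith [mul_le_mul_of_nonneg_right l5 hlF, mul_le_mul_of_nonneg_right hδ1 hlc]

end Borel

/-! ### Maps of a disc to the sphere: counting and regular radii -/

/-- A set of radii of the form `(0, R)` with `0 < R ≤ ∞`. -/
structure IsRadii (I : Set ℝ) : Prop where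
  pos : ∀ r ∈ I, 0 < r
  down : ∀ r ∈ I, ∀ t, 0 < t → t ≤ r → t ∈ I
  up : ∀ r ∈ I, ∃ r' ∈ I, r < r'

/-- The Fubini-Study density `K` and the squared chordal distances `X j` of a holomorphic map from a
disc to the sphere, given on each smaller disc by a reduced representation of the map. -/
structure IsSphereMap (I : Set ℝ) {q : ℕ} (b : Fin q → ℂ × ℂ) (K : ℂ → ℝ) (X : Fin q → ℂ → ℝ) :
    Prop where
  unit : ∀ j, ‖(b j).1‖ ^ 2 + ‖(b j).2‖ ^ 2 = 1
  exists_pair : ∀ ρ ∈ I, ∃ f₀ f₁, IsReducedPair f₀ f₁ ρ ∧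
    EqOn K (fsDensity f₀ f₁) (Metric.ball 0 ρ) ∧
    ∀ j, EqOn (X j) (chordalSq (b j) f₀ f₁) (Metric.ball 0 ρ)

/-- A radius such that the map is unramified and omits the given values on the circle. -/
def IsRegularRadius {q : ℕ} (K : ℂ → ℝ) (X : Fin q → ℂ → ℝ) (r : ℝ) : Prop :=
  ∀ z : ℂ, ‖z‖ = r → K z ≠ 0 ∧ ∀ j, X j z ≠ 0

/-- A point `u` is counted from the radius `max r₁ ‖u‖` on, which yields exactly the expression by
which a zero enters Jensen's formula. -/
theorem integral_indicator_div {u : ℂ} {r₁ r : ℝ} (h0 : 0 < r₁) (h1 : r₁ ≤ r) (hu : ‖u‖ ≤ r) :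
    IntervalIntegrable (fun t => (if ‖u‖ < t then (1 : ℝ) else 0) / t) volume r₁ r ∧
    ∫ t in r₁..r, (if ‖u‖ < t then (1 : ℝ) else 0) / t =
      Real.log (max r ‖u‖) - Real.log (max r₁ ‖u‖) := by
  set m := max r₁ ‖u‖ with hm
  have hm0 : 0 < m := lt_max_of_lt_left h0
  have hm1 : r₁ ≤ m := le_max_left _ _
  have hm2 : m ≤ r := max_le h1 hu
  have e1 : EqOn (fun t => (if ‖u‖ < t then (1 : ℝ) else 0) / t) (fun _ => 0) (uIoc r₁ m) := by
    intro t ht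
    rw [uIoc_of_le hm1] at ht
    have : ¬ ‖u‖ < t := by
      intro hlt
      rcases le_max_iff.1 ht.2 with h | h
      · exact absurd ht.1 (not_lt.2 h)
      · exact absurd hlt (not_lt.2 h)
    simp [this]
  have e2 : EqOn (fun t => (if ‖u‖ < t then (1 : ℝ) else 0) / t) (fun t => t⁻¹) (uIoc m r) := by
    intro t ht
    rw [uIoc_of_le hm2] at ht
    have : ‖u‖ < t := (le_max_right _ _).trans_lt ht.1
    simp [this]
  have i1 : IntervalIntegrable (fun t => (if ‖u‖ < t then (1 : ℝ) else 0) / t) volume r₁ m :=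
    (intervalIntegrable_const (c := (0 : ℝ))).congr e1.symm
  have i2 : IntervalIntegrable (fun t => (if ‖u‖ < t then (1 : ℝ) else 0) / t) volume m r := by
    refine IntervalIntegrable.congr e2.symm ?_
    refine intervalIntegral.intervalIntegrable_inv (fun t ht => ?_) continuousOn_id
    rw [uIcc_of_le hm2] at ht
    exact (hm0.trans_le ht.1).ne'
  refine ⟨i1.trans i2, ?_⟩
  rw [← intervalIntegral.integral_add_adjacent_intervals i1 i2,
    intervalIntegral.integral_congr_ae (Eventually.of_forall fun t ht => e1 ht),
    intervalIntegral.integral_congr_ae (Eventually.of_forall fun t ht => e2 ht),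
    integral_inv_of_pos hm0 (hm0.trans_le hm2), intervalIntegral.integral_zero, zero_add,
    max_eq_left hu, Real.log_div (hm0.trans_le hm2).ne' hm0.ne']

theorem integral_ncard_div {P : ℂ → Prop} {Z : Finset ℂ} {r₁ r : ℝ} (h0 : 0 < r₁) (h1 : r₁ ≤ r)
    (hZ : ∀ u, u ∈ Z ↔ ‖u‖ ≤ r ∧ P u) :
    IntervalIntegrable (fun t => ({u : ℂ | ‖u‖ < t ∧ P u}.ncard : ℝ) / t) volume r₁ r ∧
    ∫ t in r₁..r, ({u : ℂ | ‖u‖ < t ∧ P u}.ncard : ℝ) / t =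
      ∑ u ∈ Z, (Real.log (max r ‖u‖) - Real.log (max r₁ ‖u‖)) := by
  have e : EqOn (fun t => ∑ u ∈ Z, (if ‖u‖ < t then (1 : ℝ) else 0) / t)
      (fun t => ({u : ℂ | ‖u‖ < t ∧ P u}.ncard : ℝ) / t) (uIoc r₁ r) := by
    intro t ht
    rw [uIoc_of_le h1] at ht
    have hset : {u : ℂ | ‖u‖ < t ∧ P u} = ((Z.filter fun u => ‖u‖ < t : Finset ℂ) : Set ℂ) := by
      ext u
      simp only [Finset.coe_filter, mem_ofPred_eq, hZ]
      constructor
      · rintro ⟨h, hp⟩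
        exact ⟨⟨h.le.trans ht.2, hp⟩, h⟩
      · rintro ⟨⟨_, hp⟩, h⟩
        exact ⟨h, hp⟩
    simp only [hset, ncard_coe_finset, ← Finset.sum_div, Finset.sum_boole]
  have hi := fun u (hu : u ∈ Z) => integral_indicator_div h0 h1 ((hZ u).1 hu).1
  refine ⟨(IntervalIntegrable.sum Z fun u hu => (hi u hu).1).congr ?_, ?_⟩
  · intro t ht
    simpa using e ht
  · rw [← intervalIntegral.integral_congr_ae (Eventually.of_forall fun t ht => e ht),
      intervalIntegral.integral_finsetSum fun u hu => (hi u hu).1]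
    exact Finset.sum_congr rfl fun u hu => (hi u hu).2

theorem greenAverage_pos {g : ℂ → ℝ} {ρ r₀ r s : ℝ} (hg : ContinuousOn g (Metric.ball 0 ρ))
    (hg0 : ∀ z ∈ Metric.ball (0 : ℂ) ρ, 0 ≤ g z) (hs0 : 0 < s) (hs : s < r₀) (h1 : r₀ < r)
    (h2 : r < ρ) (hpos : 0 < Real.circleAverage g 0 s) : 0 < greenAverage g r₀ r := by
  have hr₀ := hs0.trans hs
  have hA : ∀ t ∈ Icc r₀ r, 0 < (∫ τ in (0 : ℝ)..t, τ * Real.circleAverage g 0 τ) / t := by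
    intro t ht
    have ht0 := hr₀.trans_le ht.1
    refine div_pos (intervalIntegral.integral_pos ht0
      (continuousOn_mul_circleAverage_Icc hg (ht.2.trans_lt h2)) (fun τ hτ => ?_)
      ⟨s, ⟨hs0.le, hs.le.trans ht.1⟩, mul_pos hs0 hpos⟩) ht0
    refine mul_nonneg hτ.1.le (Real.circleAverage_nonneg_of_nonneg fun z hz => hg0 z ?_)
    rw [abs_of_pos hτ.1] at hz
    exact Metric.closedBall_subset_ball (hτ.2.trans_lt (ht.2.trans_lt h2))
      (Metric.sphere_subset_closedBall hz)
  exact intervalIntegral.integral_pos h1 (continuousOn_integral_circleAverage_div hg hr₀ h1.le h2)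
    (fun t ht => (hA t (Ioc_subset_Icc_self ht)).le) ⟨r, right_mem_Icc.2 h1.le,
      hA r (right_mem_Icc.2 h1.le)⟩

namespace IsSphereMap

variable {I : Set ℝ} {q : ℕ} {b : Fin q → ℂ × ℂ} {K : ℂ → ℝ} {X : Fin q → ℂ → ℝ}

theorem continuousOn_density (h : IsSphereMap I b K X) {ρ : ℝ} (hρ : ρ ∈ I) :
    ContinuousOn K (Metric.ball 0 ρ) := by
  obtain ⟨f₀, f₁, hp, hK, -⟩ := h.exists_pair ρ hρ
  exact hp.continuousOn_fsDensity.congr hK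

theorem continuousOn_chordal (h : IsSphereMap I b K X) {ρ : ℝ} (hρ : ρ ∈ I) (j : Fin q) :
    ContinuousOn (X j) (Metric.ball 0 ρ) := by
  obtain ⟨f₀, f₁, hp, -, hX⟩ := h.exists_pair ρ hρ
  exact (hp.continuousOn_chordalSq (b j)).congr (hX j)

theorem density_nonneg (h : IsSphereMap I b K X) {ρ : ℝ} (hρ : ρ ∈ I) {z : ℂ}
    (hz : z ∈ Metric.ball (0 : ℂ) ρ) : 0 ≤ K z := by
  obtain ⟨f₀, f₁, hp, hK, -⟩ := h.exists_pair ρ hρ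
  rw [hK hz, fsDensity]
  positivity

theorem chordal_mem (h : IsSphereMap I b K X) {ρ : ℝ} (hρ : ρ ∈ I) {z : ℂ}
    (hz : z ∈ Metric.ball (0 : ℂ) ρ) (j : Fin q) : X j z ∈ Icc (0 : ℝ) 1 := by
  obtain ⟨f₀, f₁, hp, -, hX⟩ := h.exists_pair ρ hρ
  rw [hX j hz]
  exact ⟨hp.chordalSq_nonneg _ hz, hp.chordalSq_le_one (h.unit j) hz⟩

/-- The density vanishes exactly where the Wronskian of a reduced pair does, so the identity theorem
applies. -/
theorem exists_density_ne_zero (hI : IsRadii I) (h : IsSphereMap I b K X)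
    (hK : ∃ ρ ∈ I, ∃ z ∈ Metric.ball (0 : ℂ) ρ, K z ≠ 0) {ρ : ℝ} (hρ : ρ ∈ I) :
    ∃ z ∈ Metric.ball (0 : ℂ) ρ, K z ≠ 0 := by
  obtain ⟨ρ₁, hρ₁, z₁, hz₁, hne⟩ := hK
  by_contra! hall
  have hmax : max ρ ρ₁ ∈ I := by
    rcases max_choice ρ ρ₁ with h | h <;> rw [h] <;> assumption
  obtain ⟨f₀, f₁, hp, hK, -⟩ := h.exists_pair _ hmax
  have hW : ∀ z ∈ Metric.ball (0 : ℂ) (max ρ ρ₁), K z = 0 ↔ wronskian f₀ f₁ z = 0 := by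
    intro z hz
    rw [hK hz, fsDensity]
    have := hp.normSq_pos hz
    simp [this.ne']
  have h0 : (0 : ℂ) ∈ Metric.ball (0 : ℂ) (max ρ ρ₁) := by simp [hI.pos ρ hρ]
  have hz : wronskian f₀ f₁ z₁ = 0 := by
    refine hp.analyticAt_wronskian.eqOn_zero_of_preconnected_of_eventuallyEq_zero
      (convex_ball 0 _).isPreconnected h0 ?_ (Metric.ball_subset_ball (le_max_right _ _) hz₁)
    filter_upwards [Metric.isOpen_ball.mem_nhds (Metric.mem_ball_self (x := (0 : ℂ)) (hI.pos ρ hρ))]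
      with w hw
    exact (hW w (Metric.ball_subset_ball (le_max_left _ _) hw)).1 (hall w hw)
  exact hne ((hW z₁ (Metric.ball_subset_ball (le_max_right _ _) hz₁)).2 hz)

theorem exists_finset_zeros (hI : IsRadii I) (h : IsSphereMap I b K X)
    (hK : ∃ ρ ∈ I, ∃ z ∈ Metric.ball (0 : ℂ) ρ, K z ≠ 0) {r : ℝ} (hr : r ∈ I) :
    {u : ℂ | ‖u‖ ≤ r ∧ K u = 0}.Finite ∧ ∀ j, {u : ℂ | ‖u‖ ≤ r ∧ X j u = 0}.Finite := by
  obtain ⟨ρ, hρ, hrρ⟩ := hI.up r hr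
  obtain ⟨f₀, f₁, hp, hKe, hX⟩ := h.exists_pair ρ hρ
  obtain ⟨z, hz, hz0⟩ := exists_density_ne_zero hI h hK hρ
  have hW : ∃ z ∈ Metric.ball (0 : ℂ) ρ, wronskian f₀ f₁ z ≠ 0 := by
    refine ⟨z, hz, fun hw => hz0 ?_⟩
    rw [hKe hz, fsDensity, hw]; simp
  have hmem : ∀ u : ℂ, ‖u‖ ≤ r → u ∈ Metric.ball (0 : ℂ) ρ := fun u hu => by
    simpa using hu.trans_lt hrρ
  refine ⟨(finite_zeros_of_analyticOnNhd hp.analyticAt_wronskian hrρ hW).subset fun u hu => ?_,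
    fun j => (finite_zeros_of_analyticOnNhd (hp.analyticAt_linForm (b j)) hrρ
      (hp.exists_linForm_ne_zero hW (h.unit j))).subset fun u hu => ?_⟩
  · refine ⟨by simpa using hu.1, ?_⟩
    have := hu.2
    rw [hKe (hmem u hu.1), fsDensity] at this
    simpa [(hp.normSq_pos (hmem u hu.1)).ne'] using this
  · refine ⟨by simpa using hu.1, ?_⟩
    have := hu.2
    rw [hX j (hmem u hu.1), chordalSq] at this
    simpa [(hp.normSq_pos (hmem u hu.1)).ne'] using this

/-- Each closed disc contains finitely many zeros, and discs of rational radius suffice. Irregular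
radii form a null set and can be put into the exceptional set, so all logarithms may be taken to be
continuous on the circles in use. -/
theorem countable_not_isRegularRadius (hI : IsRadii I) (h : IsSphereMap I b K X)
    (hK : ∃ ρ ∈ I, ∃ z ∈ Metric.ball (0 : ℂ) ρ, K z ≠ 0) :
    {r ∈ I | ¬ IsRegularRadius K X r}.Countable := by
  have hsub : {r ∈ I | ¬ IsRegularRadius K X r} ⊆ ⋃ x : {x : ℚ // (x : ℝ) ∈ I},
      (fun u : ℂ => ‖u‖) '' ({u : ℂ | ‖u‖ ≤ (x : ℝ) ∧ K u = 0} ∪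
        ⋃ j, {u : ℂ | ‖u‖ ≤ (x : ℝ) ∧ X j u = 0}) := by
    rintro r ⟨hr, hreg⟩
    obtain ⟨r', hr', hlt⟩ := hI.up r hr
    obtain ⟨x, hx1, hx2⟩ := exists_rat_btwn hlt
    have hxI : (x : ℝ) ∈ I := hI.down r' hr' x ((hI.pos r hr).trans hx1) hx2.le
    simp only [IsRegularRadius, not_forall] at hreg
    obtain ⟨z, hz, hzz⟩ := hreg
    refine mem_iUnion.2 ⟨⟨x, hxI⟩, z, ?_, hz⟩
    have hzx : ‖z‖ ≤ (x : ℝ) := hz.le.trans hx1.le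
    by_cases hKz : K z = 0
    · exact Or.inl ⟨hzx, hKz⟩
    · have : ∃ j, X j z = 0 := by
        by_contra! hall
        exact hzz ⟨hKz, hall⟩
      obtain ⟨j, hj⟩ := this
      exact Or.inr (mem_iUnion.2 ⟨j, hzx, hj⟩)
  refine (countable_iUnion fun x => Set.Countable.image ?_ _).mono hsub
  have := h.exists_finset_zeros hI hK x.2
  exact this.1.countable.union (countable_iUnion fun j => (this.2 j).countable)

theorem exists_isRegularRadius (hI : IsRadii I) (h : IsSphereMap I b K X)
    (hK : ∃ ρ ∈ I, ∃ z ∈ Metric.ball (0 : ℂ) ρ, K z ≠ 0) {s t : ℝ} (hst : s < t) (hs : 0 ≤ s)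
    (ht : t ∈ I) : ∃ r ∈ I, s < r ∧ r < t ∧ IsRegularRadius K X r := by
  have hc := countable_not_isRegularRadius hI h hK
  obtain ⟨r, hr, hrn⟩ : ∃ r ∈ Ioo s t, r ∉ {r ∈ I | ¬ IsRegularRadius K X r} := by
    by_contra! hall
    have := hc.mono hall
    exact (Cardinal.Real.Ioo_countable_iff.1 this).not_gt hst
  have hrI : r ∈ I := hI.down t ht r (hs.trans_lt hr.1) hr.2.le
  refine ⟨r, hrI, hr.1, hr.2, ?_⟩
  by_contra hreg
  exact hrn ⟨hrI, hreg⟩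

end IsSphereMap

/-! ### Concavity of the logarithm, and separation of the values -/

/-- Averaging the tangent line inequality `log x ≤ x / m + log m - 1` at the mean `m` of `g` proves
the bound. -/
theorem circleAverage_log_le {g : ℂ → ℝ} {r : ℝ} (hr : 0 ≤ r)
    (hg : ContinuousOn g (Metric.sphere 0 r)) (hpos : ∀ z ∈ Metric.sphere (0 : ℂ) r, 0 < g z) :
    0 < Real.circleAverage g 0 r ∧
      Real.circleAverage (fun z => Real.log (g z)) 0 r ≤ Real.log (Real.circleAverage g 0 r) := by
  have hne : (Metric.sphere (0 : ℂ) r).Nonempty := NormedSpace.sphere_nonempty.2 hr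
  obtain ⟨z₀, hz₀, hmin⟩ := (isCompact_sphere (0 : ℂ) r).exists_isMinOn hne hg
  have hi : CircleIntegrable g 0 r := hg.circleIntegrable hr
  have hm : 0 < Real.circleAverage g 0 r := by
    refine (hpos z₀ hz₀).trans_le ?_
    rw [← Real.circleAverage_const (g z₀) (0 : ℂ) r]
    refine Real.circleAverage_mono (circleIntegrable_const _ _ _) hi fun z hz => ?_
    rw [abs_of_nonneg hr] at hz
    exact hmin hz
  refine ⟨hm, ?_⟩
  set m := Real.circleAverage g 0 r with hmdef
  have hlog : ContinuousOn (fun z => Real.log (g z)) (Metric.sphere 0 r) :=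
    hg.log fun z hz => (hpos z hz).ne'
  have hcont : ContinuousOn (fun z => m⁻¹ * g z + (Real.log m - 1)) (Metric.sphere 0 r) := by
    fun_prop
  calc Real.circleAverage (fun z => Real.log (g z)) 0 r
      ≤ Real.circleAverage (fun z => m⁻¹ * g z + (Real.log m - 1)) 0 r := by
        refine Real.circleAverage_mono (hlog.circleIntegrable hr) (hcont.circleIntegrable hr)
          fun z hz => ?_
        rw [abs_of_nonneg hr] at hz
        have := Real.log_le_sub_one_of_pos (mul_pos (inv_pos.2 hm) (hpos z hz))
        rw [Real.log_mul (inv_pos.2 hm).ne' (hpos z hz).ne', Real.log_inv] at this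
        linarith
    _ = m⁻¹ * m + (Real.log m - 1) := by
        rw [Real.circleAverage_fun_add (f₁ := fun z => m⁻¹ * g z) (f₂ := fun _ => Real.log m - 1)
          ((hg.const_smul m⁻¹).circleIntegrable hr) (circleIntegrable_const _ _ _),
          Real.circleAverage_const]
        congr 1
        exact Real.circleAverage_fun_smul (a := m⁻¹) (f := g)
    _ = Real.log m := by rw [inv_mul_cancel₀ hm.ne']; ring

/-- Cramer's rule recovers `f₀` and `f₁` from the two linear forms, so both forms cannot be small
relative to the norm: the map is close to at most one of the values. -/
theorem le_chordalSq_add {b b' : ℂ × ℂ} (hb : ‖b.1‖ ^ 2 + ‖b.2‖ ^ 2 = 1)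
    (hb' : ‖b'.1‖ ^ 2 + ‖b'.2‖ ^ 2 = 1) {f₀ f₁ : ℂ → ℂ} {ρ : ℝ} (h : IsReducedPair f₀ f₁ ρ) {z : ℂ}
    (hz : z ∈ Metric.ball (0 : ℂ) ρ) :
    ‖formDet b b'‖ ^ 2 / 2 ≤ chordalSq b f₀ f₁ z + chordalSq b' f₀ f₁ z := by
  have hN := h.normSq_pos hz
  rw [chordalSq, chordalSq, ← add_div, le_div_iff₀ hN]
  have key : ∀ u v : ℂ, ‖u - v‖ ^ 2 ≤ 2 * (‖u‖ ^ 2 + ‖v‖ ^ 2) := by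
    intro u v
    have h1 := norm_sub_le u v
    nlinarith [sq_nonneg (‖u‖ - ‖v‖), norm_nonneg (u - v), norm_nonneg u, norm_nonneg v]
  have e₀ : formDet b b' * f₀ z = b'.2 * linForm b f₀ f₁ z - b.2 * linForm b' f₀ f₁ z := by
    simp only [formDet, linForm]; ring
  have e₁ : formDet b b' * f₁ z = b.1 * linForm b' f₀ f₁ z - b'.1 * linForm b f₀ f₁ z := by
    simp only [formDet, linForm]; ring
  have k₀ := key (b'.2 * linForm b f₀ f₁ z) (b.2 * linForm b' f₀ f₁ z)
  have k₁ := key (b.1 * linForm b' f₀ f₁ z) (b'.1 * linForm b f₀ f₁ z)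
  rw [← e₀] at k₀
  rw [← e₁] at k₁
  simp only [norm_mul, mul_pow] at k₀ k₁
  simp only [weightedNormSq, one_mul]
  have s1 : ‖b'.2‖ ^ 2 * ‖linForm b f₀ f₁ z‖ ^ 2 + ‖b'.1‖ ^ 2 * ‖linForm b f₀ f₁ z‖ ^ 2 =
      ‖linForm b f₀ f₁ z‖ ^ 2 := by rw [← add_mul, add_comm, hb', one_mul]
  have s2 : ‖b.2‖ ^ 2 * ‖linForm b' f₀ f₁ z‖ ^ 2 + ‖b.1‖ ^ 2 * ‖linForm b' f₀ f₁ z‖ ^ 2 =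
      ‖linForm b' f₀ f₁ z‖ ^ 2 := by rw [← add_mul, add_comm, hb, one_mul]
  nlinarith

/-- At most one `x i` lies below `c`; every other factor is at most `c⁻¹`. This replaces a product
of singularities by a sum, whose terms can be integrated one at a time. -/
theorem prod_inv_le {q : ℕ} {c : ℝ} (hc : 0 < c) (hc1 : c ≤ 1) {x : Fin q → ℝ}
    (hx : ∀ j, 0 < x j) (hx1 : ∀ j, x j ≤ 1) (hsep : ∀ i j, i ≠ j → 2 * c ≤ x i + x j) :
    ∏ j, (x j)⁻¹ ≤ (c⁻¹) ^ q * (1 + ∑ j, ((x j)⁻¹ - 1)) := by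
  have hci : 1 ≤ c⁻¹ := (one_le_inv₀ hc).2 hc1
  have hnn : ∀ j, 0 ≤ (x j)⁻¹ - 1 := fun j => sub_nonneg.2 ((one_le_inv₀ (hx j)).2 (hx1 j))
  by_cases hall : ∀ j, c ≤ x j
  · have h1 : ∏ j, (x j)⁻¹ ≤ (c⁻¹) ^ q := by
      calc ∏ j, (x j)⁻¹ ≤ ∏ _j : Fin q, c⁻¹ := Finset.prod_le_prod
            (fun j _ => (inv_pos.2 (hx j)).le) fun j _ => inv_anti₀ hc (hall j)
        _ = (c⁻¹) ^ q := by simp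
    have h2 : 0 ≤ ∑ j, ((x j)⁻¹ - 1) := Finset.sum_nonneg fun j _ => hnn j
    nlinarith [pow_pos (inv_pos.2 hc) q]
  · push Not at hall
    obtain ⟨i, hi⟩ := hall
    have hoth : ∀ j, j ≠ i → c ≤ x j := fun j hj => by linarith [hsep j i hj]
    have hle : (x i)⁻¹ - 1 ≤ ∑ j, ((x j)⁻¹ - 1) :=
      Finset.single_le_sum (fun j _ => hnn j) (Finset.mem_univ i)
    have hcard : (Finset.univ.erase i).card ≤ q := by
      simp
    have h1 : ∏ j ∈ Finset.univ.erase i, (x j)⁻¹ ≤ (c⁻¹) ^ q := by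
      calc ∏ j ∈ Finset.univ.erase i, (x j)⁻¹ ≤ ∏ _j ∈ Finset.univ.erase i, c⁻¹ :=
            Finset.prod_le_prod (fun j _ => (inv_pos.2 (hx j)).le) fun j hj =>
              inv_anti₀ hc (hoth j (Finset.ne_of_mem_erase hj))
        _ = (c⁻¹) ^ (Finset.univ.erase i).card := by simp
        _ ≤ (c⁻¹) ^ q := pow_le_pow_right₀ hci hcard
    rw [← Finset.mul_prod_erase _ _ (Finset.mem_univ i), mul_comm]
    refine mul_le_mul h1 (by linarith) (inv_pos.2 (hx i)).le (by positivity)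

theorem regDensity_zero {K x : ℝ} (hx : x ≠ 0) :
    regDensity 0 K x * (2 - Real.log x) ^ 2 = K * (x⁻¹ - 1) ∨ 2 - Real.log x = 0 := by
  by_cases h : 2 - Real.log x = 0
  · exact Or.inr h
  · left
    simp only [regDensity, add_zero]
    field_simp

theorem regDensity_nonneg {ε K x : ℝ} (hK : 0 ≤ K) (hx : 0 ≤ x) (hx1 : x ≤ 1) :
    0 ≤ regDensity ε K x := by
  have : 0 ≤ 1 - x := by linarith
  rw [regDensity]
  positivity

/-- The derivative `1 - log s` is positive on `(0, 2]`. Hence the regularized densities increase as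
`ε` decreases, as monotone convergence requires. -/
theorem mul_two_sub_log_mono {s t : ℝ} (hs : 0 < s) (hst : s ≤ t) (ht : t ≤ 2) :
    s * (2 - Real.log s) ≤ t * (2 - Real.log t) := by
  have ht0 := hs.trans_le hst
  have h1 : Real.log t - Real.log s ≤ t / s - 1 := by
    rw [← Real.log_div ht0.ne' hs.ne']
    exact Real.log_le_sub_one_of_pos (div_pos ht0 hs)
  have h2 : s * (Real.log t - Real.log s) ≤ t - s := by
    have := mul_le_mul_of_nonneg_left h1 hs.le
    rwa [mul_sub s (t / s), mul_div_cancel₀ _ hs.ne', mul_one] at this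
  have h3 := one_le_two_sub_log ht0 ht
  nlinarith

theorem regDensity_antitone {ε ε' K x : ℝ} (hK : 0 ≤ K) (hx : 0 ≤ x) (hx1 : x ≤ 1)
    (h : ε ≤ ε') (hε' : ε' ≤ 1) (h0 : 0 < x + ε) :
    regDensity ε' K x ≤ regDensity ε K x := by
  have hm := mul_two_sub_log_mono h0 (by linarith : x + ε ≤ x + ε') (by linarith)
  have h1 := one_le_two_sub_log h0 (by linarith)
  have : 0 ≤ 1 - x := by linarith
  rw [regDensity, regDensity, ← mul_pow, ← mul_pow]
  gcongr

namespace IsSphereMap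

variable {I : Set ℝ} {q : ℕ} {b : Fin q → ℂ × ℂ} {K : ℂ → ℝ} {X : Fin q → ℂ → ℝ} {r₁ r : ℝ}

theorem continuousOn_log_chordal (hI : IsRadii I) (h : IsSphereMap I b K X) (hr : r ∈ I)
    (hreg : IsRegularRadius K X r) (j : Fin q) :
    ContinuousOn (fun z => Real.log (X j z)) (Metric.sphere 0 r) := by
  obtain ⟨ρ, hρ, hrρ⟩ := hI.up r hr
  exact ((h.continuousOn_chordal hρ j).mono (Metric.sphere_subset_ball hrρ)).log
    fun z hz => (hreg z (by simpa using hz)).2 j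

theorem chordal_pos (hI : IsRadii I) (h : IsSphereMap I b K X) (hr : r ∈ I)
    (hreg : IsRegularRadius K X r) (j : Fin q) {z : ℂ} (hz : z ∈ Metric.sphere (0 : ℂ) r) :
    0 < X j z := by
  obtain ⟨ρ, hρ, hrρ⟩ := hI.up r hr
  exact lt_of_le_of_ne (h.chordal_mem hρ (Metric.sphere_subset_ball hrρ hz) j).1
    (Ne.symm ((hreg z (by simpa using hz)).2 j))

theorem density_pos (hI : IsRadii I) (h : IsSphereMap I b K X) (hr : r ∈ I)
    (hreg : IsRegularRadius K X r) {z : ℂ} (hz : z ∈ Metric.sphere (0 : ℂ) r) : 0 < K z := by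
  obtain ⟨ρ, hρ, hrρ⟩ := hI.up r hr
  exact lt_of_le_of_ne (h.density_nonneg hρ (Metric.sphere_subset_ball hrρ hz))
    (Ne.symm (hreg z (by simpa using hz)).1)

/-- The first main theorem: `-log X = log N - 2 log |L|`, where the mean of `log N` grows by `4 *
greenAverage K` and that of `log |L|` does not decrease. -/
theorem circleAverage_neg_log_chordal_le (hI : IsRadii I) (h : IsSphereMap I b K X)
    (hK : ∃ ρ ∈ I, ∃ z ∈ Metric.ball (0 : ℂ) ρ, K z ≠ 0) (hr₁ : r₁ ∈ I) (hr : r ∈ I) (h1 : r₁ ≤ r)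
    (hreg₁ : IsRegularRadius K X r₁) (hreg : IsRegularRadius K X r) (j : Fin q) :
    Real.circleAverage (fun z => -Real.log (X j z)) 0 r ≤
      Real.circleAverage (fun z => -Real.log (X j z)) 0 r₁ + 4 * greenAverage K r₁ r := by
  obtain ⟨ρ, hρ, hrρ⟩ := hI.up r hr
  obtain ⟨f₀, f₁, hp, hKe, hX⟩ := h.exists_pair ρ hρ
  have h0 := hI.pos _ hr₁
  obtain ⟨z, hz, hz0⟩ := exists_density_ne_zero hI h hK hρ
  have hW : ∃ z ∈ Metric.ball (0 : ℂ) ρ, wronskian f₀ f₁ z ≠ 0 := by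
    refine ⟨z, hz, fun hw => hz0 ?_⟩
    rw [hKe hz, fsDensity, hw]; simp
  have key : ∀ s ∈ I, s ≤ r → IsRegularRadius K X s →
      Real.circleAverage (fun z => -Real.log (X j z)) 0 s =
        Real.circleAverage (fun z => Real.log (weightedNormSq f₀ f₁ 1 1 z)) 0 s
          - 2 * Real.circleAverage (fun z => Real.log ‖linForm (b j) f₀ f₁ z‖) 0 s := by
    intro s hs hsr hregs
    have hs0 := hI.pos s hs
    have hsub : Metric.sphere (0 : ℂ) s ⊆ Metric.ball 0 ρ :=
      Metric.sphere_subset_ball (hsr.trans_lt hrρ)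
    have hLne : ∀ z ∈ Metric.sphere (0 : ℂ) s, linForm (b j) f₀ f₁ z ≠ 0 := by
      intro z hz h0
      refine (hregs z (by simpa using hz)).2 j ?_
      rw [hX j (hsub hz), chordalSq, h0]; simp
    have hcL : ContinuousOn (fun z => Real.log ‖linForm (b j) f₀ f₁ z‖) (Metric.sphere 0 s) :=
      (((hp.analyticAt_linForm (b j)).continuousOn.mono hsub).norm).log
        fun z hz => norm_ne_zero_iff.2 (hLne z hz)
    have hcN : ContinuousOn (fun z => Real.log (weightedNormSq f₀ f₁ 1 1 z)) (Metric.sphere 0 s) :=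
      (hp.continuousOn_normSq.mono hsub).log fun z hz => (hp.normSq_pos (hsub hz)).ne'
    have e2 : 2 * Real.circleAverage (fun z => Real.log ‖linForm (b j) f₀ f₁ z‖) 0 s =
        Real.circleAverage (fun z => 2 * Real.log ‖linForm (b j) f₀ f₁ z‖) 0 s :=
      (Real.circleAverage_fun_smul (a := (2 : ℝ))).symm
    rw [e2, ← Real.circleAverage_fun_sub (f₂ := fun z => 2 * Real.log ‖linForm (b j) f₀ f₁ z‖)
      (hcN.circleIntegrable hs0.le) ((continuousOn_const.mul hcL).circleIntegrable hs0.le)]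
    refine Real.circleAverage_congr_sphere fun z hz => ?_
    rw [abs_of_pos hs0] at hz
    rw [hX j (hsub hz), chordalSq, Real.log_div (by have := hLne z hz; positivity)
      (hp.normSq_pos (hsub hz)).ne', Real.log_pow]
    push_cast
    ring
  rw [key r hr le_rfl hreg, key r₁ hr₁ h1 hreg₁, greenAverage_congr hKe h0 h1 hrρ,
    ← hp.circleAverage_log_normSq_sub h0 h1 hrρ]
  have := circleAverage_log_norm_mono (hp.analyticAt_linForm (b j))
    (hp.exists_linForm_ne_zero hW (h.unit j)) h0 h1 hrρ
  linarith

/-- The logarithm of the density of the singular metric. -/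
noncomputable def _root_.logSingularDensity (K : ℂ → ℝ) (X : Fin q → ℂ → ℝ) (z : ℂ) : ℝ :=
  Real.log (K z) - ∑ j, Real.log (X j z)

theorem continuousOn_logSingularDensity (hI : IsRadii I) (h : IsSphereMap I b K X) (hr : r ∈ I)
    (hreg : IsRegularRadius K X r) :
    ContinuousOn (logSingularDensity K X) (Metric.sphere 0 r) := by
  obtain ⟨ρ, hρ, hrρ⟩ := hI.up r hr
  refine ContinuousOn.sub (((h.continuousOn_density hρ).mono (Metric.sphere_subset_ball hrρ)).log
    fun z hz => (hreg z (by simpa using hz)).1) ?_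
  exact continuousOn_finsetSum _ fun j _ => continuousOn_log_chordal hI h hr hreg j

/-- The logarithm of the singular density is `(q - 2) log N - 2 log |∏ L_j / W|`. The Green–Jensen
formula applies to the first term and the order estimate for the quotient to the second. -/
theorem greenAverage_add_le_circleAverage (hI : IsRadii I) (h : IsSphereMap I b K X)
    (hdet : ∀ i j, i ≠ j → formDet (b i) (b j) ≠ 0)
    (hK : ∃ ρ ∈ I, ∃ z ∈ Metric.ball (0 : ℂ) ρ, K z ≠ 0) (hr₁ : r₁ ∈ I) (hr : r ∈ I) (h1 : r₁ ≤ r)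
    (hreg₁ : IsRegularRadius K X r₁) (hreg : IsRegularRadius K X r) :
    ((q : ℝ) - 2) * (4 * greenAverage K r₁ r)
        + Real.circleAverage (logSingularDensity K X) 0 r₁ ≤
      Real.circleAverage (logSingularDensity K X) 0 r
        + 2 * ∑ j, ∫ t in r₁..r, ({u : ℂ | ‖u‖ < t ∧ X j u = 0}.ncard : ℝ) / t := by
  obtain ⟨ρ, hρ, hrρ⟩ := hI.up r hr
  obtain ⟨f₀, f₁, hp, hKe, hX⟩ := h.exists_pair ρ hρ
  have h0 := hI.pos _ hr₁
  obtain ⟨z, hz, hz0⟩ := exists_density_ne_zero hI h hK hρ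
  have hWz : ∀ z ∈ Metric.ball (0 : ℂ) ρ, K z ≠ 0 → wronskian f₀ f₁ z ≠ 0 := by
    intro z hz hz0 hw
    refine hz0 ?_
    rw [hKe hz, fsDensity, hw]; simp
  have hLz : ∀ j, ∀ z ∈ Metric.ball (0 : ℂ) ρ, X j z ≠ 0 → linForm (b j) f₀ f₁ z ≠ 0 := by
    intro j z hz hz0 hw
    refine hz0 ?_
    rw [hX j hz, chordalSq, hw]; simp
  have hfin := (h.exists_finset_zeros hI hK hr).2
  have hZ := fun j => integral_ncard_div (P := fun u => X j u = 0) (Z := (hfin j).toFinset) h0 h1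
    fun u => by simp
  have hZsum : ∑ j, ∫ t in r₁..r, ({u : ℂ | ‖u‖ < t ∧ X j u = 0}.ncard : ℝ) / t =
      ∑ j, ∑ u ∈ (hfin j).toFinset, (Real.log (max r ‖u‖) - Real.log (max r₁ ‖u‖)) :=
    Finset.sum_congr rfl fun j _ => (hZ j).2
  have hquot := hp.circleAverage_log_quotient_sub_le h.unit hdet ⟨z, hz, hWz z hz hz0⟩ h0 h1 hrρ
    (fun j => (hfin j).toFinset) fun j u hu hLu => by
      simp only [Finite.mem_toFinset, mem_ofPred_eq]
      refine ⟨by simpa using hu, ?_⟩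
      rw [hX j (Metric.closedBall_subset_ball hrρ hu), chordalSq, hLu]; simp
  rw [hZsum]
  have key : ∀ s ∈ I, s ≤ r → IsRegularRadius K X s →
      Real.circleAverage (logSingularDensity K X) 0 s = ((q : ℝ) - 2) *
        Real.circleAverage (fun z => Real.log (weightedNormSq f₀ f₁ 1 1 z)) 0 s
          - 2 * Real.circleAverage (fun z => Real.log
              ‖(∏ j, linForm (b j) f₀ f₁ z) / wronskian f₀ f₁ z‖) 0 s := by
    intro s hs hsr hregs
    have hs0 := hI.pos s hs
    have hsub : Metric.sphere (0 : ℂ) s ⊆ Metric.ball 0 ρ :=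
      Metric.sphere_subset_ball (hsr.trans_lt hrρ)
    have hWne : ∀ z ∈ Metric.sphere (0 : ℂ) s, wronskian f₀ f₁ z ≠ 0 := fun z hz =>
      hWz z (hsub hz) (hregs z (by simpa using hz)).1
    have hLne : ∀ j, ∀ z ∈ Metric.sphere (0 : ℂ) s, linForm (b j) f₀ f₁ z ≠ 0 := fun j z hz =>
      hLz j z (hsub hz) ((hregs z (by simpa using hz)).2 j)
    have hPne : ∀ z ∈ Metric.sphere (0 : ℂ) s, ∏ j, linForm (b j) f₀ f₁ z ≠ 0 := fun z hz =>
      Finset.prod_ne_zero_iff.2 fun j _ => hLne j z hz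
    have hcL : ContinuousOn (fun z => Real.log
        ‖(∏ j, linForm (b j) f₀ f₁ z) / wronskian f₀ f₁ z‖) (Metric.sphere 0 s) := by
      refine (ContinuousOn.norm (ContinuousOn.div (continuousOn_finsetProd _ fun j _ =>
        (hp.analyticAt_linForm (b j)).continuousOn.mono hsub)
        (hp.analyticAt_wronskian.continuousOn.mono hsub) hWne)).log fun z hz => ?_
      exact norm_ne_zero_iff.2 (div_ne_zero (hPne z hz) (hWne z hz))
    have hcN : ContinuousOn (fun z => Real.log (weightedNormSq f₀ f₁ 1 1 z)) (Metric.sphere 0 s) :=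
      (hp.continuousOn_normSq.mono hsub).log fun z hz => (hp.normSq_pos (hsub hz)).ne'
    rw [← smul_eq_mul, ← smul_eq_mul (a := (2 : ℝ)), ← Real.circleAverage_fun_smul,
      ← Real.circleAverage_fun_smul, ← Real.circleAverage_fun_sub
      (f₁ := fun z => ((q : ℝ) - 2) • Real.log (weightedNormSq f₀ f₁ 1 1 z))
      (f₂ := fun z => (2 : ℝ) • Real.log ‖(∏ j, linForm (b j) f₀ f₁ z) / wronskian f₀ f₁ z‖)
      ((hcN.const_smul ((q : ℝ) - 2)).circleIntegrable hs0.le)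
      ((hcL.const_smul (2 : ℝ)).circleIntegrable hs0.le)]
    refine Real.circleAverage_congr_sphere fun z hz => ?_
    rw [abs_of_pos hs0] at hz
    have hN := hp.normSq_pos (hsub hz)
    have hLs : ∀ j, Real.log (X j z) =
        2 * Real.log ‖linForm (b j) f₀ f₁ z‖ - Real.log (weightedNormSq f₀ f₁ 1 1 z) := by
      intro j
      rw [hX j (hsub hz), chordalSq, Real.log_div (by have := hLne j z hz; positivity) hN.ne',
        Real.log_pow]
      push_cast; ring
    have hKs : Real.log (K z) =
        2 * Real.log ‖wronskian f₀ f₁ z‖ - 2 * Real.log (weightedNormSq f₀ f₁ 1 1 z) := by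
      rw [hKe (hsub hz), fsDensity, Real.log_div (by have := hWne z hz; positivity)
        (pow_ne_zero _ hN.ne'), Real.log_pow, Real.log_pow]
      push_cast; ring
    simp only [logSingularDensity, hLs, hKs, smul_eq_mul, norm_div, norm_prod]
    rw [Real.log_div (by rw [← norm_prod]; exact norm_ne_zero_iff.2 (hPne z hz))
      (norm_ne_zero_iff.2 (hWne z hz)),
      Real.log_prod (fun j _ => norm_ne_zero_iff.2 (hLne j z hz)), Finset.sum_sub_distrib,
      ← Finset.mul_sum]
    simp
    ring
  rw [key r hr le_rfl hreg, key r₁ hr₁ h1 hreg₁, greenAverage_congr hKe h0 h1 hrρ,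
    ← hp.circleAverage_log_normSq_sub h0 h1 hrρ]
  linarith

theorem exists_separation (h : IsSphereMap I b K X)
    (hdet : ∀ i j, i ≠ j → formDet (b i) (b j) ≠ 0) :
    ∃ c : ℝ, 0 < c ∧ c ≤ 1 ∧ ∀ ρ ∈ I, ∀ z ∈ Metric.ball (0 : ℂ) ρ, ∀ i j, i ≠ j →
      2 * c ≤ X i z + X j z := by
  have hev : ∀ᶠ c : ℝ in 𝓝[>] 0, ∀ i j, i ≠ j → 2 * c ≤ ‖formDet (b i) (b j)‖ ^ 2 / 2 := by
    refine eventually_all.2 fun i => eventually_all.2 fun j => ?_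
    by_cases hij : i = j
    · exact Eventually.of_forall fun c hne => absurd hij hne
    · have hpos : 0 < ‖formDet (b i) (b j)‖ ^ 2 / 4 := by
        have := norm_pos_iff.2 (hdet i j hij); positivity
      filter_upwards [nhdsWithin_le_nhds (Iio_mem_nhds hpos)] with c hc _
      rw [mem_Iio] at hc
      linarith
  have h01 : ∀ᶠ c : ℝ in 𝓝[>] 0, c ∈ Ioc (0 : ℝ) 1 := Ioc_mem_nhdsGT one_pos
  obtain ⟨c, hc, hc01⟩ := (hev.and h01).exists
  refine ⟨c, hc01.1, hc01.2, fun ρ hρ z hz i j hij => ?_⟩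
  obtain ⟨f₀, f₁, hp, -, hX⟩ := h.exists_pair ρ hρ
  rw [hX i hz, hX j hz]
  exact (hc i j hij).trans (le_chordalSq_add (h.unit i) (h.unit j) hp hz)

/-- The sum of the density and of the logarithmically weakened singular densities, smoothed by
`ε`. -/
noncomputable def _root_.totalDensity (K : ℂ → ℝ) (X : Fin q → ℂ → ℝ) (ε : ℝ) (z : ℂ) : ℝ :=
  K z + ∑ j, regDensity ε (K z) (X j z)

theorem continuousOn_totalDensity_zero (hI : IsRadii I) (h : IsSphereMap I b K X) (hr : r ∈ I)
    (hreg : IsRegularRadius K X r) :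
    ContinuousOn (totalDensity K X 0) (Metric.sphere 0 r) := by
  obtain ⟨ρ, hρ, hrρ⟩ := hI.up r hr
  have hs := Metric.sphere_subset_ball (x := (0 : ℂ)) hrρ
  have hKc := (h.continuousOn_density hρ).mono hs
  refine hKc.add (continuousOn_finsetSum _ fun j _ => ?_)
  have hXc := (h.continuousOn_chordal hρ j).mono hs
  have hl := continuousOn_log_chordal hI h hr hreg j
  simp only [regDensity, add_zero]
  refine hKc.mul ((hXc.mul (continuousOn_const.sub hXc)).div
    ((hXc.pow 2).mul ((continuousOn_const.sub hl).pow 2)) fun z hz => ?_)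
  have hX0 := chordal_pos hI h hr hreg j hz
  have := one_le_two_sub_log hX0 ((h.chordal_mem hρ (hs hz) j).2.trans one_le_two)
  exact mul_ne_zero (pow_ne_zero _ hX0.ne') (pow_ne_zero _ (by linarith))

theorem density_le_totalDensity (h : IsSphereMap I b K X) {ρ : ℝ} (hρ : ρ ∈ I) {z : ℂ}
    (hz : z ∈ Metric.ball (0 : ℂ) ρ) (ε : ℝ) : K z ≤ totalDensity K X ε z :=
  le_add_of_nonneg_right (Finset.sum_nonneg fun j _ => regDensity_nonneg (h.density_nonneg hρ hz)
    (h.chordal_mem hρ hz j).1 (h.chordal_mem hρ hz j).2)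

/-- By separation `K ∏ X_j⁻¹` is at most `c^(-q) K (1 + ∑ (X_j⁻¹ - 1))`. Each `K (X_j⁻¹ - 1)` is a
weakened density times `(2 - log X_j)²`; bounding all these squares by their product makes the loss
additive after taking logarithms. -/
theorem logSingularDensity_le (hI : IsRadii I) (h : IsSphereMap I b K X) {c : ℝ} (hc : 0 < c)
    (hc1 : c ≤ 1) (hsep : ∀ ρ ∈ I, ∀ z ∈ Metric.ball (0 : ℂ) ρ, ∀ i j, i ≠ j →
      2 * c ≤ X i z + X j z) (hr : r ∈ I) (hreg : IsRegularRadius K X r) {z : ℂ}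
    (hz : z ∈ Metric.sphere (0 : ℂ) r) :
    logSingularDensity K X z ≤ q * Real.log c⁻¹ + Real.log (totalDensity K X 0 z)
      + 2 * ∑ j, Real.log (2 - Real.log (X j z)) := by
  obtain ⟨ρ, hρ, hrρ⟩ := hI.up r hr
  have hzρ := Metric.sphere_subset_ball hrρ hz
  have hK0 := density_pos hI h hr hreg hz
  have hX0 := fun j => chordal_pos hI h hr hreg j hz
  have hX1 := fun j => (h.chordal_mem hρ hzρ j).2
  have hy := fun j => one_le_two_sub_log (hX0 j) ((hX1 j).trans one_le_two)
  have hv : 0 < totalDensity K X 0 z := hK0.trans_le (h.density_le_totalDensity hρ hzρ 0)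
  have hprod := prod_inv_le hc hc1 hX0 hX1 (hsep ρ hρ z hzρ)
  set Y := ∏ j, (2 - Real.log (X j z)) ^ 2 with hY
  have hY1 : 1 ≤ Y := Finset.prod_induction _ (1 ≤ ·) (fun _ _ => one_le_mul_of_one_le_of_one_le) le_rfl
    fun j _ => one_le_pow₀ (hy j)
  have hYj : ∀ j, (2 - Real.log (X j z)) ^ 2 ≤ Y := fun j => by
    rw [hY, ← Finset.mul_prod_erase _ _ (Finset.mem_univ j)]
    exact le_mul_of_one_le_right (by positivity)
      (Finset.prod_induction _ (1 ≤ ·) (fun _ _ => one_le_mul_of_one_le_of_one_le) le_rfl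
        fun i _ => one_le_pow₀ (hy i))
  have hle : K z * (1 + ∑ j, ((X j z)⁻¹ - 1)) ≤ totalDensity K X 0 z * Y := by
    rw [totalDensity, add_mul, mul_add, mul_one, Finset.mul_sum, Finset.sum_mul]
    refine add_le_add (le_mul_of_one_le_right hK0.le hY1) (Finset.sum_le_sum fun j _ => ?_)
    rcases regDensity_zero (K := K z) (hX0 j).ne' with e | e
    · rw [← e]
      exact mul_le_mul_of_nonneg_left (hYj j)
        (regDensity_nonneg hK0.le (hX0 j).le (hX1 j))
    · exact absurd e (by have := hy j; linarith)
  have hmain : K z * ∏ j, (X j z)⁻¹ ≤ (c⁻¹) ^ q * (totalDensity K X 0 z * Y) := by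
    calc K z * ∏ j, (X j z)⁻¹ ≤ K z * ((c⁻¹) ^ q * (1 + ∑ j, ((X j z)⁻¹ - 1))) := by gcongr
      _ = (c⁻¹) ^ q * (K z * (1 + ∑ j, ((X j z)⁻¹ - 1))) := by ring
      _ ≤ _ := by gcongr
  have hlog := Real.log_le_log (mul_pos hK0 (Finset.prod_pos fun j _ => inv_pos.2 (hX0 j))) hmain
  rw [Real.log_mul hK0.ne' (Finset.prod_pos fun j _ => inv_pos.2 (hX0 j)).ne',
    Real.log_prod (fun j _ => (inv_pos.2 (hX0 j)).ne'), Real.log_mul (by positivity)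
    (by positivity), Real.log_mul hv.ne' (by positivity), Real.log_pow, hY,
    Real.log_prod (fun j _ => by have := hy j; positivity)] at hlog
  simp only [Real.log_inv, Finset.sum_neg_distrib, Real.log_pow, ← Finset.mul_sum] at hlog
  rw [logSingularDensity, Real.log_inv]
  push_cast at hlog
  linarith

/-- The pointwise bound is averaged, and concavity is used twice: for the total density and for each
`2 - log X_j`, whose mean is a proximity function. -/
theorem circleAverage_logSingularDensity_le (hI : IsRadii I) (h : IsSphereMap I b K X) {c : ℝ}
    (hc : 0 < c) (hc1 : c ≤ 1) (hsep : ∀ ρ ∈ I, ∀ z ∈ Metric.ball (0 : ℂ) ρ, ∀ i j, i ≠ j →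
      2 * c ≤ X i z + X j z) (hr : r ∈ I) (hreg : IsRegularRadius K X r) :
    0 < Real.circleAverage (totalDensity K X 0) 0 r ∧
    Real.circleAverage (logSingularDensity K X) 0 r ≤ q * Real.log c⁻¹
      + Real.log (Real.circleAverage (totalDensity K X 0) 0 r)
      + 2 * ∑ j, Real.log (2 + Real.circleAverage (fun z => -Real.log (X j z)) 0 r) := by
  obtain ⟨ρ, hρ, hrρ⟩ := hI.up r hr
  have hr0 := (hI.pos r hr).le
  have hs := Metric.sphere_subset_ball (x := (0 : ℂ)) hrρ
  have hvc := continuousOn_totalDensity_zero hI h hr hreg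
  have hvpos : ∀ z ∈ Metric.sphere (0 : ℂ) r, 0 < totalDensity K X 0 z := fun z hz =>
    (density_pos hI h hr hreg hz).trans_le (h.density_le_totalDensity hρ (hs hz) 0)
  have hl := continuousOn_log_chordal hI h hr hreg
  have hy : ∀ j, ∀ z ∈ Metric.sphere (0 : ℂ) r, 1 ≤ 2 - Real.log (X j z) := fun j z hz =>
    one_le_two_sub_log (chordal_pos hI h hr hreg j hz)
      ((h.chordal_mem hρ (hs hz) j).2.trans one_le_two)
  have hyc : ∀ j, ContinuousOn (fun z => 2 - Real.log (X j z)) (Metric.sphere 0 r) := fun j =>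
    continuousOn_const.sub (hl j)
  have hlyc : ∀ j, ContinuousOn (fun z => Real.log (2 - Real.log (X j z))) (Metric.sphere 0 r) :=
    fun j => (hyc j).log fun z hz => by have := hy j z hz; linarith
  obtain ⟨hv0, hvle⟩ := circleAverage_log_le hr0 hvc hvpos
  refine ⟨hv0, ?_⟩
  have hyle : ∀ j, Real.circleAverage (fun z => Real.log (2 - Real.log (X j z))) 0 r ≤
      Real.log (2 + Real.circleAverage (fun z => -Real.log (X j z)) 0 r) := by
    intro j
    have := (circleAverage_log_le hr0 (hyc j) fun z hz => by have := hy j z hz; linarith).2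
    refine this.trans_eq ?_
    congr 1
    simp only [sub_eq_add_neg]
    rw [Real.circleAverage_fun_add (f₁ := fun _ => 2) (f₂ := fun z => -Real.log (X j z))
      (circleIntegrable_const _ _ _) ((hl j).neg.circleIntegrable hr0), Real.circleAverage_const]
  have i1 : CircleIntegrable (fun z => Real.log (totalDensity K X 0 z)) 0 r :=
    (hvc.log fun z hz => (hvpos z hz).ne').circleIntegrable hr0
  have i2 : CircleIntegrable (fun z => ∑ j, Real.log (2 - Real.log (X j z))) 0 r :=
    (continuousOn_finsetSum _ fun j _ => hlyc j).circleIntegrable hr0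
  calc Real.circleAverage (logSingularDensity K X) 0 r
      ≤ Real.circleAverage (fun z => (q * Real.log c⁻¹ + Real.log (totalDensity K X 0 z))
          + (2 : ℝ) • ∑ j, Real.log (2 - Real.log (X j z))) 0 r := by
        refine Real.circleAverage_mono
          ((continuousOn_logSingularDensity hI h hr hreg).circleIntegrable hr0)
          (((circleIntegrable_const _ _ _).add i1).add (i2.const_smul)) fun z hz => ?_
        rw [abs_of_nonneg hr0] at hz
        exact logSingularDensity_le hI h hc hc1 hsep hr hreg hz
    _ = q * Real.log c⁻¹ + Real.circleAverage (fun z => Real.log (totalDensity K X 0 z)) 0 r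
          + 2 * ∑ j, Real.circleAverage (fun z => Real.log (2 - Real.log (X j z))) 0 r := by
        rw [Real.circleAverage_fun_add
            (f₁ := fun z => q * Real.log c⁻¹ + Real.log (totalDensity K X 0 z))
            (f₂ := fun z => (2 : ℝ) • ∑ j, Real.log (2 - Real.log (X j z)))
            ((circleIntegrable_const _ _ _).add i1) i2.const_smul,
          Real.circleAverage_fun_add (f₁ := fun _ => q * Real.log c⁻¹)
            (circleIntegrable_const _ _ _) i1, Real.circleAverage_const,
          Real.circleAverage_fun_smul, Real.circleAverage_fun_sum fun j _ =>
            (hlyc j).circleIntegrable hr0, smul_eq_mul]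
    _ ≤ _ := by
        have := Finset.sum_le_sum fun j (_ : j ∈ Finset.univ) => hyle j
        linarith

end IsSphereMap

/-! ### Removal of the smoothing, and the main estimate on a disc -/

theorem IsRadii.measurableSet {I : Set ℝ} (hI : IsRadii I) : MeasurableSet I := by
  have : I.OrdConnected := ⟨fun x hx y hy t ht => hI.down y hy t ((hI.pos x hx).trans_le ht.1) ht.2⟩
  exact this.measurableSet

theorem ofReal_intervalIntegral_eq_lintegral {φ : ℝ → ℝ} {a r : ℝ} (h : a ≤ r)
    (hi : IntervalIntegrable φ volume a r) (h0 : ∀ t ∈ Ioo a r, 0 ≤ φ t) :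
    ENNReal.ofReal (∫ t in a..r, φ t) = ∫⁻ t in Ioo a r, ENNReal.ofReal (φ t) := by
  rw [intervalIntegral.integral_of_le h, integral_Ioc_eq_integral_Ioo,
    ofReal_integral_eq_lintegral_ofReal]
  · exact ((intervalIntegrable_iff_integrableOn_Ioo_of_le h).1 hi)
  · exact (ae_restrict_iff' measurableSet_Ioo).2 (Eventually.of_forall h0)

theorem lintegral_eq_ofReal_greenAverage {g : ℂ → ℝ} {ρ a r : ℝ}
    (hg : ContinuousOn g (Metric.ball 0 ρ)) (hg0 : ∀ z ∈ Metric.ball (0 : ℂ) ρ, 0 ≤ g z)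
    (h0 : 0 < a) (h1 : a ≤ r) (h2 : r < ρ) :
    ∫⁻ t in Ioo a r, (∫⁻ τ in Ioo 0 t, ENNReal.ofReal (τ * Real.circleAverage g 0 τ))
      / ENNReal.ofReal t = ENNReal.ofReal (greenAverage g a r) := by
  have hm : ∀ τ, 0 < τ → τ < ρ → 0 ≤ τ * Real.circleAverage g 0 τ := fun τ hτ hτρ =>
    mul_nonneg hτ.le (Real.circleAverage_nonneg_of_nonneg fun z hz => hg0 z (by
      rw [abs_of_pos hτ] at hz
      exact Metric.sphere_subset_ball hτρ hz))
  rw [greenAverage, ofReal_intervalIntegral_eq_lintegral h1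
    (intervalIntegrable_integral_circleAverage_div hg h0 h1 h2)]
  · refine setLIntegral_congr_fun measurableSet_Ioo fun t ht => ?_
    have ht0 : 0 < t := h0.trans ht.1
    rw [ENNReal.ofReal_div_of_pos ht0, ofReal_intervalIntegral_eq_lintegral ht0.le
      (intervalIntegrable_mul_circleAverage hg ht0.le (ht.2.trans h2))]
    exact fun τ hτ => hm τ hτ.1 (hτ.2.trans (ht.2.trans h2))
  · intro t ht
    have ht0 : 0 < t := h0.trans ht.1
    refine div_nonneg (intervalIntegral.integral_nonneg ht0.le fun τ hτ => ?_) ht0.le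
    rcases hτ.1.eq_or_lt with rfl | h
    · simp
    · exact hm τ h (hτ.2.trans_lt (ht.2.trans h2))

theorem greenAverage_sum {ι : Type*} (s : Finset ι) {g : ι → ℂ → ℝ} {ρ r₁ r : ℝ}
    (hg : ∀ i ∈ s, ContinuousOn (g i) (Metric.ball 0 ρ)) (h0 : 0 < r₁) (h1 : r₁ ≤ r) (h2 : r < ρ) :
    greenAverage (fun z => ∑ i ∈ s, g i z) r₁ r = ∑ i ∈ s, greenAverage (g i) r₁ r := by
  classical
  induction s using Finset.induction_on with
  | empty => simpa using greenAverage_const_mul 0 (fun _ => 0) r₁ r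
  | insert i s hi ih =>
    simp only [Finset.sum_insert hi]
    rw [greenAverage_add (hg i (Finset.mem_insert_self _ _)) (continuousOn_finsetSum s fun j hj =>
      hg j (Finset.mem_insert_of_mem hj)) h0 h1 h2,
      ih fun j hj => hg j (Finset.mem_insert_of_mem hj)]

/-- The smoothing parameter `1 / (n + 1)`. -/
noncomputable def smoothing (n : ℕ) : ℝ := 1 / ((n : ℝ) + 1)

theorem smoothing_pos (n : ℕ) : 0 < smoothing n := Nat.one_div_pos_of_nat

theorem smoothing_antitone : Antitone smoothing := fun _ _ h => Nat.one_div_le_one_div h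

theorem smoothing_le_one (n : ℕ) : smoothing n ≤ 1 := by
  have := smoothing_antitone (Nat.zero_le n)
  simpa [smoothing] using this

theorem tendsto_smoothing : Tendsto smoothing atTop (𝓝 0) := tendsto_one_div_add_atTop_nhds_zero_nat

namespace IsSphereMap

variable {I : Set ℝ} {q : ℕ} {b : Fin q → ℂ × ℂ} {K : ℂ → ℝ} {X : Fin q → ℂ → ℝ} {r₁ r : ℝ}

theorem continuousOn_regDensity (h : IsSphereMap I b K X) {ρ : ℝ} (hρ : ρ ∈ I) (n : ℕ)
    (j : Fin q) :
    ContinuousOn (fun z => regDensity (smoothing n) (K z) (X j z)) (Metric.ball 0 ρ) := by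
  obtain ⟨f₀, f₁, hp, hK, hX⟩ := h.exists_pair ρ hρ
  refine (hp.continuousOn_regDensity (h.unit j) (smoothing_pos n) (smoothing_le_one n)).congr
    fun z hz => ?_
  simp only [hK hz, hX j hz]

theorem continuousOn_totalDensity (h : IsSphereMap I b K X) {ρ : ℝ} (hρ : ρ ∈ I) (n : ℕ) :
    ContinuousOn (totalDensity K X (smoothing n)) (Metric.ball 0 ρ) :=
  (h.continuousOn_density hρ).add
    (continuousOn_finsetSum _ fun j _ => h.continuousOn_regDensity hρ n j)

theorem totalDensity_antitone (h : IsSphereMap I b K X) {ρ : ℝ} (hρ : ρ ∈ I) {z : ℂ}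
    (hz : z ∈ Metric.ball (0 : ℂ) ρ) {ε ε' : ℝ} (hε : ε ≤ ε') (hε' : ε' ≤ 1)
    (h0 : ∀ j, 0 < X j z + ε) : totalDensity K X ε' z ≤ totalDensity K X ε z :=
  add_le_add le_rfl (Finset.sum_le_sum fun j _ => regDensity_antitone (h.density_nonneg hρ hz)
    (h.chordal_mem hρ hz j).1 (h.chordal_mem hρ hz j).2 hε hε' (h0 j))

/-- The radial density `τ ↦ τ M_τ`, where `M_τ` is the circular mean of the total density. -/
noncomputable def _root_.radialDensity (I : Set ℝ) (K : ℂ → ℝ) (X : Fin q → ℂ → ℝ) (n : ℕ) :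
    ℝ → ENNReal :=
  I.indicator fun τ =>
    ENNReal.ofReal (τ * Real.circleAverage (totalDensity K X (smoothing n)) 0 τ)

theorem measurable_radialDensity (hI : IsRadii I) (h : IsSphereMap I b K X) (n : ℕ) :
    Measurable (radialDensity I K X n) := by
  classical
  have hc : ContinuousOn (fun τ => ENNReal.ofReal
      (τ * Real.circleAverage (totalDensity K X (smoothing n)) 0 τ)) I := by
    intro τ hτ
    obtain ⟨ρ, hρ, hτρ⟩ := hI.up τ hτ
    have hmem : Ioo 0 ρ ∈ 𝓝 τ := Ioo_mem_nhds (hI.pos τ hτ) hτρ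
    have := ((continuousOn_id (s := Ioo 0 ρ)).mul ((continuousOn_circleAverage_Ico
      (h.continuousOn_totalDensity hρ n)).mono Ioo_subset_Ico_self)).continuousAt hmem
    exact (ENNReal.continuous_ofReal.continuousAt.comp this).continuousWithinAt
  exact (hc.measurable_piecewise continuousOn_const hI.measurableSet)

theorem monotone_radialDensity (hI : IsRadii I) (h : IsSphereMap I b K X) :
    Monotone (radialDensity I K X) := by
  intro m n hmn τ
  by_cases hτ : τ ∈ I
  · obtain ⟨ρ, hρ, hτρ⟩ := hI.up τ hτ
    have hτ0 := hI.pos τ hτ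
    simp only [radialDensity, indicator_of_mem hτ]
    refine ENNReal.ofReal_le_ofReal (mul_le_mul_of_nonneg_left ?_ hτ0.le)
    refine Real.circleAverage_mono
      (circleIntegrable_of_continuousOn_ball (h.continuousOn_totalDensity hρ m) hτ0.le hτρ)
      (circleIntegrable_of_continuousOn_ball (h.continuousOn_totalDensity hρ n) hτ0.le hτρ)
      fun z hz => ?_
    rw [abs_of_pos hτ0] at hz
    have hzρ := Metric.sphere_subset_ball hτρ hz
    exact h.totalDensity_antitone hρ hzρ (smoothing_antitone hmn) (smoothing_le_one m) fun j =>
      add_pos_of_nonneg_of_pos (h.chordal_mem hρ hzρ j).1 (smoothing_pos n)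
  · simp [radialDensity, hτ]

/-- The point is uniformity in `n`. The curvature estimate charges one copy of `greenAverage K` for
each value, and `K` itself adds one more. Regularity of `r₁` lets the boundary term be bounded by
its value without smoothing. -/
theorem greenAverage_totalDensity_le (hI : IsRadii I) (h : IsSphereMap I b K X)
    (hr₁ : r₁ ∈ I) (hr : r ∈ I) (h1 : r₁ ≤ r) (hreg₁ : IsRegularRadius K X r₁) (n : ℕ) :
    greenAverage (totalDensity K X (smoothing n)) r₁ r ≤ ((q : ℝ) + 1) * greenAverage K r₁ r
      + ∑ j, Real.circleAverage (fun z => Real.log (2 - Real.log (X j z))) 0 r₁ / 4 := by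
  obtain ⟨ρ, hρ, hrρ⟩ := hI.up r hr
  obtain ⟨f₀, f₁, hp, hK, hX⟩ := h.exists_pair ρ hρ
  have h0 := hI.pos _ hr₁
  have hsub := Metric.sphere_subset_ball (x := (0 : ℂ)) (h1.trans_lt hrρ)
  have hterm : ∀ j, greenAverage (fun z => regDensity (smoothing n) (K z) (X j z)) r₁ r ≤
      greenAverage K r₁ r
        + Real.circleAverage (fun z => Real.log (2 - Real.log (X j z))) 0 r₁ / 4 := by
    intro j
    have hle := hp.four_mul_greenAverage_regDensity_le (h.unit j) (smoothing_pos n)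
      (smoothing_le_one n) h0 h1 hrρ
    rw [← greenAverage_congr hK h0 h1 hrρ, ← greenAverage_congr (g := fun z =>
      regDensity (smoothing n) (K z) (X j z)) (fun z hz => by simp only [hK hz, hX j hz])
      h0 h1 hrρ] at hle
    have hl := continuousOn_log_chordal hI h hr₁ hreg₁ j
    have hXc := (h.continuousOn_chordal hρ j).mono hsub
    have hpos : ∀ z ∈ Metric.sphere (0 : ℂ) r₁, 0 < X j z := fun z hz =>
      chordal_pos hI h hr₁ hreg₁ j hz
    have hlt : ∀ z ∈ Metric.sphere (0 : ℂ) r₁, X j z ≤ 1 := fun z hz =>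
      (h.chordal_mem hρ (hsub hz) j).2
    have hn := smoothing_pos n
    have hn1 := smoothing_le_one n
    have hmono : Real.circleAverage
        (fun z => Real.log (2 - Real.log (chordalSq (b j) f₀ f₁ z + smoothing n))) 0 r₁ ≤
        Real.circleAverage (fun z => Real.log (2 - Real.log (X j z))) 0 r₁ := by
      rw [Real.circleAverage_congr_sphere (f₂ := fun z => Real.log (2 - Real.log
        (X j z + smoothing n))) fun z hz => by
          rw [abs_of_pos h0] at hz
          simp only [hX j (hsub hz)]]
      refine Real.circleAverage_mono (ContinuousOn.circleIntegrable h0.le ?_)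
        (ContinuousOn.circleIntegrable h0.le ?_) fun z hz => ?_
      · refine (continuousOn_const.sub ((hXc.add continuousOn_const).log fun z hz => ?_)).log
          fun z hz => ?_
        · exact (add_pos (hpos z hz) hn).ne'
        · have := one_le_two_sub_log (x := X j z + smoothing n) (by have := hpos z hz; positivity)
            (by have := hlt z hz; linarith)
          exact (one_pos.trans_le this).ne'
      · refine (continuousOn_const.sub hl).log fun z hz => ?_
        have := one_le_two_sub_log (hpos z hz) (by have := hlt z hz; linarith)
        exact (one_pos.trans_le this).ne'
      · rw [abs_of_pos h0] at hz
        have h3 := one_le_two_sub_log (x := X j z + smoothing n) (by have := hpos z hz; positivity)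
            (by have := hlt z hz; linarith)
        have h4 := Real.log_le_log (hpos z hz) (by linarith : X j z ≤ X j z + smoothing n)
        exact Real.log_le_log (by linarith) (by linarith)
    linarith
  have hsum := greenAverage_add (h.continuousOn_density hρ) (continuousOn_finsetSum Finset.univ
    fun j _ => h.continuousOn_regDensity hρ n j) h0 h1 hrρ
  rw [greenAverage_sum _ (fun j _ => h.continuousOn_regDensity hρ n j) h0 h1 hrρ] at hsum
  have e : greenAverage (totalDensity K X (smoothing n)) r₁ r = greenAverage K r₁ r
    + ∑ j, greenAverage (fun z => regDensity (smoothing n) (K z) (X j z)) r₁ r := hsum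
  rw [e]
  have := Finset.sum_le_sum fun j (_ : j ∈ Finset.univ) => hterm j
  rw [Finset.sum_add_distrib, Finset.sum_const, Finset.card_univ, Fintype.card_fin,
    nsmul_eq_mul] at this
  linarith

/-- Monotone convergence, applied to the inner and to the outer integral. Working in `ENNReal` makes
it unnecessary to know beforehand that the singular limit density is integrable. -/
theorem lintegral_iSup_radialDensity_le (hI : IsRadii I) (h : IsSphereMap I b K X)
    (hr₁ : r₁ ∈ I) (hr : r ∈ I) (h1 : r₁ ≤ r) (hreg₁ : IsRegularRadius K X r₁) :
    ∫⁻ t in Ioo r₁ r, (∫⁻ τ in Ioo 0 t, ⨆ n, radialDensity I K X n τ) / ENNReal.ofReal t ≤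
      ENNReal.ofReal (((q : ℝ) + 1) * greenAverage K r₁ r
      + ∑ j, Real.circleAverage (fun z => Real.log (2 - Real.log (X j z))) 0 r₁ / 4) := by
  obtain ⟨ρ, hρ, hrρ⟩ := hI.up r hr
  have h0 := hI.pos _ hr₁
  have hm := fun n => measurable_radialDensity hI h n
  have hmono := monotone_radialDensity hI h
  have hinner : ∀ t, ∫⁻ τ in Ioo 0 t, ⨆ n, radialDensity I K X n τ =
      ⨆ n, ∫⁻ τ in Ioo 0 t, radialDensity I K X n τ := fun t => lintegral_iSup hm hmono
  have hmonoint : ∀ n, Monotone fun t : ℝ => ∫⁻ τ in Ioo 0 t, radialDensity I K X n τ :=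
    fun n s t hst => lintegral_mono_set (Ioo_subset_Ioo_right hst)
  simp only [hinner, ENNReal.iSup_div]
  rw [lintegral_iSup (f := fun n t => (∫⁻ τ in Ioo 0 t, radialDensity I K X n τ)
    / ENNReal.ofReal t) (fun n => (hmonoint n).measurable.div ENNReal.measurable_ofReal)
    (fun m n hmn t => by
      simp only
      gcongr
      exact hmono hmn _)]
  refine iSup_le fun n => ?_
  refine le_trans (le_of_eq ?_) (ENNReal.ofReal_le_ofReal
    (greenAverage_totalDensity_le hI h hr₁ hr h1 hreg₁ n))
  rw [← lintegral_eq_ofReal_greenAverage (h.continuousOn_totalDensity hρ n)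
    (fun z hz => (h.density_nonneg hρ hz).trans (h.density_le_totalDensity hρ hz _)) h0 h1 hrρ]
  refine setLIntegral_congr_fun measurableSet_Ioo fun t ht => ?_
  congr 1
  refine setLIntegral_congr_fun measurableSet_Ioo fun τ hτ => ?_
  simp only [radialDensity]
  rw [indicator_of_mem]
  exact hI.down r hr τ hτ.1 (hτ.2.trans ht.2).le

/-- On a regular circle the unsmoothed density is continuous and dominates all the smoothed ones, so
dominated convergence identifies the limit of the means. -/
theorem ofReal_le_iSup_radialDensity (hI : IsRadii I) (h : IsSphereMap I b K X)
    (hr : r ∈ I) (hreg : IsRegularRadius K X r) :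
    ENNReal.ofReal (r * Real.circleAverage (totalDensity K X 0) 0 r) ≤
      ⨆ n, radialDensity I K X n r := by
  obtain ⟨ρ, hρ, hrρ⟩ := hI.up r hr
  have hr0 := hI.pos r hr
  have hsub := Metric.sphere_subset_ball (x := (0 : ℂ)) hrρ
  have hmem : ∀ θ : ℝ, circleMap 0 r θ ∈ Metric.sphere (0 : ℂ) r := fun θ =>
    circleMap_mem_sphere 0 hr0.le θ
  have hlim : Tendsto (fun n => Real.circleAverage (totalDensity K X (smoothing n)) 0 r) atTop
      (𝓝 (Real.circleAverage (totalDensity K X 0) 0 r)) := by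
    simp only [Real.circleAverage_def]
    refine Tendsto.const_smul ?_ _
    refine intervalIntegral.tendsto_integral_filter_of_dominated_convergence
      (fun θ => totalDensity K X 0 (circleMap 0 r θ)) ?_ ?_ ?_ ?_
    · refine Eventually.of_forall fun n => ?_
      exact (((h.continuousOn_totalDensity hρ n).mono hsub).comp_continuous
        (continuous_circleMap 0 r) hmem).aestronglyMeasurable
    · refine Eventually.of_forall fun n => Eventually.of_forall fun θ _ => ?_
      have hz := hsub (hmem θ)
      rw [Real.norm_of_nonneg ((h.density_nonneg hρ hz).trans (h.density_le_totalDensity hρ hz _))]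
      exact h.totalDensity_antitone hρ hz (smoothing_pos n).le (smoothing_le_one n) fun j => by
        simpa using chordal_pos hI h hr hreg j (hmem θ)
    · exact (continuousOn_totalDensity_zero hI h hr hreg).circleIntegrable hr0.le
    · refine Eventually.of_forall fun θ _ => ?_
      refine Tendsto.add tendsto_const_nhds (tendsto_finsetSum _ fun j _ => ?_)
      have hX0 := chordal_pos hI h hr hreg j (hmem θ)
      have hX1 := (h.chordal_mem hρ (hsub (hmem θ)) j).2
      have hy := one_le_two_sub_log hX0 (hX1.trans one_le_two)
      have hc : ContinuousAt (fun ε => regDensity ε (K (circleMap 0 r θ)) (X j (circleMap 0 r θ)))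
          0 := by
        simp only [regDensity]
        have h1 : X j (circleMap 0 r θ) + 0 ≠ 0 := by simpa using hX0.ne'
        have h2 : ContinuousAt (fun ε : ℝ => Real.log (X j (circleMap 0 r θ) + ε)) 0 :=
          ContinuousAt.log (by fun_prop) h1
        refine continuousAt_const.mul (continuousAt_const.div (ContinuousAt.mul (by fun_prop)
          ((continuousAt_const.sub h2).pow 2)) ?_)
        refine mul_ne_zero (pow_ne_zero _ h1) (pow_ne_zero _ ?_)
        rw [add_zero]; linarith
      exact hc.tendsto.comp tendsto_smoothing
  refine le_of_tendsto' (ENNReal.tendsto_ofReal (hlim.const_mul r)) fun n => ?_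
  refine le_trans (le_of_eq ?_) (le_iSup _ n)
  simp [radialDensity, hr]

/-- The circle mean of the logarithm of the singular density is bounded below by Jensen's formula
and above by concavity and the growth lemma. In the upper bound the growth lemma gives `4 log (1 +
G)` and the `q` proximity functions give `2 q log (1 + G)`; after division by 2 this is the
coefficient `q + 2`. -/
theorem exists_main_estimate (hI : IsRadii I) (h : IsSphereMap I b K X)
    (hdet : ∀ i j, i ≠ j → formDet (b i) (b j) ≠ 0)
    (hK : ∃ ρ ∈ I, ∃ z ∈ Metric.ball (0 : ℂ) ρ, K z ≠ 0) (hr₁ : r₁ ∈ I)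
    (hreg₁ : IsRegularRadius K X r₁) :
    ∃ C : ℝ, ∀ γ : ℝ → ℝ, Measurable γ → ∀ δ : ℝ, 0 < δ → δ ≤ 1 →
      ∃ E ⊆ I, MeasurableSet E ∧ ∫⁻ r in E, ENNReal.ofReal (γ r) < ⊤ ∧
        ∀ r ∈ I, r₁ < r → r ∉ E →
          ((q : ℝ) - 2) * (2 * greenAverage K r₁ r) ≤
            ∑ j, (∫ t in r₁..r, ({u : ℂ | ‖u‖ < t ∧ X j u = 0}.ncard : ℝ) / t)
              + (3 * Real.posLog (γ r) + (1 + δ) * Real.log (1 + r) - Real.log r) / 2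
              + (q + 2) * Real.log (1 + greenAverage K r₁ r) + C := by
  obtain ⟨c, hc, hc1, hsep⟩ := h.exists_separation hdet
  have h0 := hI.pos _ hr₁
  set M : Fin q → ℝ := fun j => Real.circleAverage (fun z => -Real.log (X j z)) 0 r₁ with hM
  set B : ℝ := ∑ j, Real.circleAverage (fun z => Real.log (2 - Real.log (X j z))) 0 r₁ / 4 with hB
  obtain ⟨ρ₁, hρ₁, hrρ₁⟩ := hI.up r₁ hr₁
  have hM0 : ∀ j, 0 ≤ M j := fun j => Real.circleAverage_nonneg_of_nonneg fun z hz => by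
    rw [abs_of_pos h0] at hz
    have := h.chordal_mem hρ₁ (Metric.sphere_subset_ball hrρ₁ hz) j
    simpa using Real.log_nonpos this.1 this.2
  have hB0 : 0 ≤ B := Finset.sum_nonneg fun j _ => by
    refine div_nonneg (Real.circleAverage_nonneg_of_nonneg fun z hz => ?_) (by norm_num)
    rw [abs_of_pos h0] at hz
    have := h.chordal_mem hρ₁ (Metric.sphere_subset_ball hrρ₁ hz) j
    exact Real.log_nonneg (one_le_two_sub_log (chordal_pos hI h hr₁ hreg₁ j hz) (by linarith [this.2]))
  -- These are half the constants from separation, the growth lemma, the proximity functions and the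
  -- mean at `r₁`; none of them involves `γ` or `δ`.
  refine ⟨(q * Real.log c⁻¹ + 4 * Real.log (q + 1 + B) + 2 * ∑ j, Real.log (4 + M j)
    - Real.circleAverage (logSingularDensity K X) 0 r₁) / 2, fun γ hγ δ hδ hδ1 => ?_⟩
  set J : Set ℝ := I ∩ Ioi r₁ with hJ
  obtain ⟨E, hEJ, hEm, hEγ, hE⟩ := exists_iterated_borel_exceptional_set (J := J) (a := r₁)
    (g := fun τ => ⨆ n, radialDensity I K X n τ)
    -- The weight is raised to at least 1 so that its logarithm becomes `log⁺ γ`. Finite mass for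
    -- the larger weight implies finite mass for `γ`.
    (γ := fun r => ENNReal.ofReal (max (γ r) 1)) (δ := δ)
    (hI.measurableSet.inter measurableSet_Ioi) h0 (fun r hr => hr.2)
    (fun r hr t ht htr => ⟨hI.down r hr.1 t (h0.trans ht) htr, ht⟩)
    (fun r hr => by
      obtain ⟨r', hr', hlt⟩ := hI.up r hr.1
      exact ⟨r', ⟨hr', (mem_Ioi.1 hr.2).trans hlt⟩, hlt⟩)
    (Measurable.iSup fun n => measurable_radialDensity hI h n)
    (fun r hr => (lintegral_iSup_radialDensity_le hI h hr₁ hr.1 (mem_Ioi.1 hr.2).le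
      hreg₁).trans_lt ENNReal.ofReal_lt_top)
    (ENNReal.measurable_ofReal.comp (hγ.max measurable_const)) hδ
  have hcount := countable_not_isRegularRadius hI h hK
  refine ⟨E ∪ {r ∈ I | ¬ IsRegularRadius K X r}, union_subset (fun r hr => (hEJ hr).1)
    fun r hr => hr.1, hEm.union hcount.measurableSet, ?_, fun r hr hr1 hrE => ?_⟩
  · refine (lintegral_union_le _ _ _).trans_lt ?_
    rw [setLIntegral_measure_zero _ _ (hcount.measure_zero volume), add_zero]
    exact (lintegral_mono fun r => ENNReal.ofReal_le_ofReal (le_max_left _ _)).trans_lt hEγ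
  · simp only [mem_union, not_or] at hrE
    have hreg : IsRegularRadius K X r := by
      by_contra hcon
      exact hrE.2 ⟨hr, hcon⟩
    obtain ⟨hΓ, hg1, hg2⟩ := hE r ⟨hr, hr1⟩ hrE.1
    have hr0 := hI.pos r hr
    obtain ⟨ρ, hρ, hrρ⟩ := hI.up r hr
    set G := greenAverage K r₁ r with hG
    have hG0 : 0 ≤ G := greenAverage_nonneg (fun z hz => h.density_nonneg hρ hz) h0 hr1.le hrρ
    obtain ⟨hv0, hS⟩ := circleAverage_logSingularDensity_le hI h hc hc1 hsep hr hreg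
    set V := Real.circleAverage (totalDensity K X 0) 0 r with hV
    have hF := lintegral_iSup_radialDensity_le hI h hr₁ hr hr1.le hreg₁
    have hlogV := log_le_of_iterated_borel (G := r * V) (F := ((q : ℝ) + 1) * G + B)
      (c := max (γ r) 1) hδ hδ1 hr0 (le_max_right _ _)
      (mul_pos hr0 hv0) ENNReal.toReal_nonneg (by positivity)
      (by
        rw [ENNReal.ofReal_toReal hΓ.ne]
        exact (ofReal_le_iSup_radialDensity hI h hr hreg).trans hg1)
      (by
        rw [ENNReal.ofReal_toReal hΓ.ne]
        refine hg2.trans ?_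
        gcongr)
    rw [Real.log_mul hr0.ne' hv0.ne'] at hlogV
    have hγ' : Real.log (max (γ r) 1) ≤ Real.posLog (γ r) := by
      rcases le_total (γ r) 1 with hle | hle
      · rw [max_eq_right hle, Real.log_one]; exact Real.posLog_nonneg
      · rw [max_eq_left hle]; exact le_max_right _ _
    have hlogF : Real.log (1 + (((q : ℝ) + 1) * G + B)) ≤
        Real.log (q + 1 + B) + Real.log (1 + G) := by
      rw [← Real.log_mul (by positivity) (by positivity)]
      refine Real.log_le_log (by positivity) ?_
      nlinarith [mul_nonneg hB0 hG0, mul_nonneg (Nat.cast_nonneg q : (0 : ℝ) ≤ q) hG0,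
        (Nat.cast_nonneg q : (0 : ℝ) ≤ q)]
    have hlogM : ∀ j, Real.log (2 + Real.circleAverage (fun z => -Real.log (X j z)) 0 r) ≤
        Real.log (4 + M j) + Real.log (1 + G) := by
      intro j
      have hle := circleAverage_neg_log_chordal_le hI h hK hr₁ hr hr1.le hreg₁ hreg j
      have hMj := hM0 j
      rw [← Real.log_mul (by positivity) (by positivity)]
      refine Real.log_le_log ?_ ?_
      · have : 0 ≤ Real.circleAverage (fun z => -Real.log (X j z)) 0 r :=
          Real.circleAverage_nonneg_of_nonneg fun z hz => by
            rw [abs_of_pos hr0] at hz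
            have := h.chordal_mem hρ (Metric.sphere_subset_ball hrρ hz) j
            simpa using Real.log_nonpos this.1 this.2
        positivity
      · change _ ≤ M j + 4 * G at hle
        nlinarith [mul_nonneg hMj hG0]
    have hsumM := Finset.sum_le_sum fun j (_ : j ∈ Finset.univ) => hlogM j
    rw [Finset.sum_add_distrib, Finset.sum_const, Finset.card_univ, Fintype.card_fin,
      nsmul_eq_mul] at hsumM
    have hmain := greenAverage_add_le_circleAverage hI h hdet hK hr₁ hr hr1.le hreg₁ hreg
    rw [← hG] at hmain
    linarith

end IsSphereMap

/-! ### The coordinate `x̂`: a biholomorphic map onto the disc of radius `R` -/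

section Transition

variable {S : Type*} [TopologicalSpace S] [ChartedSpace ℂ S] [IsManifold 𝓘(ℂ, ℂ) ω S]
  {e e' : OpenPartialHomeomorph S ℂ}

theorem contDiffOn_transition (he : e ∈ atlas ℂ S) (he' : e' ∈ atlas ℂ S) :
    ContDiffOn ℂ ω (fun z => e' (e.symm z)) (e.target ∩ e.symm ⁻¹' e'.source) := by
  have := ModelWithCorners.contDiffOn_extendCoordChange (I := 𝓘(ℂ, ℂ)) (n := ω)
    (IsManifold.subset_maximalAtlas he) (IsManifold.subset_maximalAtlas he')
  simpa [ModelWithCorners.extendCoordChange, OpenPartialHomeomorph.extend, Function.comp_def,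
    inter_comm] using this

theorem differentiableAt_transition (he : e ∈ atlas ℂ S) (he' : e' ∈ atlas ℂ S) {z : ℂ}
    (hz : z ∈ e.target) (hz' : e.symm z ∈ e'.source) :
    DifferentiableAt ℂ (fun z => e' (e.symm z)) z :=
  ((contDiffOn_transition he he').contDiffAt ((e.isOpen_inter_preimage_symm e'.open_source).mem_nhds
    ⟨hz, hz'⟩)).differentiableAt (by simp)

theorem isManifold_real : IsManifold 𝓘(ℝ, ℂ) ω S := by
  refine isManifold_of_contDiffOn _ _ _ fun e e' he he' => ?_
  have := (contDiffOn_transition he he').restrict_scalars ℝ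
  simpa [Function.comp_def, inter_comm] using this

end Transition

namespace HolomorphicForm

variable {S : Type*} [TopologicalSpace S] [ChartedSpace ℂ S]
  {Φ : HolomorphicForm S} {o : S} {L : S → ℂ} {e : OpenPartialHomeomorph S ℂ}

theorem IsSurfaceForm.isIntegralFrom_hat (h : Φ.IsSurfaceForm o) :
    Φ.IsIntegralFrom o (Φ.hat o) := by
  unfold HolomorphicForm.hat
  rw [dif_pos h.pathIndependent]
  exact h.pathIndependent.choose_spec

theorem IsSurfaceForm.coeff_ne_zero (h : Φ.IsSurfaceForm o) (he : e ∈ atlas ℂ S) {z : ℂ} (hz : z ∈ e.target) :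
    Φ.coeff e z ≠ 0 := by
  have hs := mem_chart_source ℂ (e.symm z)
  have h1 := Φ.compat _ (chart_mem_atlas ℂ (e.symm z)) e he (e.symm z) ⟨hs, e.map_target hz⟩
  rw [e.right_inv hz] at h1
  intro h0
  rw [h0, zero_mul] at h1
  exact h.ne_zero _ h1

theorem isRadii_radii : IsRadii (Φ.radii o) where
  pos _ hr := hr.1
  down r hr t ht htr := ⟨ht, (ENNReal.ofReal_le_ofReal htr).trans_lt hr.2⟩
  up r hr := by
    obtain ⟨x, hx1, hx2⟩ := ENNReal.lt_iff_exists_nnreal_btwn.1 hr.2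
    have hlt : r < x := (ENNReal.ofReal_lt_coe_iff hr.1.le).1 hx1
    exact ⟨x, ⟨hr.1.trans hlt, by simpa using hx2⟩, hlt⟩

/-- As `r < R`, some circle of radius `r' > r` contains a point. The exhaustion is applied to the
radii `r + n (r' - r)`; the case in which already the first disc is all of `S` is excluded by that
point. -/
theorem IsExhausted.isCompact_closure_disc (h : Φ.IsExhausted o) {r : ℝ} (hr : r ∈ Φ.radii o) :
    IsCompact (closure (Φ.disc o r)) := by
  have hR := hr.2
  simp only [radius, lt_iSup_iff] at hR
  obtain ⟨r', ⟨hr'0, x, hx⟩, hlt⟩ := hR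
  have hrr' : r < r' := (ENNReal.ofReal_lt_ofReal_iff hr'0).1 hlt
  have hd : 0 < r' - r := sub_pos.2 hrr'
  have hx' : ‖Φ.hat o x‖ = r' := hx
  have hmono : StrictMono fun n : ℕ => r + n * (r' - r) := fun m n hmn => by
    have : (m : ℝ) < n := by exact_mod_cast hmn
    simp only
    gcongr
  have ht : Tendsto (fun n : ℕ => r + n * (r' - r)) atTop atTop :=
    tendsto_atTop_add_const_left _ _ (tendsto_natCast_atTop_atTop.atTop_mul_const hd)
  obtain ⟨-, hall | ⟨k, hk, hk'⟩⟩ := h.exhaustion _ (by simpa using hr.1) hmono ht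
  · simpa using (hall 0).1
  · rcases Nat.eq_zero_or_pos k with rfl | hk0
    · have := hk' 0 le_rfl
      simp only [Nat.cast_zero, zero_mul, add_zero] at this
      have hxr : x ∈ Φ.disc o r := by rw [this]; trivial
      exact absurd (show ‖Φ.hat o x‖ < r from hxr) (by rw [hx']; exact hrr'.not_gt)
    · simpa using (hk 0 hk0).1

variable [IsManifold 𝓘(ℂ, ℂ) ω S]

/-- On a small disc in the chart the coefficient has a holomorphic primitive, and integrating the
form along straight segments shows that `L` differs from it by a constant. -/
theorem hasDerivAt_of_isIntegralFrom (hL : Φ.IsIntegralFrom o L) (he : e ∈ atlas ℂ S) {z : ℂ}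
    (hz : z ∈ e.target) : HasDerivAt (fun w => L (e.symm w)) (Φ.coeff e z) z := by
  have : IsManifold 𝓘(ℝ, ℂ) ω S := isManifold_real
  obtain ⟨ε, hε, hball⟩ := Metric.isOpen_iff.1 e.open_target z hz
  obtain ⟨P, hP⟩ := ((Φ.holomorphic e he).mono hball).isExactOn_ball
  have key : ∀ w ∈ Metric.ball z ε, L (e.symm w) = L (e.symm z) + (P w - P z) := by
    intro w hw
    set ζ : ℝ → ℂ := fun t => z + (t : ℂ) * (w - z) with hζ
    have hζmem : ∀ t ∈ Icc (0 : ℝ) 1, ζ t ∈ Metric.ball z ε := by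
      intro t ht
      rw [mem_ball_iff_norm] at hw ⊢
      simp only [hζ, add_sub_cancel_left, norm_mul, Complex.norm_real, Real.norm_eq_abs,
        abs_of_nonneg ht.1]
      exact (mul_le_of_le_one_left (norm_nonneg _) ht.2).trans_lt hw
    have hζd : ∀ t, HasDerivAt ζ (w - z) t := fun t => by
      have := ((Complex.ofRealCLM.hasDerivAt (x := t)).mul_const (w - z)).const_add z
      rwa [Complex.ofRealCLM_apply, Complex.ofReal_one, one_mul] at this
    have hζs : ContDiff ℝ ∞ ζ :=
      contDiff_const.add (Complex.ofRealCLM.contDiff.mul contDiff_const)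
    have hc := hL.2 (fun t => e.symm (ζ t)) <|
      ((contMDiffOn_symm_of_mem_maximalAtlas (I := 𝓘(ℝ, ℂ)) (n := ω)
        (IsManifold.subset_maximalAtlas he)).of_le le_top).comp hζs.contMDiff.contMDiffOn
        fun t ht => hball (hζmem t ht)
    have hint : Φ.curveInt (fun t => e.symm (ζ t)) = ∫ t in (0 : ℝ)..1,
        Φ.coeff e (ζ t) * (w - z) := by
      refine intervalIntegral.integral_congr fun t ht => ?_
      rw [uIcc_of_le zero_le_one] at ht
      have htt := hball (hζmem t ht)
      have hs := mem_chart_source ℂ (e.symm (ζ t))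
      have hcompat := Φ.compat e he _ (chart_mem_atlas ℂ (e.symm (ζ t))) (e.symm (ζ t))
        ⟨e.map_target htt, hs⟩
      rw [e.right_inv htt] at hcompat
      have hd := ((differentiableAt_transition he (chart_mem_atlas ℂ (e.symm (ζ t))) htt
        hs).hasDerivAt.scomp t (hζd t)).deriv
      simp only [Function.comp_def, smul_eq_mul] at hd
      simp only [coeffAt]
      rw [hd, hcompat]
      ring
    have hFTC : ∫ t in (0 : ℝ)..1, Φ.coeff e (ζ t) * (w - z) = P (ζ 1) - P (ζ 0) := by
      refine intervalIntegral.integral_eq_sub_of_hasDerivAt (f := fun t => P (ζ t))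
        (fun t ht => ?_) ?_
      · rw [uIcc_of_le zero_le_one] at ht
        have := (hP (ζ t) (hζmem t ht)).scomp t (hζd t)
        rwa [smul_eq_mul, mul_comm] at this
      · refine ContinuousOn.intervalIntegrable ?_
        rw [uIcc_of_le zero_le_one]
        exact ((Φ.holomorphic e he).continuousOn.comp hζs.continuous.continuousOn
          fun t ht => hball (hζmem t ht)).mul continuousOn_const
    have h1 : ζ 1 = w := by simp [hζ]
    have h0 : ζ 0 = z := by simp [hζ]
    rw [hint, hFTC] at hc
    simp only [h1, h0] at hc
    rw [hc]; ring
  have hev : (fun w => L (e.symm w)) =ᶠ[𝓝 z] fun w => L (e.symm z) + (P w - P z) := by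
    filter_upwards [Metric.ball_mem_nhds z hε] with w hw using key w hw
  refine HasDerivAt.congr_of_eventuallyEq ?_ hev
  exact ((hP z (Metric.mem_ball_self hε)).sub_const _).const_add _

namespace IsSurfaceForm

theorem hasDerivAt_hat (h : Φ.IsSurfaceForm o) (he : e ∈ atlas ℂ S) {z : ℂ} (hz : z ∈ e.target) :
    HasDerivAt (fun w => Φ.hat o (e.symm w)) (Φ.coeff e z) z :=
  hasDerivAt_of_isIntegralFrom h.isIntegralFrom_hat he hz

theorem analyticAt_hat (h : Φ.IsSurfaceForm o) (he : e ∈ atlas ℂ S) {z : ℂ} (hz : z ∈ e.target) :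
    AnalyticAt ℂ (fun w => Φ.hat o (e.symm w)) z :=
  DifferentiableOn.analyticAt (s := e.target) (fun _ hw =>
    (h.hasDerivAt_hat he hw).differentiableAt.differentiableWithinAt) (e.open_target.mem_nhds hz)

theorem map_nhds_hat (h : Φ.IsSurfaceForm o) (x : S) :
    map (Φ.hat o) (𝓝 x) = 𝓝 (Φ.hat o x) := by
  set e := chartAt ℂ x
  have hx : x ∈ e.source := mem_chart_source ℂ x
  have he : e ∈ atlas ℂ S := chart_mem_atlas ℂ x
  have hz : e x ∈ e.target := e.map_source hx
  have hs : HasStrictDerivAt (fun w => Φ.hat o (e.symm w)) (Φ.coeff e (e x)) (e x) := by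
    have := (h.analyticAt_hat he hz).hasStrictDerivAt
    rwa [(h.hasDerivAt_hat he hz).deriv] at this
  have h1 := hs.map_nhds_eq (h.coeff_ne_zero he hz)
  rw [← e.map_nhds_eq hx, map_map, e.left_inv hx] at h1
  rw [← h1]
  refine map_congr ?_
  filter_upwards [e.open_source.mem_nhds hx] with y hy
  simp [e.left_inv hy]

theorem continuous_hat (h : Φ.IsSurfaceForm o) : Continuous (Φ.hat o) :=
  continuous_iff_continuousAt.2 fun x => (h.map_nhds_hat x).le

theorem isOpenMap_hat (h : Φ.IsSurfaceForm o) : IsOpenMap (Φ.hat o) :=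
  isOpenMap_iff_nhds_le.2 fun x => (h.map_nhds_hat x).ge

theorem exists_injOn_hat (h : Φ.IsSurfaceForm o) (x : S) : ∃ U ∈ 𝓝 x, InjOn (Φ.hat o) U := by
  set e := chartAt ℂ x
  have hx : x ∈ e.source := mem_chart_source ℂ x
  have he : e ∈ atlas ℂ S := chart_mem_atlas ℂ x
  have hz : e x ∈ e.target := e.map_source hx
  have hs : HasStrictDerivAt (fun w => Φ.hat o (e.symm w)) (Φ.coeff e (e x)) (e x) := by
    have := (h.analyticAt_hat he hz).hasStrictDerivAt
    rwa [(h.hasDerivAt_hat he hz).deriv] at this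
  have hf := hs.hasStrictFDerivAt_equiv (h.coeff_ne_zero he hz)
  set φ := hf.toOpenPartialHomeomorph _ with hφ
  refine ⟨e.source ∩ e ⁻¹' φ.source, inter_mem (e.open_source.mem_nhds hx)
    ((e.continuousAt hx).preimage_mem_nhds (φ.open_source.mem_nhds
      hf.mem_toOpenPartialHomeomorph_source)), fun a ha b hb hab => ?_⟩
  refine e.injOn ha.1 hb.1 (φ.injOn ha.2 hb.2 ?_)
  simp only [hφ, HasStrictFDerivAt.toOpenPartialHomeomorph_coe]
  rw [e.left_inv ha.1, e.left_inv hb.1]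
  exact hab

end IsSurfaceForm

theorem isOpen_disc (h : Φ.IsSurfaceForm o) (r : ℝ) : IsOpen (Φ.disc o r) :=
  isOpen_lt h.continuous_hat.norm continuous_const

namespace IsExhausted

theorem isCompact_preimage_closedBall (h : Φ.IsExhausted o) {r : ℝ} (hr : r ∈ Φ.radii o) :
    IsCompact (Φ.hat o ⁻¹' Metric.closedBall 0 r) := by
  obtain ⟨s, hs, hrs⟩ := isRadii_radii.up r hr
  refine (h.isCompact_closure_disc hs).of_isClosed_subset
    (Metric.isClosed_closedBall.preimage h.continuous_hat) fun x hx => subset_closure ?_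
  have : ‖Φ.hat o x‖ ≤ r := by simpa using hx
  exact this.trans_lt hrs

/-- The supremum `R` is never attained: `x̂` is open, so near a point with `x̂ ≠ 0` there are points
farther out on the same ray. -/
theorem norm_hat_mem (h : Φ.IsExhausted o) (hne : (Φ.radii o).Nonempty) (x : S) :
    ∃ r ∈ Φ.radii o, ‖Φ.hat o x‖ < r := by
  obtain ⟨r₁, hr₁⟩ := hne
  by_cases h0 : Φ.hat o x = 0
  · exact ⟨r₁, hr₁, by simpa [h0] using hr₁.1⟩
  · have hp := norm_pos_iff.2 h0
    have hnh : range (Φ.hat o) ∈ 𝓝 (Φ.hat o x) := h.isOpenMap_hat.isOpen_range.mem_nhds ⟨x, rfl⟩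
    have hcur : Tendsto (fun s : ℝ => (s : ℂ) * Φ.hat o x) (𝓝[>] 1) (𝓝 (Φ.hat o x)) := by
      have : ContinuousAt (fun s : ℝ => (s : ℂ) * Φ.hat o x) 1 := by fun_prop
      have h1 := this.tendsto
      simp only [Complex.ofReal_one, one_mul] at h1
      exact h1.mono_left nhdsWithin_le_nhds
    obtain ⟨s, hs, hs1⟩ := ((hcur.eventually hnh).and self_mem_nhdsWithin).exists
    obtain ⟨y, hy⟩ := hs
    have hs1' : 1 < s := hs1
    have hny : ‖Φ.hat o y‖ = s * ‖Φ.hat o x‖ := by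
      rw [hy, norm_mul, Complex.norm_real, Real.norm_of_nonneg (by linarith)]
    have hlt : ‖Φ.hat o x‖ < ‖Φ.hat o y‖ := by rw [hny]; nlinarith
    have hmem : ‖Φ.hat o x‖ ∈ Φ.radii o := by
      refine ⟨hp, (ENNReal.ofReal_lt_ofReal_iff (hp.trans hlt)).2 hlt |>.trans_le ?_⟩
      exact le_iSup₂_of_le (f := fun (r : ℝ) (_ : 0 < r ∧ (Φ.circle o r).Nonempty) =>
        ENNReal.ofReal r) ‖Φ.hat o y‖ ⟨hp.trans hlt, y, rfl⟩ le_rfl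
    obtain ⟨r, hr, hlt'⟩ := isRadii_radii.up _ hmem
    exact ⟨r, hr, hlt'⟩

/-- The range is open because `x̂` is an open map, and closed relative to the disc because the
preimage of the closed disc is compact; the disc is connected and `0` is attained at `o`. -/
theorem ball_subset_range_hat (h : Φ.IsExhausted o) {r : ℝ} (hr : r ∈ Φ.radii o) :
    Metric.ball 0 r ⊆ range (Φ.hat o) := by
  refine (convex_ball (0 : ℂ) r).isPreconnected.subset_of_closure_inter_subset
    h.isOpenMap_hat.isOpen_range ⟨0, by simpa using hr.1, o, (h.hat_eq_zero_iff o).2 rfl⟩ ?_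
  rintro w ⟨hw, hwr⟩
  have h1 : w ∈ closure (Metric.ball 0 r ∩ range (Φ.hat o)) :=
    Metric.isOpen_ball.inter_closure ⟨hwr, hw⟩
  have hc : IsClosed (Φ.hat o '' (Φ.hat o ⁻¹' Metric.closedBall 0 r)) :=
    ((h.isCompact_preimage_closedBall hr).image h.continuous_hat).isClosed
  have h2 : Metric.ball 0 r ∩ range (Φ.hat o) ⊆ Φ.hat o '' (Φ.hat o ⁻¹' Metric.closedBall 0 r) := by
    rintro _ ⟨hb, x, rfl⟩
    exact ⟨x, Metric.ball_subset_closedBall hb, rfl⟩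
  obtain ⟨x, -, hx⟩ := closure_minimal h2 hc h1
  exact ⟨x, hx⟩

/-- Consider the set of values attained at two distinct points. It is open, by openness of `x̂` at
two separated points. It is closed in each disc, by compactness, because two such points cannot
merge in the limit where `x̂` is locally injective. If nonempty, it would contain `0`, whose only
preimage is `o`. -/
theorem injective_hat [T2Space S] (h : Φ.IsExhausted o) (hne : (Φ.radii o).Nonempty) :
    Function.Injective (Φ.hat o) := by
  intro a b hab
  by_contra hne_ab
  obtain ⟨r, hr, har⟩ := h.norm_hat_mem hne a
  set D : Set (S × S) := {p | Φ.hat o p.1 = Φ.hat o p.2 ∧ p.1 ≠ p.2} with hD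
  have hDclosed : IsClosed D := by
    rw [← isOpen_compl_iff, isOpen_iff_mem_nhds]
    rintro ⟨x, y⟩ hxy
    by_cases heq : Φ.hat o x = Φ.hat o y
    · have hxy' : x = y := by
        by_contra hcon
        exact hxy ⟨heq, hcon⟩
      subst hxy'
      obtain ⟨U, hU, hinj⟩ := h.exists_injOn_hat x
      filter_upwards [prod_mem_nhds hU hU] with p hp hpD
      exact hpD.2 (hinj hp.1 hp.2 hpD.1)
    · have hc : Continuous fun p : S × S => (Φ.hat o p.1, Φ.hat o p.2) :=
        (h.continuous_hat.comp continuous_fst).prodMk (h.continuous_hat.comp continuous_snd)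
      have hopen : IsOpen {p : S × S | Φ.hat o p.1 ≠ Φ.hat o p.2} :=
        isOpen_ne_fun (h.continuous_hat.comp continuous_fst) (h.continuous_hat.comp continuous_snd)
      filter_upwards [hopen.mem_nhds heq] with p hp hpD
      exact hp hpD.1
  set V : Set ℂ := (fun p : S × S => Φ.hat o p.1) '' D with hV
  have hVopen : IsOpen V := by
    rw [isOpen_iff_mem_nhds]
    rintro _ ⟨⟨x, y⟩, ⟨hxy, hne'⟩, rfl⟩
    obtain ⟨U, W, hU, hW, hxU, hyW, hUW⟩ := t2_separation hne'
    have h1 := (h.isOpenMap_hat U hU).mem_nhds ⟨x, hxU, rfl⟩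
    have h2 := (h.isOpenMap_hat W hW).mem_nhds ⟨y, hyW, rfl⟩
    simp only at hxy
    rw [← hxy] at h2
    filter_upwards [h1, h2]
    rintro w ⟨x', hx', rfl⟩ ⟨y', hy', hxy'⟩
    exact ⟨(x', y'), ⟨hxy'.symm, fun hcon => hUW.le_bot ⟨hx', by rw [show x' = y' from hcon]; exact hy'⟩⟩, rfl⟩
  have hsub : Metric.ball 0 r ⊆ V := by
    refine (convex_ball (0 : ℂ) r).isPreconnected.subset_of_closure_inter_subset hVopen
      ⟨Φ.hat o a, by simpa using har, (a, b), ⟨hab, hne_ab⟩, rfl⟩ ?_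
    rintro w ⟨hw, hwr⟩
    have h1 : w ∈ closure (Metric.ball 0 r ∩ V) := Metric.isOpen_ball.inter_closure ⟨hwr, hw⟩
    set P := Φ.hat o ⁻¹' Metric.closedBall 0 r with hP
    have hPc := h.isCompact_preimage_closedBall hr
    have hc : IsClosed ((fun p : S × S => Φ.hat o p.1) '' ((P ×ˢ P) ∩ D)) :=
      (((hPc.prod hPc).inter_right hDclosed).image
        (h.continuous_hat.comp continuous_fst)).isClosed
    have h2 : Metric.ball 0 r ∩ V ⊆ (fun p : S × S => Φ.hat o p.1) '' ((P ×ˢ P) ∩ D) := by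
      rintro _ ⟨hb, p, hp, rfl⟩
      refine ⟨p, ⟨⟨Metric.ball_subset_closedBall hb, ?_⟩, hp⟩, rfl⟩
      rw [hP, mem_preimage, ← hp.1]
      exact Metric.ball_subset_closedBall hb
    obtain ⟨p, hp, hpw⟩ := closure_minimal h2 hc h1
    exact ⟨p, hp.2, hpw⟩
  obtain ⟨⟨x, y⟩, ⟨hxy, hne'⟩, h0⟩ := hsub (Metric.mem_ball_self hr.1)
  simp only at h0 hxy
  rw [h0] at hxy
  exact hne' (((h.hat_eq_zero_iff x).1 h0).trans ((h.hat_eq_zero_iff y).1 hxy.symm).symm)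

theorem sigmaCompactSpace (h : Φ.IsExhausted o) (hne : (Φ.radii o).Nonempty) :
    SigmaCompactSpace S := by
  refine SigmaCompactSpace.of_countable
    (range fun x : {x : ℚ // (x : ℝ) ∈ Φ.radii o} => closure (Φ.disc o (x : ℝ)))
    (countable_range _) ?_ ?_
  · rintro _ ⟨x, rfl⟩
    exact h.isCompact_closure_disc x.2
  · refine eq_univ_of_forall fun x => ?_
    obtain ⟨r, hr, hlt⟩ := h.norm_hat_mem hne x
    obtain ⟨y, hy1, hy2⟩ := exists_rat_btwn hlt
    exact mem_sUnion.2 ⟨_, ⟨⟨y, isRadii_radii.down r hr y ((norm_nonneg _).trans_lt hy1) hy2.le⟩, rfl⟩,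
      subset_closure hy1⟩

end IsExhausted

end HolomorphicForm

/-! ### Integration of `(1,1)`-forms in the coordinate `x̂` -/

theorem Complex.abs_det_smul_one (a : ℂ) : |(a • (1 : ℂ →L[ℝ] ℂ)).det| = ‖a‖ ^ 2 := by
  have h : ((a • (1 : ℂ →L[ℝ] ℂ) : ℂ →L[ℝ] ℂ) : ℂ →ₗ[ℝ] ℂ) =
      (a • (1 : ℂ →ₗ[ℂ] ℂ) : ℂ →ₗ[ℂ] ℂ).restrictScalars ℝ := rfl
  rw [ContinuousLinearMap.det, h, LinearMap.det_restrictScalars]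
  simp [Algebra.norm_complex_apply, Complex.normSq_eq_norm_sq]

namespace HolomorphicForm

variable {S : Type*} [TopologicalSpace S] [ChartedSpace ℂ S] {Φ : HolomorphicForm S} {o : S}

theorem image_chartPiece (A : Set S) (n : ℕ) :
    chartAt ℂ (chartSeq o n) '' chartPiece o A n =
      ((chartAt ℂ (chartSeq o n)).target ∩ (chartAt ℂ (chartSeq o n)).symm ⁻¹' A) \
        ⋃ m < n, (chartAt ℂ (chartSeq o n)).target ∩ (chartAt ℂ (chartSeq o n)).symm ⁻¹'
          (chartAt ℂ (chartSeq o m)).source := by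
  set e := chartAt ℂ (chartSeq o n)
  ext z
  simp only [chartPiece, mem_image, Set.mem_sdiff, mem_inter_iff, mem_iUnion, mem_preimage,
    not_exists, not_and]
  constructor
  · rintro ⟨x, ⟨⟨hxA, hxe⟩, hx⟩, rfl⟩
    refine ⟨⟨e.map_source hxe, by rwa [e.left_inv hxe]⟩, fun m hm _ => ?_⟩
    rw [e.left_inv hxe]
    exact hx m hm
  · rintro ⟨⟨hz, hzA⟩, hzm⟩
    exact ⟨e.symm z, ⟨⟨hzA, e.map_target hz⟩, fun m hm => hzm m hm hz⟩, e.right_inv hz⟩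

theorem measurableSet_image_chartPiece {A : Set S} (hA : IsOpen A) (n : ℕ) :
    MeasurableSet (chartAt ℂ (chartSeq o n) '' chartPiece o A n) := by
  rw [image_chartPiece]
  refine ((OpenPartialHomeomorph.isOpen_inter_preimage_symm _ hA).measurableSet).diff ?_
  exact MeasurableSet.iUnion fun m => MeasurableSet.iUnion fun _ =>
    (OpenPartialHomeomorph.isOpen_inter_preimage_symm _
      (chartAt ℂ (chartSeq o m)).open_source).measurableSet

theorem pairwise_disjoint_chartPiece (A : Set S) : Pairwise (Function.onFun Disjoint (chartPiece o A)) := by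
  have key : ∀ m n, m < n → Disjoint (chartPiece o A m) (chartPiece o A n) := fun m n hmn =>
    Set.disjoint_left.2 fun x hm hn => hn.2 (mem_iUnion₂.2 ⟨m, hmn, hm.1.2⟩)
  intro m n hmn
  rcases lt_or_gt_of_ne hmn with h | h
  · exact key m n h
  · exact (key n m h).symm

theorem iUnion_chartPiece [SigmaCompactSpace S] (A : Set S) : ⋃ n, chartPiece o A n = A := by
  classical
  refine Subset.antisymm (iUnion_subset fun n x hx => hx.1.1) fun x hx => ?_
  have hex : ∃ n, x ∈ (chartAt ℂ (chartSeq o n)).source := by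
    have : x ∈ ⋃ n, (chartAt ℂ (chartSeq o n)).source := by rw [iUnion_chartSeq]; trivial
    simpa using this
  refine mem_iUnion.2 ⟨Nat.find hex, ⟨hx, Nat.find_spec hex⟩, ?_⟩
  simp only [mem_iUnion, not_exists]
  exact fun m hm => Nat.find_min hex hm

variable [IsManifold 𝓘(ℂ, ℂ) ω S]

theorem IsExhausted.image_hat_disc (h : Φ.IsExhausted o) {t : ℝ} (ht : t ∈ Φ.radii o) :
    Φ.hat o '' Φ.disc o t = Metric.ball 0 t := by
  ext w
  constructor
  · rintro ⟨x, hx, rfl⟩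
    have : ‖Φ.hat o x‖ < t := hx
    simpa using this
  · intro hw
    obtain ⟨x, rfl⟩ := h.ball_subset_range_hat ht hw
    exact ⟨x, show ‖Φ.hat o x‖ < t by simpa using hw, rfl⟩

/-- In each chart `x̂` is injective with real Jacobian `|φ|²`, so the change of variables formula
carries the chart pieces to disjoint measurable sets that fill the disc. -/
theorem IsExhausted.formIntegral_disc [T2Space S] (h : Φ.IsExhausted o) {t : ℝ} (ht : t ∈ Φ.radii o)
    {η : OpenPartialHomeomorph S ℂ → ℂ → ℝ} {H : ℂ → ℝ}
    (hη : ∀ e ∈ atlas ℂ S, ∀ z ∈ e.target, ‖Φ.hat o (e.symm z)‖ < t →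
      η e z = ‖Φ.coeff e z‖ ^ 2 * H (Φ.hat o (e.symm z)))
    (hH : IntegrableOn H (Metric.ball 0 t)) :
    formIntegral o η (Φ.disc o t) = ∫ w in Metric.ball 0 t, H w := by
  have hne : (Φ.radii o).Nonempty := ⟨t, ht⟩
  have := h.sigmaCompactSpace hne
  have hinj := h.injective_hat hne
  have hopen := isOpen_disc h.toIsSurfaceForm t
  have hA := measurableSet_image_chartPiece (o := o) hopen
  have himg : ∀ n, (fun z => Φ.hat o ((chartAt ℂ (chartSeq o n)).symm z)) ''
      (chartAt ℂ (chartSeq o n) '' chartPiece o (Φ.disc o t) n) =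
        Φ.hat o '' chartPiece o (Φ.disc o t) n := by
    intro n
    rw [image_image]
    refine image_congr fun x hx => ?_
    rw [(chartAt ℂ (chartSeq o n)).left_inv hx.1.2]
  have hsub : ∀ n, ∀ z ∈ chartAt ℂ (chartSeq o n) '' chartPiece o (Φ.disc o t) n,
      z ∈ (chartAt ℂ (chartSeq o n)).target ∧
        ‖Φ.hat o ((chartAt ℂ (chartSeq o n)).symm z)‖ < t := by
    rintro n _ ⟨x, hx, rfl⟩
    refine ⟨(chartAt ℂ (chartSeq o n)).map_source hx.1.2, ?_⟩
    rw [(chartAt ℂ (chartSeq o n)).left_inv hx.1.2]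
    exact hx.1.1
  have hderiv : ∀ n, ∀ z ∈ chartAt ℂ (chartSeq o n) '' chartPiece o (Φ.disc o t) n,
      HasFDerivWithinAt (fun z => Φ.hat o ((chartAt ℂ (chartSeq o n)).symm z))
        (Φ.coeff (chartAt ℂ (chartSeq o n)) z • (1 : ℂ →L[ℝ] ℂ))
        (chartAt ℂ (chartSeq o n) '' chartPiece o (Φ.disc o t) n) z := fun n z hz =>
    (h.hasDerivAt_hat (chart_mem_atlas ℂ _) (hsub n z hz).1).complexToReal_fderiv.hasFDerivWithinAt
  have hinjOn : ∀ n, InjOn (fun z => Φ.hat o ((chartAt ℂ (chartSeq o n)).symm z))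
      (chartAt ℂ (chartSeq o n) '' chartPiece o (Φ.disc o t) n) := fun n a ha b hb hab =>
    (chartAt ℂ (chartSeq o n)).symm.injOn (hsub n a ha).1 (hsub n b hb).1 (hinj hab)
  have hpiece : ∀ n, ∫ z in chartAt ℂ (chartSeq o n) '' chartPiece o (Φ.disc o t) n,
      η (chartAt ℂ (chartSeq o n)) z = ∫ w in Φ.hat o '' chartPiece o (Φ.disc o t) n, H w := by
    intro n
    rw [← himg n, integral_image_eq_integral_abs_det_fderiv_smul volume (hA n) (hderiv n)
      (hinjOn n)]
    refine setIntegral_congr_fun (hA n) fun z hz => ?_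
    simp only [Complex.abs_det_smul_one, smul_eq_mul]
    exact hη _ (chart_mem_atlas ℂ _) z (hsub n z hz).1 (hsub n z hz).2
  have hmeas : ∀ n, MeasurableSet (Φ.hat o '' chartPiece o (Φ.disc o t) n) := fun n => by
    rw [← himg n]
    exact measurable_image_of_fderivWithin (hA n) (hderiv n) (hinjOn n)
  have hunion : ⋃ n, Φ.hat o '' chartPiece o (Φ.disc o t) n = Metric.ball 0 t := by
    rw [← image_iUnion, iUnion_chartPiece, h.image_hat_disc ht]
  simp only [formIntegral, hpiece]
  rw [← integral_iUnion hmeas (fun m n hmn => ?_) (by rwa [hunion]), hunion]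
  exact (disjoint_image_iff hinj).2 (pairwise_disjoint_chartPiece _ hmn)

end HolomorphicForm

/-! ### The Riemann sphere, and reduced representations of holomorphic maps -/

/-- The point of the sphere with homogeneous coordinates `[u : v]`. -/
noncomputable def ratioPoint (u v : ℂ) : OnePoint ℂ :=
  if u = 0 then OnePoint.infty else ((v / u : ℂ) : OnePoint ℂ)

/-- A unit linear form on `ℂ²` that vanishes at the point `a` of the sphere. -/
noncomputable def sphereForm (a : OnePoint ℂ) : ℂ × ℂ :=
  a.elim (1, 0) fun c => (-c / (Real.sqrt (1 + ‖c‖ ^ 2) : ℝ), 1 / (Real.sqrt (1 + ‖c‖ ^ 2) : ℝ))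

/-- The squared chordal distance from a point of the sphere to the zero of a linear form. -/
noncomputable def sphereChordalSq (b : ℂ × ℂ) (p : OnePoint ℂ) : ℝ :=
  p.elim (‖b.2‖ ^ 2) fun c => ‖b.1 + b.2 * c‖ ^ 2 / (1 + ‖c‖ ^ 2)

theorem sphereForm_unit (a : OnePoint ℂ) : ‖(sphereForm a).1‖ ^ 2 + ‖(sphereForm a).2‖ ^ 2 = 1 := by
  induction a using OnePoint.rec with
  | infty => simp [sphereForm]
  | coe c =>
    have h : (0 : ℝ) < 1 + ‖c‖ ^ 2 := by positivity
    simp only [sphereForm, OnePoint.elim_some, norm_div, norm_neg, Complex.norm_real, norm_one,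
      Real.norm_of_nonneg (Real.sqrt_nonneg _), div_pow, Real.sq_sqrt h.le]
    field_simp
    ring

theorem sphereChordalSq_ratioPoint (b : ℂ × ℂ) {u v : ℂ} (h : u ≠ 0 ∨ v ≠ 0) :
    sphereChordalSq b (ratioPoint u v) = ‖b.1 * u + b.2 * v‖ ^ 2 / (‖u‖ ^ 2 + ‖v‖ ^ 2) := by
  by_cases hu : u = 0
  · have hv : ‖v‖ ≠ 0 := norm_ne_zero_iff.2 (by tauto)
    simp only [ratioPoint, hu, if_true, sphereChordalSq, OnePoint.elim_infty, norm_mul, mul_zero,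
      zero_add, norm_zero, mul_pow]
    field_simp
    ring
  · have hu' : ‖u‖ ≠ 0 := norm_ne_zero_iff.2 hu
    have e : b.1 * u + b.2 * v = u * (b.1 + b.2 * (v / u)) := by field_simp
    have h1 : ‖u‖ ^ 2 + ‖v‖ ^ 2 = ‖u‖ ^ 2 * (1 + ‖v / u‖ ^ 2) := by
      rw [norm_div]; field_simp
    simp only [ratioPoint, hu, if_false, sphereChordalSq, OnePoint.elim_some]
    rw [e, h1, norm_mul, mul_pow, mul_div_mul_left _ _ (pow_ne_zero 2 hu')]

theorem sphereChordalSq_sphereForm_eq_zero_iff {a p : OnePoint ℂ} :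
    sphereChordalSq (sphereForm a) p = 0 ↔ p = a := by
  have hs : ∀ c : ℂ, ((Real.sqrt (1 + ‖c‖ ^ 2) : ℝ) : ℂ) ≠ 0 := fun c => by
    have : (0 : ℝ) < 1 + ‖c‖ ^ 2 := by positivity
    exact_mod_cast (Real.sqrt_pos.2 this).ne'
  have hp : ∀ c : ℂ, 1 + ‖c‖ ^ 2 ≠ 0 := fun c => by positivity
  induction a using OnePoint.rec with
  | infty =>
    induction p using OnePoint.rec with
    | infty => simp [sphereForm, sphereChordalSq]
    | coe d => simp [sphereForm, sphereChordalSq, hp]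
  | coe c =>
    induction p using OnePoint.rec with
    | infty => simpa [sphereForm, sphereChordalSq] using hs c
    | coe d =>
      have e : -c / ((Real.sqrt (1 + ‖c‖ ^ 2) : ℝ) : ℂ) + 1 / ((Real.sqrt (1 + ‖c‖ ^ 2) : ℝ) : ℂ) * d
          = (d - c) / ((Real.sqrt (1 + ‖c‖ ^ 2) : ℝ) : ℂ) := by ring
      simp only [sphereForm, sphereChordalSq, OnePoint.elim_some, e, div_eq_zero_iff, hp, or_false,
        pow_eq_zero_iff (two_ne_zero), norm_eq_zero, hs, sub_eq_zero, OnePoint.coe_eq_coe]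

theorem formDet_sphereForm_ne_zero {a a' : OnePoint ℂ} (h : a ≠ a') :
    formDet (sphereForm a) (sphereForm a') ≠ 0 := by
  have hs : ∀ c : ℂ, ((Real.sqrt (1 + ‖c‖ ^ 2) : ℝ) : ℂ) ≠ 0 := fun c => by
    have : (0 : ℝ) < 1 + ‖c‖ ^ 2 := by positivity
    exact_mod_cast (Real.sqrt_pos.2 this).ne'
  induction a using OnePoint.rec with
  | infty =>
    induction a' using OnePoint.rec with
    | infty => exact absurd rfl h
    | coe d => simpa [sphereForm, formDet] using hs d
  | coe c =>
    induction a' using OnePoint.rec with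
    | infty => simpa [sphereForm, formDet] using hs c
    | coe d =>
      have hcd : d - c ≠ 0 := sub_ne_zero.2 fun e => h (by rw [e])
      have e : formDet (sphereForm c) (sphereForm d) =
          (d - c) / (((Real.sqrt (1 + ‖c‖ ^ 2) : ℝ) : ℂ) * ((Real.sqrt (1 + ‖d‖ ^ 2) : ℝ) : ℂ)) := by
        simp only [sphereForm, formDet, OnePoint.elim_some]
        have h1 := hs c
        have h2 := hs d
        field_simp
        ring
      rw [e]
      exact div_ne_zero hcd (mul_ne_zero (hs c) (hs d))

theorem sphereCoord_eq_inv (p : OnePoint ℂ) : sphereCoord p = (sphereCoordInv p)⁻¹ := by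
  induction p using OnePoint.rec with
  | infty => simp [sphereCoord, sphereCoordInv]
  | coe c => simp [sphereCoord, sphereCoordInv]

theorem ratioPoint_one_sphereCoord {p : OnePoint ℂ} (h : p ≠ OnePoint.infty) :
    ratioPoint 1 (sphereCoord p) = p := by
  induction p using OnePoint.rec with
  | infty => exact absurd rfl h
  | coe c => simp [ratioPoint, sphereCoord]

theorem ratioPoint_sphereCoordInv_one {p : OnePoint ℂ} (h : p ≠ ((0 : ℂ) : OnePoint ℂ)) :
    ratioPoint (sphereCoordInv p) 1 = p := by
  induction p using OnePoint.rec with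
  | infty => simp [ratioPoint, sphereCoordInv]
  | coe c =>
    have hc : c ≠ 0 := fun e => h (by rw [e])
    simp [ratioPoint, sphereCoordInv, hc]

theorem sphereCoord_ratioPoint {u v : ℂ} (hu : u ≠ 0) : sphereCoord (ratioPoint u v) = v / u := by
  simp [ratioPoint, hu, sphereCoord]

theorem sphereCoordInv_ratioPoint {u v : ℂ} :
    sphereCoordInv (ratioPoint u v) = u / v := by
  by_cases hu : u = 0
  · simp [ratioPoint, hu, sphereCoordInv]
  · simp [ratioPoint, hu, sphereCoordInv]

theorem wronskian_one_left (φ : ℂ → ℂ) (z : ℂ) : wronskian (fun _ => 1) φ z = deriv φ z := by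
  simp [wronskian]

theorem wronskian_one_right (φ : ℂ → ℂ) (z : ℂ) : wronskian φ (fun _ => 1) z = -deriv φ z := by
  simp [wronskian]

/-- The density `K` of `f^* ω_FS = (1 / π) K dx ∧ dy` for a map from the plane to the sphere. -/
noncomputable def sphereDensity (F : ℂ → OnePoint ℂ) (z : ℂ) : ℝ :=
  Real.pi * fubiniStudyPullback F (OpenPartialHomeomorph.refl ℂ) z

theorem pi_mul_ddc (u : ℂ → ℝ) (z : ℂ) : Real.pi * ddc u z = Laplacian.laplacian u z / 4 := by
  rw [ddc]; field_simp

theorem sphereDensity_of_ne_infty {F : ℂ → OnePoint ℂ} {z : ℂ} (h : F z ≠ OnePoint.infty)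
    (ha : AnalyticAt ℂ (fun w => sphereCoord (F w)) z) :
    sphereDensity F z = fsDensity (fun _ => 1) (fun w => sphereCoord (F w)) z := by
  have e : (fun w => Real.log (1 + ‖sphereCoord (F w)‖ ^ 2)) = fun w =>
      Real.log (weightedNormSq (fun _ => 1) (fun w => sphereCoord (F w)) 1 1 w) := by
    funext w; simp [weightedNormSq]
  have hd : sphereDensity F z =
      Real.pi * ddc (fun w => Real.log (1 + ‖sphereCoord (F w)‖ ^ 2)) z :=
    congrArg (Real.pi * ·) (if_pos h)
  rw [hd, pi_mul_ddc, e, laplacian_log_weightedNormSq analyticAt_const ha (by simp [weightedNormSq]; positivity),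
    fsDensity]
  ring

theorem sphereDensity_of_eq_infty {F : ℂ → OnePoint ℂ} {z : ℂ} (h : F z = OnePoint.infty)
    (ha : AnalyticAt ℂ (fun w => sphereCoordInv (F w)) z) :
    sphereDensity F z = fsDensity (fun w => sphereCoordInv (F w)) (fun _ => 1) z := by
  have e : (fun w => Real.log (‖sphereCoordInv (F w)‖ ^ 2 + 1)) = fun w =>
      Real.log (weightedNormSq (fun w => sphereCoordInv (F w)) (fun _ => 1) 1 1 w) := by
    funext w; simp [weightedNormSq]
  have hd : sphereDensity F z =
      Real.pi * ddc (fun w => Real.log (‖sphereCoordInv (F w)‖ ^ 2 + 1)) z :=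
    congrArg (Real.pi * ·) (if_neg (not_not.2 h))
  rw [hd, pi_mul_ddc, e, laplacian_log_weightedNormSq ha analyticAt_const (by simp [weightedNormSq]; positivity),
    fsDensity]
  ring

/-- The pull-back is defined by different potentials at finite points and at poles. The derivative
of `f₁ / f₀` is `W / f₀²`, and similarly for `f₀ / f₁`, so both agree with the homogeneous formula.
-/
theorem sphereDensity_eq_fsDensity {F : ℂ → OnePoint ℂ} {f₀ f₁ : ℂ → ℂ} {z : ℂ}
    (h₀ : AnalyticAt ℂ f₀ z) (h₁ : AnalyticAt ℂ f₁ z) (hne : f₀ z ≠ 0 ∨ f₁ z ≠ 0)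
    (hF : ∀ᶠ w in 𝓝 z, F w = ratioPoint (f₀ w) (f₁ w)) :
    sphereDensity F z = fsDensity f₀ f₁ z := by
  have hFz := hF.self_of_nhds
  by_cases h0 : f₀ z = 0
  · have h1 : f₁ z ≠ 0 := by tauto
    have hinf : F z = OnePoint.infty := by rw [hFz, ratioPoint, if_pos h0]
    have hev : (fun w => sphereCoordInv (F w)) =ᶠ[𝓝 z] fun w => f₀ w / f₁ w := by
      filter_upwards [hF] with w hw
      rw [hw, sphereCoordInv_ratioPoint]
    have ha : AnalyticAt ℂ (fun w => sphereCoordInv (F w)) z := (h₀.fun_div h₁ h1).congr hev.symm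
    rw [sphereDensity_of_eq_infty hinf ha, fsDensity, fsDensity, wronskian_one_right, hev.deriv_eq]
    simp only [weightedNormSq, one_mul, hev.self_of_nhds, wronskian]
    rw [(h₀.differentiableAt.hasDerivAt.fun_div h₁.differentiableAt.hasDerivAt h1).deriv, h0]
    have hn : ‖f₁ z‖ ≠ 0 := norm_ne_zero_iff.2 h1
    simp
    field_simp
  · have hinf : F z ≠ OnePoint.infty := by
      rw [hFz, ratioPoint, if_neg h0]; exact OnePoint.coe_ne_infty _
    have hev : (fun w => sphereCoord (F w)) =ᶠ[𝓝 z] fun w => f₁ w / f₀ w := by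
      filter_upwards [hF, h₀.continuousAt.eventually_ne h0] with w hw hw0
      rw [hw, sphereCoord_ratioPoint hw0]
    have ha : AnalyticAt ℂ (fun w => sphereCoord (F w)) z := (h₁.fun_div h₀ h0).congr hev.symm
    rw [sphereDensity_of_ne_infty hinf ha, fsDensity, fsDensity, wronskian_one_left, hev.deriv_eq]
    simp only [weightedNormSq, one_mul, hev.self_of_nhds, wronskian]
    rw [(h₁.differentiableAt.hasDerivAt.fun_div h₀.differentiableAt.hasDerivAt h0).deriv]
    have hn : ‖f₀ z‖ ≠ 0 := norm_ne_zero_iff.2 h0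
    have e : deriv f₁ z * f₀ z - f₁ z * deriv f₀ z = f₀ z * deriv f₁ z - deriv f₀ z * f₁ z := by
      ring
    rw [e]
    simp only [norm_div, norm_pow, norm_one]
    field_simp

/-- A holomorphic map from an open set of the plane to the sphere. -/
structure IsHolomorphicToSphere (F : ℂ → OnePoint ℂ) (U : Set ℂ) : Prop where
  continuousAt : ∀ z ∈ U, ContinuousAt F z
  analyticAt : ∀ z ∈ U, F z ≠ OnePoint.infty → AnalyticAt ℂ (fun w => sphereCoord (F w)) z
  analyticAt_inv : ∀ z ∈ U, F z ≠ ((0 : ℂ) : OnePoint ℂ) →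
    AnalyticAt ℂ (fun w => sphereCoordInv (F w)) z

namespace IsHolomorphicToSphere

variable {F : ℂ → OnePoint ℂ} {U : Set ℂ}

theorem meromorphicAt (hF : IsHolomorphicToSphere F U) {z : ℂ} (hz : z ∈ U) :
    MeromorphicAt (fun w => sphereCoord (F w)) z := by
  by_cases h : F z = OnePoint.infty
  · have ha := hF.analyticAt_inv z hz (by rw [h]; exact OnePoint.infty_ne_coe _)
    simp only [sphereCoord_eq_inv]
    exact ha.meromorphicAt.inv
  · exact (hF.analyticAt z hz h).meromorphicAt

/-- As `sphereCoord` has the default value `0` at `∞`, the hypothesis allows both `F = 0` and `F =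
∞` near `z`. The lemma excludes infinite order for nonconstant maps. -/
theorem sphereDensity_eq_zero_of_eventually (hF : IsHolomorphicToSphere F U) {z : ℂ} (hz : z ∈ U)
    (h : ∀ᶠ w in 𝓝[≠] z, sphereCoord (F w) = 0) : sphereDensity F z = 0 := by
  by_cases hinf : F z = OnePoint.infty
  · have ha := hF.analyticAt_inv z hz (by rw [hinf]; exact OnePoint.infty_ne_coe _)
    have h' : (fun w => sphereCoordInv (F w)) =ᶠ[𝓝[≠] z] fun _ => 0 := by
      filter_upwards [h] with w hw
      rw [sphereCoord_eq_inv, inv_eq_zero] at hw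
      exact hw
    have h2 := (ha.continuousAt.eventuallyEq_nhds_iff_eventuallyEq_nhdsNE continuousAt_const).1 h'
    rw [sphereDensity_of_eq_infty hinf ha, fsDensity, wronskian_one_right, h2.deriv_eq]
    simp
  · have ha := hF.analyticAt z hz hinf
    have h2 := (ha.continuousAt.eventuallyEq_nhds_iff_eventuallyEq_nhdsNE
      (continuousAt_const (y := (0 : ℂ)))).1 h
    rw [sphereDensity_of_ne_infty hinf ha, fsDensity, wronskian_one_left, h2.deriv_eq]
    simp

theorem eventually_const_of_sphereDensity_eq_zero (hF : IsHolomorphicToSphere F U) (hU : IsOpen U)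
    (h0 : ∀ z ∈ U, sphereDensity F z = 0) {z : ℂ} (hz : z ∈ U) : ∀ᶠ w in 𝓝 z, F w = F z := by
  have hc := hF.continuousAt z hz
  have key : ∀ φ : ℂ → ℂ, (∀ᶠ w in 𝓝 z, DifferentiableAt ℂ φ w ∧ deriv φ w = 0) →
      ∀ᶠ w in 𝓝 z, φ w = φ z := by
    intro φ hφ
    obtain ⟨ε, hε, hball⟩ := Metric.eventually_nhds_iff_ball.1 hφ
    filter_upwards [Metric.ball_mem_nhds z hε] with w hw
    exact Metric.isOpen_ball.is_const_of_deriv_eq_zero (convex_ball z ε).isPreconnected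
      (fun u hu => (hball u hu).1.differentiableWithinAt) (fun u hu => (hball u hu).2) hw
      (Metric.mem_ball_self hε)
  have hpos : ∀ (g₀ g₁ : ℂ → ℂ) (w : ℂ), (g₀ w ≠ 0 ∨ g₁ w ≠ 0) → fsDensity g₀ g₁ w = 0 →
      wronskian g₀ g₁ w = 0 := by
    intro g₀ g₁ w hne h
    have hN : weightedNormSq g₀ g₁ 1 1 w ≠ 0 := by
      simp only [weightedNormSq, one_mul]
      rcases hne with h | h
      · have := norm_pos_iff.2 h; positivity
      · have := norm_pos_iff.2 h; positivity
    simpa [fsDensity, hN] using h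
  by_cases hinf : F z = OnePoint.infty
  · have hne : ∀ᶠ w in 𝓝 z, F w ≠ ((0 : ℂ) : OnePoint ℂ) :=
      hc.eventually_ne (by rw [hinf]; exact OnePoint.infty_ne_coe _)
    have hz0 : F z ≠ ((0 : ℂ) : OnePoint ℂ) := hne.self_of_nhds
    have hk := key (fun w => sphereCoordInv (F w)) (by
      filter_upwards [hne.eventually_nhds, hU.mem_nhds hz] with w hw hwU
      have ha := hF.analyticAt_inv w hwU hw.self_of_nhds
      refine ⟨ha.differentiableAt, ?_⟩
      have h1 := h0 w hwU
      rw [sphereDensity_eq_fsDensity ha analyticAt_const (Or.inr one_ne_zero)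
        (hw.mono fun u hu => (ratioPoint_sphereCoordInv_one hu).symm)] at h1
      simpa [wronskian_one_right] using hpos _ _ w (Or.inr one_ne_zero) h1)
    filter_upwards [hk, hne] with w hw hw0
    rw [← ratioPoint_sphereCoordInv_one hw0, hw, ratioPoint_sphereCoordInv_one hz0]
  · have hne : ∀ᶠ w in 𝓝 z, F w ≠ OnePoint.infty := hc.eventually_ne hinf
    have hk := key (fun w => sphereCoord (F w)) (by
      filter_upwards [hne.eventually_nhds, hU.mem_nhds hz] with w hw hwU
      have ha := hF.analyticAt w hwU hw.self_of_nhds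
      refine ⟨ha.differentiableAt, ?_⟩
      have h1 := h0 w hwU
      rw [sphereDensity_eq_fsDensity analyticAt_const ha (Or.inl one_ne_zero)
        (hw.mono fun u hu => (ratioPoint_one_sphereCoord hu).symm)] at h1
      simpa [wronskian_one_left] using hpos _ _ w (Or.inl one_ne_zero) h1)
    filter_upwards [hk, hne] with w hw hw0
    rw [← ratioPoint_one_sphereCoord hw0, hw, ratioPoint_one_sphereCoord hinf]

/-- On a closed disc inside the domain there are only finitely many zeros and poles. The poles go
into a polynomial `f₀`, the zeros and the zero-free factor into `f₁`. Shrinking the disc thus avoids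
infinite products. -/
theorem exists_isReducedPair {ρ ρ' : ℝ} (hF : IsHolomorphicToSphere F (Metric.ball 0 ρ'))
    (hρ : ρ < ρ') (hK : ∃ z ∈ Metric.ball (0 : ℂ) ρ', sphereDensity F z ≠ 0) :
    ∃ f₀ f₁, IsReducedPair f₀ f₁ ρ ∧
      ∀ z ∈ Metric.ball (0 : ℂ) ρ, F z = ratioPoint (f₀ z) (f₁ z) := by
  classical
  set φ : ℂ → ℂ := fun w => sphereCoord (F w) with hφ
  have hmer : MeromorphicOn φ (Metric.ball 0 ρ') := fun z hz => hF.meromorphicAt hz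
  have hsub : Metric.closedBall (0 : ℂ) ρ ⊆ Metric.ball 0 ρ' := Metric.closedBall_subset_ball hρ
  obtain ⟨z₁, hz₁, hK₁⟩ := hK
  have hconn : IsConnected (Metric.ball (0 : ℂ) ρ') :=
    ⟨⟨z₁, hz₁⟩, (convex_ball (0 : ℂ) ρ').isPreconnected⟩
  have hord : ∀ z ∈ Metric.ball (0 : ℂ) ρ', meromorphicOrderAt φ z ≠ ⊤ := by
    have := (hmer.exists_meromorphicOrderAt_ne_top_iff_forall hconn).1 ⟨⟨z₁, hz₁⟩, fun htop =>
      hK₁ (hF.sphereDensity_eq_zero_of_eventually hz₁ (meromorphicOrderAt_eq_top_iff.1 htop))⟩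
    exact fun z hz => this ⟨z, hz⟩
  have hfin := (MeromorphicOn.divisor φ (Metric.closedBall 0 ρ)).finiteSupport
    (isCompact_closedBall 0 ρ)
  obtain ⟨g, hg, hg0, hφg⟩ := (hmer.mono_set hsub).extract_zeros_poles
    (fun u => hord u (hsub u.2)) hfin
  set D : ℂ → ℤ := fun u => MeromorphicOn.divisor φ (Metric.closedBall 0 ρ) u with hD
  set s := hfin.toFinset with hs
  -- `toNat` truncates at zero, so `-D u` is kept only at poles and `D u` only at zeros; the two
  -- products have no common root.
  set f₀ : ℂ → ℂ := fun z => ∏ u ∈ s, (z - u) ^ (-D u).toNat with hf₀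
  set f₁ : ℂ → ℂ := fun z => (∏ u ∈ s, (z - u) ^ (D u).toNat) * g z with hf₁
  have hprod : ∀ z, (∏ᶠ u, (fun w : ℂ => w - u) ^ D u) z = ∏ u ∈ s, (z - u) ^ D u := by
    intro z
    rw [finprod_eq_prod_of_mulSupport_subset (s := s)]
    · simp [Finset.prod_apply]
    · intro u hu
      simp only [hs, Finite.coe_toFinset, Function.mem_support, Function.mem_mulSupport] at hu ⊢
      contrapose! hu
      have : D u = 0 := hu
      rw [this, zpow_zero]
  -- At zeros and poles the factorization may fail pointwise because of default values; it is used
  -- off `z` and then extended by continuity of the appropriate coordinate.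
  have hpunct : ∀ z ∈ Metric.ball (0 : ℂ) ρ, ∀ᶠ w in 𝓝[≠] z, f₀ w * φ w = f₁ w := by
    intro z hz
    have h1 := mem_codiscreteWithin_iff_forall_mem_nhdsNE.1 hφg z
      (Metric.ball_subset_closedBall hz)
    have h2 : Metric.closedBall (0 : ℂ) ρ ∈ 𝓝[≠] z := nhdsWithin_le_nhds
      (mem_of_superset (Metric.isOpen_ball.mem_nhds hz) Metric.ball_subset_closedBall)
    have h3 : ∀ᶠ w in 𝓝[≠] z, w ∉ (s : Set ℂ) := by
      have := (s.finite_toSet.subset (Set.sdiff_subset (t := {z}))).isClosed.isOpen_compl.mem_nhds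
        (show z ∈ ((s : Set ℂ) \ {z})ᶜ by simp)
      filter_upwards [nhdsWithin_le_nhds this, self_mem_nhdsWithin] with w hw hwz hws
      exact hw ⟨hws, hwz⟩
    filter_upwards [h1, h2, h3] with w hw hwb hws
    have hw' : φ w = (∏ᶠ u, (fun w : ℂ => w - u) ^ D u) w * g w := by
      rcases hw with hw | hw
      · exact hw
      · exact absurd hwb hw
    rw [hw', hprod, ← mul_assoc, hf₀, hf₁]
    simp only
    rw [← Finset.prod_mul_distrib]
    congr 1
    refine Finset.prod_congr rfl fun u hu => ?_
    have hne : w - u ≠ 0 := sub_ne_zero.2 fun e => hws (by rw [e]; exact hu)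
    rw [← zpow_natCast, ← zpow_natCast, ← zpow_add₀ hne]
    congr 1
    omega
  have ha₀ : AnalyticOnNhd ℂ f₀ (Metric.ball 0 ρ) := fun z _ =>
    Finset.analyticAt_fun_prod _ fun u _ => (analyticAt_id.sub analyticAt_const).pow _
  have ha₁ : AnalyticOnNhd ℂ f₁ (Metric.ball 0 ρ) := fun z hz =>
    (Finset.analyticAt_fun_prod _ fun u _ => (analyticAt_id.sub analyticAt_const).pow _).mul
      (hg z (Metric.ball_subset_closedBall hz))
  have hne : ∀ z ∈ Metric.ball (0 : ℂ) ρ, f₀ z ≠ 0 ∨ f₁ z ≠ 0 := by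
    intro z hz
    by_contra! hcon
    obtain ⟨h0, h1⟩ := hcon
    have hzero : ∀ m : ℂ → ℕ, ∏ u ∈ s, (z - u) ^ m u = 0 → m z ≠ 0 := by
      intro m hm
      obtain ⟨u, -, hu⟩ := Finset.prod_eq_zero_iff.1 hm
      rw [pow_eq_zero_iff', sub_eq_zero] at hu
      rw [hu.1]
      exact hu.2
    have h2 := hzero _ h0
    have h3 := hzero _ ((mul_eq_zero.1 h1).resolve_right
      (hg0 ⟨z, Metric.ball_subset_closedBall hz⟩))
    omega
  refine ⟨f₀, f₁, ⟨ha₀, ha₁, hne⟩, fun z hz => ?_⟩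
  have hzρ' : z ∈ Metric.ball (0 : ℂ) ρ' := hsub (Metric.ball_subset_closedBall hz)
  by_cases hinf : F z = OnePoint.infty
  · have ha := hF.analyticAt_inv z hzρ' (by rw [hinf]; exact OnePoint.infty_ne_coe _)
    have hφne : ∀ᶠ w in 𝓝[≠] z, φ w ≠ 0 :=
      (meromorphicOrderAt_ne_top_iff_eventually_ne_zero (hmer z hzρ')).1 (hord z hzρ')
    have h1 : f₀ =ᶠ[𝓝[≠] z] fun w => sphereCoordInv (F w) * f₁ w := by
      filter_upwards [hφne, hpunct z hz] with w hw hw'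
      have e : φ w = (sphereCoordInv (F w))⁻¹ := sphereCoord_eq_inv _
      rw [e] at hw hw'
      rw [← hw']
      have : sphereCoordInv (F w) ≠ 0 := by simpa using hw
      field_simp
    have h2 := ((ha₀ z hz).continuousAt.eventuallyEq_nhds_iff_eventuallyEq_nhdsNE
      (ha.continuousAt.mul (ha₁ z hz).continuousAt)).1 h1
    have h3 := h2.self_of_nhds
    have h4 : sphereCoordInv (F z) = 0 := by rw [hinf]; simp [sphereCoordInv]
    simp only [h4, Pi.mul_apply, zero_mul] at h3
    rw [hinf, ratioPoint, if_pos h3]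
  · have ha := hF.analyticAt z hzρ' hinf
    have h2 := (((ha₀ z hz).continuousAt.mul
      ha.continuousAt).eventuallyEq_nhds_iff_eventuallyEq_nhdsNE (ha₁ z hz).continuousAt).1
      (hpunct z hz)
    have h3 : f₀ z * φ z = f₁ z := h2.self_of_nhds
    have h0 : f₀ z ≠ 0 := by
      intro h0
      rw [h0, zero_mul] at h3
      rcases hne z hz with h | h
      · exact h h0
      · exact h h3.symm
    rw [ratioPoint, if_neg h0, ← h3, mul_div_cancel_left₀ _ h0]
    have := ratioPoint_one_sphereCoord hinf
    rw [ratioPoint, if_neg one_ne_zero, div_one] at this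
    exact this.symm

theorem isSphereMap {I : Set ℝ} (hI : IsRadii I) (hF : ∀ ρ ∈ I, IsHolomorphicToSphere F (Metric.ball 0 ρ))
    (hK : ∃ ρ ∈ I, ∃ z ∈ Metric.ball (0 : ℂ) ρ, sphereDensity F z ≠ 0) {q : ℕ}
    (a : Fin q → OnePoint ℂ) :
    IsSphereMap I (fun j => sphereForm (a j)) (sphereDensity F)
      fun j z => sphereChordalSq (sphereForm (a j)) (F z) where
  unit j := sphereForm_unit _
  exists_pair ρ hρ := by
    obtain ⟨ρ₁, hρ₁, z₁, hz₁, hK₁⟩ := hK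
    obtain ⟨ρ₂, hρ₂, hlt⟩ := hI.up ρ hρ
    have hmax : max ρ₁ ρ₂ ∈ I := by
      rcases max_choice ρ₁ ρ₂ with h | h <;> rw [h] <;> assumption
    obtain ⟨f₀, f₁, hp, heq⟩ := (hF _ hmax).exists_isReducedPair
      (hlt.trans_le (le_max_right _ _)) ⟨z₁, Metric.ball_subset_ball (le_max_left _ _) hz₁, hK₁⟩
    refine ⟨f₀, f₁, hp, fun z hz => ?_, fun j z hz => ?_⟩
    · refine sphereDensity_eq_fsDensity (hp.analytic_fst z hz) (hp.analytic_snd z hz)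
        (hp.ne_zero z hz) ?_
      filter_upwards [Metric.isOpen_ball.mem_nhds hz] with w hw using heq w hw
    · simp only
      rw [heq z hz, sphereChordalSq_ratioPoint _ (hp.ne_zero z hz)]
      simp [chordalSq, linForm, weightedNormSq]

end IsHolomorphicToSphere

/-! ### Nevanlinna's functions in the coordinate `x̂` -/

theorem weightedNormSq_one_one (g₀ g₁ : ℂ → ℂ) :
    weightedNormSq g₀ g₁ 1 1 = fun z => ‖g₀ z‖ ^ 2 + ‖g₁ z‖ ^ 2 := by
  funext z; simp [weightedNormSq]

theorem MDifferentiableAt.differentiableAt_chart {S : Type*} [TopologicalSpace S]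
    [ChartedSpace ℂ S] {k : S → ℂ} {x : S} (h : MDifferentiableAt 𝓘(ℂ, ℂ) 𝓘(ℂ, ℂ) k x) :
    DifferentiableAt ℂ (fun z => k ((chartAt ℂ x).symm z)) (chartAt ℂ x x) := by
  have := (mdifferentiableAt_iff _ _).1 h
  simpa [writtenInExtChartAt, Function.comp_def, differentiableWithinAt_univ, chartAt_self_eq]
    using this.2

namespace HolomorphicForm

variable {S : Type*} [TopologicalSpace S] [ChartedSpace ℂ S] {Φ : HolomorphicForm S} {o : S}
  {e : OpenPartialHomeomorph S ℂ} {r : ℝ}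

/-- The inverse of the function `x ↦ x̂`. -/
noncomputable def hatInv (Φ : HolomorphicForm S) (o : S) : ℂ → S :=
  haveI : Nonempty S := ⟨o⟩
  Function.invFun (Φ.hat o)

theorem IsSurfaceForm.normAt_eq (h : Φ.IsSurfaceForm o) (g : HermitianMetric S)
    (he : e ∈ atlas ℂ S) {z : ℂ} (hz : z ∈ e.target) :
    Φ.normAt g (e.symm z) = ‖Φ.coeff e z‖ / Real.sqrt (g.coeff e z) := by
  set x := e.symm z with hx
  have hs := mem_chart_source ℂ x
  have h1 := Φ.compat e he _ (chart_mem_atlas ℂ x) x ⟨e.map_target hz, hs⟩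
  have h2 := g.compat e he _ (chart_mem_atlas ℂ x) x ⟨e.map_target hz, hs⟩
  have hD := h.coeff_ne_zero he hz
  rw [hx, e.right_inv hz, ← hx] at h1 h2
  set D := deriv (fun w => chartAt ℂ x (e.symm w)) z
  have hD0 : ‖D‖ ≠ 0 := by
    intro h0
    rw [norm_eq_zero.1 h0, mul_zero] at h1
    exact hD h1
  rw [normAt, coeffAt, h1, h2, norm_mul, Real.sqrt_mul' _ (by positivity),
    Real.sqrt_sq (norm_nonneg _), mul_div_mul_right _ _ hD0]

theorem IsSurfaceForm.normAt_pos (h : Φ.IsSurfaceForm o) (g : HermitianMetric S) (x : S) :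
    0 < Φ.normAt g x :=
  div_pos (norm_pos_iff.2 (h.ne_zero x)) (Real.sqrt_pos.2
    (g.pos _ (chart_mem_atlas ℂ x) _ ((chartAt ℂ x).map_source (mem_chart_source ℂ x))))

/-- The logarithm of the coefficient of the metric in the coordinate `x̂`. -/
noncomputable def logMetric (Φ : HolomorphicForm S) (o : S) (g : HermitianMetric S) (w : ℂ) : ℝ :=
  -2 * Real.log (Φ.normAt g (Φ.hatInv o w))

variable [IsManifold 𝓘(ℂ, ℂ) ω S]

namespace IsExhausted

theorem hat_hatInv (h : Φ.IsExhausted o) (hr : r ∈ Φ.radii o) {w : ℂ}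
    (hw : w ∈ Metric.ball (0 : ℂ) r) : Φ.hat o (Φ.hatInv o w) = w := by
  have : Nonempty S := ⟨o⟩
  exact Function.invFun_eq (h.ball_subset_range_hat hr hw)

variable [T2Space S]

theorem hatInv_hat (h : Φ.IsExhausted o) (hne : (Φ.radii o).Nonempty) (x : S) :
    Φ.hatInv o (Φ.hat o x) = x := by
  have : Nonempty S := ⟨o⟩
  exact Function.leftInverse_invFun (h.injective_hat hne) x

theorem continuousAt_hatInv (h : Φ.IsExhausted o) (hr : r ∈ Φ.radii o) {w : ℂ}
    (hw : w ∈ Metric.ball (0 : ℂ) r) : ContinuousAt (Φ.hatInv o) w := by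
  have h1 := h.map_nhds_hat (Φ.hatInv o w)
  rw [h.hat_hatInv hr hw] at h1
  rw [ContinuousAt, ← h1, tendsto_map'_iff]
  exact tendsto_id.congr fun x => (h.hatInv_hat ⟨r, hr⟩ x).symm

theorem analyticAt_chart_hatInv (h : Φ.IsExhausted o) (hr : r ∈ Φ.radii o) (he : e ∈ atlas ℂ S)
    {w : ℂ} (hw : w ∈ Metric.ball (0 : ℂ) r) (hwe : Φ.hatInv o w ∈ e.source) :
    AnalyticAt ℂ (fun w => e (Φ.hatInv o w)) w := by
  have hev : ∀ w ∈ Metric.ball (0 : ℂ) r, Φ.hatInv o w ∈ e.source →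
      ∀ᶠ v in 𝓝 w, v ∈ Metric.ball (0 : ℂ) r ∧ Φ.hatInv o v ∈ e.source := fun w hw hwe =>
    (Metric.isOpen_ball.eventually_mem hw).and
      ((h.continuousAt_hatInv hr hw).eventually (e.open_source.mem_nhds hwe))
  have hd : ∀ w ∈ Metric.ball (0 : ℂ) r, Φ.hatInv o w ∈ e.source →
      DifferentiableAt ℂ (fun w => e (Φ.hatInv o w)) w := by
    intro w hw hwe
    have hz := e.map_source hwe
    refine (HasDerivAt.of_local_left_inverse (f := fun z => Φ.hat o (e.symm z))
      (ContinuousAt.comp (f := Φ.hatInv o) (e.continuousAt hwe) (h.continuousAt_hatInv hr hw))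
      (h.hasDerivAt_hat he hz) (h.coeff_ne_zero he hz) ?_).differentiableAt
    filter_upwards [hev w hw hwe] with v hv
    change Φ.hat o (e.symm (e (Φ.hatInv o v))) = v
    rw [e.left_inv hv.2, h.hat_hatInv hr hv.1]
  rw [Complex.analyticAt_iff_eventually_differentiableAt]
  filter_upwards [hev w hw hwe] with v hv using hd v hv.1 hv.2

theorem differentiableAt_comp_hatInv (h : Φ.IsExhausted o) (hr : r ∈ Φ.radii o) {k : S → ℂ}
    {w : ℂ} (hw : w ∈ Metric.ball (0 : ℂ) r)
    (hk : MDifferentiableAt 𝓘(ℂ, ℂ) 𝓘(ℂ, ℂ) k (Φ.hatInv o w)) :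
    DifferentiableAt ℂ (fun w => k (Φ.hatInv o w)) w := by
  set e := chartAt ℂ (Φ.hatInv o w)
  have hwe : Φ.hatInv o w ∈ e.source := mem_chart_source ℂ _
  have h1 := hk.differentiableAt_chart.comp w
    (h.analyticAt_chart_hatInv hr (chart_mem_atlas ℂ _) hw hwe).differentiableAt
  refine h1.congr_of_eventuallyEq ?_
  filter_upwards [(h.continuousAt_hatInv hr hw).eventually (e.open_source.mem_nhds hwe)] with v hv
  simp only [Function.comp_apply]
  rw [e.left_inv hv]

theorem isHolomorphicToSphere (h : Φ.IsExhausted o) (hr : r ∈ Φ.radii o) {f : S → OnePoint ℂ}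
    (hf : IsMeromorphicMap f) :
    IsHolomorphicToSphere (fun w => f (Φ.hatInv o w)) (Metric.ball 0 r) := by
  have hc : ∀ w ∈ Metric.ball (0 : ℂ) r, ContinuousAt (fun w => f (Φ.hatInv o w)) w := fun w hw =>
    hf.continuous.continuousAt.comp (h.continuousAt_hatInv hr hw)
  refine ⟨hc, fun w hw hne => ?_, fun w hw hne => ?_⟩
  · rw [Complex.analyticAt_iff_eventually_differentiableAt]
    filter_upwards [(hc w hw).eventually_ne hne, Metric.isOpen_ball.mem_nhds hw] with v hv hvr
    exact h.differentiableAt_comp_hatInv hr (k := fun y => sphereCoord (f y)) hvr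
      (hf.holomorphic _ hv)
  · rw [Complex.analyticAt_iff_eventually_differentiableAt]
    filter_upwards [(hc w hw).eventually_ne hne, Metric.isOpen_ball.mem_nhds hw] with v hv hvr
    exact h.differentiableAt_comp_hatInv hr (k := fun y => sphereCoordInv (f y)) hvr
      (hf.holomorphic_inv _ hv)

theorem exists_sphereDensity_ne_zero [PreconnectedSpace S] (h : Φ.IsExhausted o)
    (hne : (Φ.radii o).Nonempty) {f : S → OnePoint ℂ} (hf : IsMeromorphicMap f)
    (hf_nonconst : ¬ ∃ b, ∀ x, f x = b) :
    ∃ ρ ∈ Φ.radii o, ∃ z ∈ Metric.ball (0 : ℂ) ρ,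
      sphereDensity (fun w => f (Φ.hatInv o w)) z ≠ 0 := by
  by_contra! hall
  have hloc : IsLocallyConstant f := by
    rw [IsLocallyConstant.iff_eventually_eq]
    intro x
    obtain ⟨r, hr, hlt⟩ := h.norm_hat_mem hne x
    have hx : Φ.hat o x ∈ Metric.ball (0 : ℂ) r := by simpa using hlt
    have h1 := (h.isHolomorphicToSphere hr hf).eventually_const_of_sphereDensity_eq_zero
      Metric.isOpen_ball (hall r hr) hx
    have h2 := h.continuous_hat.continuousAt.eventually h1
    simpa only [h.hatInv_hat hne] using h2
  exact hf_nonconst ⟨f o, fun x => hloc.apply_eq_of_preconnectedSpace x o⟩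

theorem fubiniStudyPullback_eq (h : Φ.IsExhausted o) (hne : (Φ.radii o).Nonempty)
    {f : S → OnePoint ℂ} (hf : IsMeromorphicMap f) (he : e ∈ atlas ℂ S) {z : ℂ}
    (hz : z ∈ e.target) :
    fubiniStudyPullback f e z = ‖Φ.coeff e z‖ ^ 2 *
      (Real.pi⁻¹ * sphereDensity (fun w => f (Φ.hatInv o w)) (Φ.hat o (e.symm z))) := by
  set F : ℂ → OnePoint ℂ := fun w => f (Φ.hatInv o w) with hF
  have hfF : ∀ u, f (e.symm u) = F (Φ.hat o (e.symm u)) := fun u => by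
    simp only [hF, h.hatInv_hat hne]
  obtain ⟨r, hr, hlt⟩ := h.norm_hat_mem hne (e.symm z)
  have hw : Φ.hat o (e.symm z) ∈ Metric.ball (0 : ℂ) r := by simpa using hlt
  have hol := h.isHolomorphicToSphere hr hf
  have ha := h.analyticAt_hat he hz
  have hda := (h.hasDerivAt_hat he hz).deriv
  have hcomp : ∀ U : ℂ → ℝ, ContDiffAt ℝ 2 U (Φ.hat o (e.symm z)) →
      ddc (fun u => U (Φ.hat o (e.symm u))) z =
        ‖Φ.coeff e z‖ ^ 2 * (Real.pi⁻¹ * (Real.pi * ddc U (Φ.hat o (e.symm z)))) := by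
    intro U hU
    simp only [ddc]
    rw [laplacian_comp_analyticAt ha hU, hda]
    field_simp
  by_cases hinf : F (Φ.hat o (e.symm z)) = OnePoint.infty
  · have hA := hol.analyticAt_inv _ hw fun hcon => OnePoint.infty_ne_coe _ (hinf.symm.trans hcon)
    have e1 : fubiniStudyPullback f e z =
        ddc (fun u => Real.log (‖sphereCoordInv (F (Φ.hat o (e.symm u)))‖ ^ 2 + 1)) z := by
      simp only [← hfF]
      exact if_neg (not_not.2 (by rw [hfF]; exact hinf))
    have e2 : sphereDensity F (Φ.hat o (e.symm z)) = Real.pi *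
        ddc (fun w => Real.log (‖sphereCoordInv (F w)‖ ^ 2 + 1)) (Φ.hat o (e.symm z)) :=
      congrArg (Real.pi * ·) (if_neg (not_not.2 hinf))
    rw [e1, e2, hcomp fun w => Real.log (‖sphereCoordInv (F w)‖ ^ 2 + 1)]
    have := contDiffAt_weightedNormSq (α := 1) (β := 1) hA (analyticAt_const (v := 1)) (n := 2)
    simp only [weightedNormSq_one_one, norm_one, one_pow] at this
    exact this.log (by positivity)
  · have hA := hol.analyticAt _ hw hinf
    have e1 : fubiniStudyPullback f e z =
        ddc (fun u => Real.log (1 + ‖sphereCoord (F (Φ.hat o (e.symm u)))‖ ^ 2)) z := by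
      simp only [← hfF]
      exact if_pos (by rw [hfF]; exact hinf)
    have e2 : sphereDensity F (Φ.hat o (e.symm z)) = Real.pi *
        ddc (fun w => Real.log (1 + ‖sphereCoord (F w)‖ ^ 2)) (Φ.hat o (e.symm z)) :=
      congrArg (Real.pi * ·) (if_pos hinf)
    rw [e1, e2, hcomp fun w => Real.log (1 + ‖sphereCoord (F w)‖ ^ 2)]
    have := contDiffAt_weightedNormSq (α := 1) (β := 1) (analyticAt_const (v := 1)) hA (n := 2)
    simp only [weightedNormSq_one_one, norm_one, one_pow] at this
    exact this.log (by positivity)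

theorem characteristic_fubiniStudyPullback [PreconnectedSpace S] (h : Φ.IsExhausted o)
    {f : S → OnePoint ℂ} (hf : IsMeromorphicMap f)
    (hf_nonconst : ¬ ∃ b, ∀ x, f x = b) {r₀ : ℝ} (hr₀ : r₀ ∈ Φ.radii o) (hr : r ∈ Φ.radii o)
    (hle : r₀ ≤ r) : Φ.characteristic o r₀ (fubiniStudyPullback f) r =
      2 * greenAverage (sphereDensity fun w => f (Φ.hatInv o w)) r₀ r := by
  have hne : (Φ.radii o).Nonempty := ⟨r, hr⟩
  set F : ℂ → OnePoint ℂ := fun w => f (Φ.hatInv o w) with hF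
  obtain ⟨ρ, hρ, hlt⟩ := isRadii_radii.up r hr
  -- Only the continuity of the density is needed here, so the family of values is taken to be
  -- empty.
  have hsm := IsHolomorphicToSphere.isSphereMap isRadii_radii
    (fun ρ hρ => h.isHolomorphicToSphere hρ hf) (h.exists_sphereDensity_ne_zero hne hf hf_nonconst)
    (q := 0) Fin.elim0
  have hc := hsm.continuousOn_density hρ
  rw [characteristic, greenAverage, ← intervalIntegral.integral_const_mul]
  refine intervalIntegral.integral_congr fun t ht => ?_
  rw [uIcc_of_le hle] at ht
  have ht0 : 0 < t := (isRadii_radii.pos _ hr₀).trans_le ht.1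
  have htr : t ∈ Φ.radii o := isRadii_radii.down r hr t ht0 ht.2
  have htρ : t < ρ := ht.2.trans_lt hlt
  rw [h.formIntegral_disc htr (H := fun w => Real.pi⁻¹ * sphereDensity F w)
    (fun e he z hz _ => h.fubiniStudyPullback_eq hne hf he hz)]
  · rw [integral_const_mul, setIntegral_ball_eq_integral_circleAverage hc ht0.le htρ]
    field_simp
    rfl
  · exact ((continuousOn_const.mul (hc.mono (Metric.closedBall_subset_ball htρ))).integrableOn_compact
      (isCompact_closedBall 0 t)).mono_set Metric.ball_subset_closedBall

theorem logMetric_eq (h : Φ.IsExhausted o) (hne : (Φ.radii o).Nonempty) (g : HermitianMetric S)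
    (he : e ∈ atlas ℂ S) {z : ℂ} (hz : z ∈ e.target) :
    Φ.logMetric o g (Φ.hat o (e.symm z)) =
      Real.log (g.coeff e z) - 2 * Real.log ‖Φ.coeff e z‖ := by
  have hg := g.pos e he z hz
  rw [logMetric, h.hatInv_hat hne, h.normAt_eq g he hz,
    Real.log_div (norm_ne_zero_iff.2 (h.coeff_ne_zero he hz)) (Real.sqrt_pos.2 hg).ne',
    Real.log_sqrt hg.le]
  ring

theorem contDiffAt_logMetric (h : Φ.IsExhausted o) (g : HermitianMetric S) (hr : r ∈ Φ.radii o)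
    {w : ℂ} (hw : w ∈ Metric.ball (0 : ℂ) r) : ContDiffAt ℝ 2 (Φ.logMetric o g) w := by
  set e := chartAt ℂ (Φ.hatInv o w)
  have he : e ∈ atlas ℂ S := chart_mem_atlas ℂ _
  have hwe : Φ.hatInv o w ∈ e.source := mem_chart_source ℂ _
  have hk := h.analyticAt_chart_hatInv hr he hw hwe
  have hz := e.map_source hwe
  have hcoeff : AnalyticAt ℂ (Φ.coeff e) (e (Φ.hatInv o w)) :=
    (Φ.holomorphic e he).analyticAt (e.open_target.mem_nhds hz)
  have h1 : ContDiffAt ℝ 2 (fun z => Real.log (g.coeff e z)) (e (Φ.hatInv o w)) :=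
    (((g.smooth e he).contDiffAt (e.open_target.mem_nhds hz)).of_le (WithTop.coe_le_coe.2 le_top : ((2 : ℕ∞) : WithTop ℕ∞) ≤ ∞)).log
      (g.pos e he _ hz).ne'
  have h2 : ContDiffAt ℝ 2 (fun z => Real.log ‖Φ.coeff e z‖) (e (Φ.hatInv o w)) :=
    (hcoeff.harmonicAt_log_norm (h.coeff_ne_zero he hz)).1
  have h3 : ContDiffAt ℝ 2 (fun z => Real.log (g.coeff e z) - 2 * Real.log ‖Φ.coeff e z‖)
      (e (Φ.hatInv o w)) := h1.sub (contDiffAt_const.mul h2)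
  refine (ContDiffAt.comp w h3 (hk.contDiffAt.restrict_scalars ℝ)).congr_of_eventuallyEq ?_
  filter_upwards [(h.continuousAt_hatInv hr hw).eventually (e.open_source.mem_nhds hwe),
    Metric.isOpen_ball.mem_nhds hw] with v hv hvr
  have := h.logMetric_eq ⟨r, hr⟩ g he (e.map_source hv)
  rw [e.left_inv hv, h.hat_hatInv hr hvr] at this
  exact this

/-- In a chart `log h` is the logarithmic metric in the coordinate `x̂` plus `2 log |φ|`, and the
latter is harmonic since `φ` has no zeros. -/
theorem ricciForm_eq (h : Φ.IsExhausted o) (hne : (Φ.radii o).Nonempty) (g : HermitianMetric S)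
    (he : e ∈ atlas ℂ S) {z : ℂ} (hz : z ∈ e.target) :
    g.ricciForm e z = ‖Φ.coeff e z‖ ^ 2 * (-(4 * Real.pi)⁻¹ *
      Laplacian.laplacian (Φ.logMetric o g) (Φ.hat o (e.symm z))) := by
  obtain ⟨r, hr, hlt⟩ := h.norm_hat_mem hne (e.symm z)
  have hw : Φ.hat o (e.symm z) ∈ Metric.ball (0 : ℂ) r := by simpa using hlt
  have ha := h.analyticAt_hat he hz
  have hlm := h.contDiffAt_logMetric g hr hw
  have hcoeff : AnalyticAt ℂ (Φ.coeff e) z :=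
    (Φ.holomorphic e he).analyticAt (e.open_target.mem_nhds hz)
  have hh := hcoeff.harmonicAt_log_norm (h.coeff_ne_zero he hz)
  have hev : (fun u => Real.log (g.coeff e u)) =ᶠ[𝓝 z]
      (fun u => Φ.logMetric o g (Φ.hat o (e.symm u))) + (2 : ℝ) • fun u => Real.log ‖Φ.coeff e u‖ := by
    filter_upwards [e.open_target.mem_nhds hz] with u hu
    simp only [Pi.add_apply, Pi.smul_apply, smul_eq_mul]
    rw [h.logMetric_eq hne g he hu]
    ring
  have hc : ContDiffAt ℝ 2 (fun u => Φ.logMetric o g (Φ.hat o (e.symm u))) z :=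
    ContDiffAt.comp (g := Φ.logMetric o g) (f := fun u => Φ.hat o (e.symm u)) z hlm (ha.contDiffAt.restrict_scalars ℝ)
  have hc2 : ContDiffAt ℝ 2 ((2 : ℝ) • fun u => Real.log ‖Φ.coeff e u‖) z := hh.1.const_smul (2 : ℝ)
  rw [HermitianMetric.ricciForm, ddc, (InnerProductSpace.laplacian_congr_nhds hev).self_of_nhds,
    hc.laplacian_add hc2, InnerProductSpace.laplacian_smul 2 hh.1,
    hh.2.self_of_nhds, laplacian_comp_analyticAt ha hlm, (h.hasDerivAt_hat he hz).deriv]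
  simp
  ring

theorem characteristic_ricciForm (h : Φ.IsExhausted o) (g : HermitianMetric S) {r₀ : ℝ}
    (hr₀ : r₀ ∈ Φ.radii o) (hr : r ∈ Φ.radii o) (hle : r₀ ≤ r) :
    Φ.characteristic o r₀ g.ricciForm r = (Real.circleAverage (Φ.logMetric o g) 0 r₀
      - Real.circleAverage (Φ.logMetric o g) 0 r) / 2 := by
  have hne : (Φ.radii o).Nonempty := ⟨r, hr⟩
  obtain ⟨ρ, hρ, hlt⟩ := isRadii_radii.up r hr
  have hcd : ContDiffOn ℝ 2 (Φ.logMetric o g) (Metric.ball 0 ρ) := fun w hw =>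
    (h.contDiffAt_logMetric g hρ hw).contDiffWithinAt
  have hc := continuousOn_laplacian Metric.isOpen_ball hcd
  have hG := circleAverage_sub_circleAverage_eq hcd (isRadii_radii.pos _ hr₀) hle hlt
  have e1 : (Real.circleAverage (Φ.logMetric o g) 0 r₀
      - Real.circleAverage (Φ.logMetric o g) 0 r) / 2 = (-1 / 2) * (∫ t in r₀..r,
        (∫ τ in (0 : ℝ)..t, τ * Real.circleAverage (Laplacian.laplacian (Φ.logMetric o g)) 0 τ) / t) := by
    rw [← hG]; ring
  rw [e1, characteristic, ← intervalIntegral.integral_const_mul]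
  refine intervalIntegral.integral_congr fun t ht => ?_
  rw [uIcc_of_le hle] at ht
  have ht0 : 0 < t := (isRadii_radii.pos _ hr₀).trans_le ht.1
  have htr : t ∈ Φ.radii o := isRadii_radii.down r hr t ht0 ht.2
  have htρ : t < ρ := ht.2.trans_lt hlt
  rw [h.formIntegral_disc htr
    (H := fun w => -(4 * Real.pi)⁻¹ * Laplacian.laplacian (Φ.logMetric o g) w)
    (fun e he z hz _ => h.ricciForm_eq hne g he hz)]
  · rw [integral_const_mul, setIntegral_ball_eq_integral_circleAverage hc ht0.le htρ]
    field_simp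
    ring
  · exact ((continuousOn_const.mul (hc.mono (Metric.closedBall_subset_ball htρ))).integrableOn_compact
      (isCompact_closedBall 0 t)).mono_set Metric.ball_subset_closedBall

theorem continuousOn_normAt_hatInv (h : Φ.IsExhausted o) (g : HermitianMetric S)
    (hr : r ∈ Φ.radii o) :
    ContinuousOn (fun w => Φ.normAt g (Φ.hatInv o w)) (Metric.ball 0 r) := by
  intro w hw
  have h1 := (h.contDiffAt_logMetric g hr hw).continuousAt
  have h2 : ContinuousAt (fun w => Real.exp (-(1 / 2) * Φ.logMetric o g w)) w :=
    Real.continuous_exp.continuousAt.comp (continuousAt_const.mul h1)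
  refine (h2.congr (Eventually.of_forall fun v => ?_)).continuousWithinAt
  simp only [logMetric]
  rw [← mul_assoc, show -(1 / 2 : ℝ) * -2 = 1 by norm_num, one_mul,
    Real.exp_log (h.normAt_pos g _)]

theorem bddAbove_normAt (h : Φ.IsExhausted o) (g : HermitianMetric S) (hr : r ∈ Φ.radii o) :
    BddAbove (Φ.normAt g '' Φ.disc o r) := by
  obtain ⟨ρ, hρ, hlt⟩ := isRadii_radii.up r hr
  have hb := (isCompact_closedBall (0 : ℂ) r).bddAbove_image
    ((h.continuousOn_normAt_hatInv g hρ).mono (Metric.closedBall_subset_ball hlt))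
  refine hb.mono ?_
  rintro _ ⟨x, hx, rfl⟩
  have hx' : ‖Φ.hat o x‖ < r := hx
  exact ⟨Φ.hat o x, by simpa using hx'.le, by simp only [h.hatInv_hat ⟨r, hr⟩]⟩

/-- The supremum is taken over the open disc but is needed on the bounding circle, to which it
extends by continuity. -/
theorem normAt_le_supNorm (h : Φ.IsExhausted o) (g : HermitianMetric S) (hr : r ∈ Φ.radii o)
    {w : ℂ} (hw : ‖w‖ ≤ r) : Φ.normAt g (Φ.hatInv o w) ≤ Φ.supNorm o g r := by
  obtain ⟨ρ, hρ, hlt⟩ := isRadii_radii.up r hr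
  have hr0 := isRadii_radii.pos _ hr
  have hball : ∀ v ∈ Metric.ball (0 : ℂ) r, Φ.normAt g (Φ.hatInv o v) ≤ Φ.supNorm o g r := by
    intro v hv
    refine le_csSup (h.bddAbove_normAt g hr) ⟨Φ.hatInv o v, ?_, rfl⟩
    show ‖Φ.hat o (Φ.hatInv o v)‖ < r
    rw [h.hat_hatInv hr hv]
    simpa using hv
  have hcl : w ∈ closure (Metric.ball (0 : ℂ) r) := by
    rw [closure_ball _ hr0.ne']
    simpa using hw
  have hc := ((h.continuousOn_normAt_hatInv g hρ).mono
    (Metric.closedBall_subset_ball hlt) : ContinuousOn _ (Metric.closedBall (0 : ℂ) r))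
  rw [← closure_ball _ hr0.ne'] at hc
  exact ((hc w hcl).mono subset_closure).closure_le hcl continuousWithinAt_const hball

theorem supNorm_pos (h : Φ.IsExhausted o) (g : HermitianMetric S) (hr : r ∈ Φ.radii o) :
    0 < Φ.supNorm o g r :=
  (h.normAt_pos g _).trans_le (h.normAt_le_supNorm g hr (w := 0)
    (by simpa using (isRadii_radii.pos _ hr).le))

theorem supNorm_mono (h : Φ.IsExhausted o) (g : HermitianMetric S) (hr : r ∈ Φ.radii o) {r₀ : ℝ}
    (h0 : 0 < r₀) (hle : r₀ ≤ r) : Φ.supNorm o g r₀ ≤ Φ.supNorm o g r := by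
  refine csSup_le_csSup (h.bddAbove_normAt g hr) ⟨_, o, ?_, rfl⟩
    (image_mono fun x (hx : ‖Φ.hat o x‖ < r₀) => hx.trans_le hle)
  show ‖Φ.hat o o‖ < r₀
  rw [(h.hat_eq_zero_iff o).2 rfl]
  simpa using h0

/-- By Green–Jensen the Ricci characteristic is half the drop of the mean of `-2 log ‖𝒮‖_h`, and on
the circle of radius `r` this function is at least `-2 log ‖𝒮‖_{r,sup}`. -/
theorem characteristic_ricciForm_le (h : Φ.IsExhausted o) (g : HermitianMetric S) {r₀ : ℝ}
    (hr₀ : r₀ ∈ Φ.radii o) (hr : r ∈ Φ.radii o) (hle : r₀ ≤ r) :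
    Φ.characteristic o r₀ g.ricciForm r ≤
      Real.log (Φ.supNorm o g r) + Real.circleAverage (Φ.logMetric o g) 0 r₀ / 2 := by
  rw [h.characteristic_ricciForm g hr₀ hr hle]
  obtain ⟨ρ, hρ, hlt⟩ := isRadii_radii.up r hr
  have hr0 := isRadii_radii.pos _ hr
  have hcont : ContinuousOn (Φ.logMetric o g) (Metric.ball 0 ρ) := fun w hw =>
    (h.contDiffAt_logMetric g hρ hw).continuousAt.continuousWithinAt
  have hle2 : -2 * Real.log (Φ.supNorm o g r) ≤ Real.circleAverage (Φ.logMetric o g) 0 r := by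
    rw [← Real.circleAverage_const (-2 * Real.log (Φ.supNorm o g r)) (0 : ℂ) r]
    refine Real.circleAverage_mono (circleIntegrable_const _ _ _)
      (circleIntegrable_of_continuousOn_ball hcont hr0.le hlt) fun w hw => ?_
    rw [abs_of_pos hr0] at hw
    have := Real.log_le_log (h.normAt_pos g _) (h.normAt_le_supNorm g hr (w := w) (by
      simpa using (Metric.sphere_subset_closedBall hw)))
    simp only [logMetric]
    linarith
  linarith

theorem simpleCounting_eq (h : Φ.IsExhausted o) (f : S → OnePoint ℂ) (a : OnePoint ℂ) {r₀ : ℝ}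
    (hr₀ : r₀ ∈ Φ.radii o) (hr : r ∈ Φ.radii o) (hle : r₀ ≤ r) :
    Φ.simpleCounting o r₀ f a r = ∫ t in r₀..r,
      ({u : ℂ | ‖u‖ < t ∧ sphereChordalSq (sphereForm a) (f (Φ.hatInv o u)) = 0}.ncard : ℝ) / t := by
  have hne : (Φ.radii o).Nonempty := ⟨r, hr⟩
  refine intervalIntegral.integral_congr fun t ht => ?_
  rw [uIcc_of_le hle] at ht
  have ht0 : 0 < t := (isRadii_radii.pos _ hr₀).trans_le ht.1
  have htr : t ∈ Φ.radii o := isRadii_radii.down r hr t ht0 ht.2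
  have himg : Φ.hat o '' (Φ.disc o t ∩ f ⁻¹' {a}) =
      {u : ℂ | ‖u‖ < t ∧ sphereChordalSq (sphereForm a) (f (Φ.hatInv o u)) = 0} := by
    ext u
    simp only [sphereChordalSq_sphereForm_eq_zero_iff]
    constructor
    · rintro ⟨x, ⟨hx, hfx⟩, rfl⟩
      exact ⟨hx, by rw [h.hatInv_hat hne]; exact hfx⟩
    · rintro ⟨hu, hfu⟩
      have hhu := h.hat_hatInv htr (w := u) (by simpa using hu)
      exact ⟨Φ.hatInv o u, ⟨show ‖Φ.hat o (Φ.hatInv o u)‖ < t by rwa [hhu], hfu⟩, hhu⟩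
  rw [← himg, ncard_image_of_injective _ (h.injective_hat hne)]

end IsExhausted

end HolomorphicForm

/-! ### Absorption of the constants, and the conclusion -/

/-- On this set `log r < M / δ`, so it is bounded; and `log⁺ γ < M - δ log r₁`, so `γ` is bounded on
it. Off this set the error term itself exceeds any prescribed constant `M`. -/
theorem lintegral_posLog_add_log_lt {I : Set ℝ} {γ : ℝ → ℝ} {r₁ δ M : ℝ} (hr₁ : 0 < r₁)
    (hδ : 0 < δ) :
    ∫⁻ r in {r ∈ I | r₁ < r ∧ Real.posLog (γ r) + δ * Real.log r < M}, ENNReal.ofReal (γ r) < ⊤ := by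
  set B := {r ∈ I | r₁ < r ∧ Real.posLog (γ r) + δ * Real.log r < M} with hB
  have hsub : B ⊆ Ioo r₁ (Real.exp (M / δ)) := by
    rintro r ⟨-, h1, h2⟩
    refine ⟨h1, ?_⟩
    rw [← Real.log_lt_iff_lt_exp (hr₁.trans h1), lt_div_iff₀ hδ]
    linarith [Real.posLog_nonneg (x := γ r)]
  have hle : ∀ r ∈ B, ENNReal.ofReal (γ r) ≤ ENNReal.ofReal (Real.exp (M - δ * Real.log r₁)) := by
    rintro r ⟨-, h1, h2⟩
    refine ENNReal.ofReal_le_ofReal ?_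
    rcases le_or_gt (γ r) 0 with h0 | h0
    · exact h0.trans (Real.exp_pos _).le
    · rw [← Real.log_le_iff_le_exp h0]
      have h3 : Real.log (γ r) ≤ Real.posLog (γ r) := le_max_right _ _
      have h4 := mul_le_mul_of_nonneg_left (Real.log_le_log hr₁ h1.le) hδ.le
      linarith
  calc ∫⁻ r in B, ENNReal.ofReal (γ r)
      ≤ ∫⁻ _ in B, ENNReal.ofReal (Real.exp (M - δ * Real.log r₁)) :=
        setLIntegral_mono measurable_const hle
    _ = ENNReal.ofReal (Real.exp (M - δ * Real.log r₁)) * volume B := setLIntegral_const _ _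
    _ < ⊤ := ENNReal.mul_lt_top ENNReal.ofReal_lt_top
        ((measure_mono hsub).trans_lt measure_Ioo_lt_top)

/-- A locally integrable weight is measurable off a Borel null set. -/
theorem MeasureTheory.LocallyIntegrableOn.exists_measurable_eq {I : Set ℝ} {γ : ℝ → ℝ} (hI : MeasurableSet I)
    (hγ : LocallyIntegrableOn γ I) :
    ∃ γ' : ℝ → ℝ, Measurable γ' ∧ ∃ N ⊆ I, MeasurableSet N ∧ volume N = 0 ∧
      ∀ r ∈ I, r ∉ N → γ r = γ' r := by
  have hm : AEMeasurable γ (volume.restrict I) := hγ.aestronglyMeasurable.aemeasurable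
  refine ⟨hm.mk γ, hm.measurable_mk, I ∩ toMeasurable volume {r | ¬ (r ∈ I → γ r = hm.mk γ r)},
    inter_subset_left, hI.inter (measurableSet_toMeasurable _ _), ?_, fun r hr hrN => ?_⟩
  · refine measure_mono_null inter_subset_right ?_
    rw [measure_toMeasurable]
    exact (ae_restrict_iff' hI).1 hm.ae_eq_mk
  · by_contra hne
    exact hrN ⟨hr, subset_toMeasurable _ _ fun hc => hne (hc hr)⟩

/-- For `r > r₁` the difference `log (1 + r) - log r` is bounded. The term with `|log r₁|` pays for
replacing `min δ 1` by `δ` when `log r` is negative. -/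
theorem log_growth_le {r₁ r δ : ℝ} (hr₁ : 0 < r₁) (hr : r₁ < r) (hδ : 0 < δ) :
    (1 + min δ 1) * Real.log (1 + r) - Real.log r ≤
      δ * Real.log r + (δ * |Real.log r₁| + 2 * Real.log (1 + r₁⁻¹)) := by
  have hr0 := hr₁.trans hr
  have h1 : Real.log (1 + r) ≤ Real.log r + Real.log (1 + r₁⁻¹) := by
    rw [← Real.log_mul hr0.ne' (by positivity)]
    refine Real.log_le_log (by positivity) ?_
    have : 1 ≤ r * r₁⁻¹ := by
      rw [← div_eq_mul_inv, one_le_div hr₁]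
      exact hr.le
    linarith
  have h2 : 0 ≤ Real.log (1 + r₁⁻¹) := Real.log_nonneg (by simp [hr₁.le])
  have h3 : -|Real.log r₁| ≤ Real.log r := (neg_abs_le _).trans (Real.log_le_log hr₁ hr.le)
  have hm0 : 0 < min δ 1 := lt_min hδ one_pos
  have hm1 : min δ 1 ≤ 1 := min_le_right _ _
  have hm2 : min δ 1 ≤ δ := min_le_left _ _
  have h4 := mul_le_mul_of_nonneg_left h1 (by linarith : (0 : ℝ) ≤ 1 + min δ 1)
  have h5 := mul_le_mul_of_nonneg_right hm1 h2
  have h6 := mul_le_mul_of_nonneg_left h3 (by linarith : 0 ≤ δ - min δ 1)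
  have h7 := mul_nonneg hm0.le (abs_nonneg (Real.log r₁))
  linarith

namespace IsSphereMap

variable {I : Set ℝ} {q : ℕ} {b : Fin q → ℂ × ℂ} {K : ℂ → ℝ} {X : Fin q → ℂ → ℝ} {r₀ r₁ r : ℝ}

theorem integral_ncard_div_le (hI : IsRadii I) (h : IsSphereMap I b K X)
    (hK : ∃ ρ ∈ I, ∃ z ∈ Metric.ball (0 : ℂ) ρ, K z ≠ 0) (h0 : 0 < r₀) (h1 : r₀ ≤ r₁) (h2 : r₁ ≤ r)
    (hr : r ∈ I) (j : Fin q) :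
    ∫ t in r₁..r, ({u : ℂ | ‖u‖ < t ∧ X j u = 0}.ncard : ℝ) / t ≤
      ∫ t in r₀..r, ({u : ℂ | ‖u‖ < t ∧ X j u = 0}.ncard : ℝ) / t := by
  have hfin := (h.exists_finset_zeros hI hK hr).2 j
  refine intervalIntegral.integral_mono_interval h1 h2 le_rfl ?_
    (integral_ncard_div (Z := hfin.toFinset) h0 (h1.trans h2) (by simp)).1
  refine ae_restrict_of_forall_mem measurableSet_Ioc fun t ht => ?_
  exact div_nonneg (Nat.cast_nonneg _) (h0.trans ht.1).le

theorem greenAverage_density_pos (hI : IsRadii I) (h : IsSphereMap I b K X)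
    (hK : ∃ ρ ∈ I, ∃ z ∈ Metric.ball (0 : ℂ) ρ, K z ≠ 0) (h0 : 0 < r₀) (h1 : r₀ < r) (hr : r ∈ I) :
    0 < greenAverage K r₀ r := by
  obtain ⟨ρ, hρ, hlt⟩ := hI.up r hr
  obtain ⟨s, hs, hs0, hs1, hreg⟩ :=
    h.exists_isRegularRadius hI hK h0 le_rfl (hI.down r hr r₀ h0 h1.le)
  have hc := h.continuousOn_density hρ
  exact greenAverage_pos hc (fun z hz => h.density_nonneg hρ hz) hs0 hs1 h1 hlt
    (circleAverage_log_le hs0.le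
      (hc.mono (Metric.sphere_subset_ball (hs1.trans (h1.trans hlt))))
      fun z hz => h.density_pos hI hs hreg hz).1

/-- The second main theorem for a map of a disc, with an additional term `ψ` on the left that is
bounded by the logarithm of the increasing function `P`. -/
theorem exists_second_main_theorem (hI : IsRadii I) (h : IsSphereMap I b K X)
    (hdet : ∀ i j, i ≠ j → formDet (b i) (b j) ≠ 0)
    (hK : ∃ ρ ∈ I, ∃ z ∈ Metric.ball (0 : ℂ) ρ, K z ≠ 0) (hr₀ : r₀ ∈ I)
    {γ : ℝ → ℝ} (hγ : LocallyIntegrableOn γ I) {P ψ : ℝ → ℝ} (hP0 : 0 < P r₀)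
    (hP : ∀ r ∈ I, r₀ ≤ r → P r₀ ≤ P r) {c : ℝ}
    (hψ : ∀ r ∈ I, r₀ ≤ r → ψ r ≤ Real.log (P r) + c) {δ : ℝ} (hδ : 0 < δ) :
    ∃ E : Set ℝ, MeasurableSet E ∧ E ⊆ I ∧ ∫⁻ r in E, ENNReal.ofReal (γ r) < ⊤ ∧
      ∀ r ∈ I, r₀ < r → r ∉ E →
        ((q : ℝ) - 2) * (2 * greenAverage K r₀ r) + ψ r ≤
          ∑ j, (∫ t in r₀..r, ({u : ℂ | ‖u‖ < t ∧ X j u = 0}.ncard : ℝ) / t)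
            + (q + 3) * (Real.log (2 * greenAverage K r₀ r) + Real.log (P r)
              + Real.posLog (γ r) + δ * Real.log r) := by
  have h0 := hI.pos _ hr₀
  obtain ⟨r₂, hr₂, hlt₂⟩ := hI.up r₀ hr₀
  -- The radius `r₀` need not be regular, so the estimate starts at a regular `r₁ > r₀`. Putting
  -- `(r₀, r₁]` into the exceptional set also keeps `log T_f` bounded below by `log m`.
  obtain ⟨r₁, hr₁, h01, -, hreg₁⟩ := h.exists_isRegularRadius hI hK hlt₂ h0.le hr₂
  have hr₁0 := h0.trans h01
  obtain ⟨C, hC⟩ := h.exists_main_estimate hI hdet hK hr₁ hreg₁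
  -- The growth lemma wants a Borel weight; the null set on which `γ` and `γ'` differ joins the
  -- exceptional set.
  obtain ⟨γ', hγ', N, hNI, hNm, hN0, hNe⟩ := hγ.exists_measurable_eq hI.measurableSet
  obtain ⟨E, hEI, hEm, hEfin, hE⟩ := hC γ' hγ' (min δ 1) (lt_min hδ one_pos) (min_le_right _ _)
  set m := 2 * greenAverage K r₀ r₁ with hm
  have hm0 : 0 < m := mul_pos two_pos (h.greenAverage_density_pos hI hK h0 h01 hr₁)
  -- `A` collects all additive constants: the shift of the starting radius, the bound for `ψ`, the
  -- growth of `log (1 + r)`, the comparison of `log (1 + G)` with `log (m + 2 G)`, and the main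
  -- estimate.
  set A : ℝ := (q - 2) * m + c + (δ * |Real.log r₁| + 2 * Real.log (1 + r₁⁻¹)) / 2
    + (q + 2) * Real.log (m⁻¹ + 2⁻¹) + C with hA
  -- The coefficient `q + 3` leaves spare copies of `log T`, `log P` and `δ log r`, which are
  -- bounded below by their values at `r₁` or `r₀`. What remains of `A` is `M`, to be dominated by
  -- one copy of `log⁺ γ + δ log r`.
  set M : ℝ := A - Real.log m - (q + 2) * Real.log (P r₀) - (q + 3 / 2) * (δ * Real.log r₁) with hM
  set B := {r ∈ I | r₁ < r ∧ Real.posLog (γ' r) + δ * Real.log r < M} with hB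
  have hBm : MeasurableSet B := by
    have hmeas : Measurable fun r => Real.posLog (γ' r) + δ * Real.log r :=
      (measurable_const.max (Real.measurable_log.comp hγ')).add (Real.measurable_log.const_mul δ)
    exact hI.measurableSet.inter (measurableSet_Ioi.inter
      (measurableSet_lt hmeas measurable_const : MeasurableSet {r | _ < M}))
  have hIoc : Ioc r₀ r₁ ⊆ I := fun t ht => hI.down _ hr₁ t (h0.trans ht.1) ht.2
  have hγe : ∀ A ⊆ I, MeasurableSet A →
      ∫⁻ r in A, ENNReal.ofReal (γ r) = ∫⁻ r in A, ENNReal.ofReal (γ' r) := by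
    intro A hAI hAm
    refine setLIntegral_congr_fun_ae hAm ?_
    filter_upwards [compl_mem_ae_iff.2 hN0] with r hrN hrA
    rw [hNe r (hAI hrA) hrN]
  have hfin₁ : ∫⁻ r in Ioc r₀ r₁, ENNReal.ofReal (γ r) < ⊤ := by
    have hi : IntegrableOn γ (Icc r₀ r₁) := hγ.integrableOn_compact_subset
      (fun t ht => hI.down _ hr₁ t (h0.trans_le ht.1) ht.2) isCompact_Icc
    exact (hi.mono_set Ioc_subset_Icc_self).lintegral_lt_top
  refine ⟨Ioc r₀ r₁ ∪ (N ∪ (E ∪ B)),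
    measurableSet_Ioc.union (hNm.union (hEm.union hBm)),
    union_subset hIoc (union_subset hNI (union_subset hEI fun r hr => hr.1)), ?_, ?_⟩
  · have hNfin : ∫⁻ r in N, ENNReal.ofReal (γ r) = 0 := setLIntegral_measure_zero _ _ hN0
    have hBfin : ∫⁻ r in B, ENNReal.ofReal (γ r) < ⊤ := by
      rw [hγe B (fun r hr => hr.1) hBm]
      exact lintegral_posLog_add_log_lt hr₁0 hδ
    rw [← hγe E hEI hEm] at hEfin
    refine (lintegral_union_le _ _ _).trans_lt (ENNReal.add_lt_top.2 ⟨hfin₁, ?_⟩)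
    refine (lintegral_union_le _ _ _).trans_lt (ENNReal.add_lt_top.2 ⟨by simp [hNfin], ?_⟩)
    exact (lintegral_union_le _ _ _).trans_lt (ENNReal.add_lt_top.2 ⟨hEfin, hBfin⟩)
  · intro r hr h0r hrE
    simp only [mem_union, not_or] at hrE
    obtain ⟨hrI, hrN, hrE, hrB⟩ := hrE
    have h1r : r₁ < r := by
      by_contra hcon
      exact hrI ⟨h0r, not_lt.1 hcon⟩
    obtain ⟨ρ, hρ, hrρ⟩ := hI.up r hr
    have hadd := greenAverage_add_adjacent (h.continuousOn_density hρ) h0 h01.le h1r.le hrρ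
    have hG0 := greenAverage_nonneg (fun z hz => h.density_nonneg hρ hz) hr₁0 h1r.le hrρ
    have hmain := hE r hr h1r hrE
    have hpsi := hψ r hr h0r.le
    have hgrow := log_growth_le hr₁0 h1r hδ
    have hsum := Finset.sum_le_sum fun j (_ : j ∈ Finset.univ) =>
      h.integral_ncard_div_le hI hK h0 h01.le h1r.le hr j
    have hBr : M ≤ Real.posLog (γ' r) + δ * Real.log r := by
      by_contra hcon
      exact hrB ⟨hr, h1r, not_le.1 hcon⟩
    rw [← hNe r hr hrN] at hmain hBr
    rw [← hadd]
    set G := greenAverage K r₁ r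
    have hT : 2 * (greenAverage K r₀ r₁ + G) = m + 2 * G := by rw [hm]; ring
    rw [hT]
    have hlogT : Real.log (1 + G) ≤ Real.log (m + 2 * G) + Real.log (m⁻¹ + 2⁻¹) := by
      rw [← Real.log_mul (by positivity) (by positivity)]
      refine Real.log_le_log (by positivity) ?_
      have : (m + 2 * G) * (m⁻¹ + 2⁻¹) = 1 + G + (m / 2 + 2 * G * m⁻¹) := by
        field_simp
        ring
      rw [this]
      have : 0 ≤ m / 2 + 2 * G * m⁻¹ := by positivity
      linarith
    have hlogm : Real.log m ≤ Real.log (m + 2 * G) := Real.log_le_log hm0 (by linarith)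
    have hlogP : Real.log (P r₀) ≤ Real.log (P r) := Real.log_le_log hP0 (hP r hr h0r.le)
    have hlogr : δ * Real.log r₁ ≤ δ * Real.log r :=
      mul_le_mul_of_nonneg_left (Real.log_le_log hr₁0 h1r.le) hδ.le
    have hq : (0 : ℝ) ≤ q := Nat.cast_nonneg q
    have e1 := mul_le_mul_of_nonneg_left hlogT (by linarith : (0 : ℝ) ≤ q + 2)
    have e2 := mul_le_mul_of_nonneg_left hlogP (by linarith : (0 : ℝ) ≤ q + 2)
    have e3 := mul_le_mul_of_nonneg_left hlogr (by linarith : (0 : ℝ) ≤ q + 3 / 2)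
    have e4 : 0 ≤ (q + 1 / 2) * Real.posLog (γ r) := mul_nonneg (by linarith) Real.posLog_nonneg
    rw [hM, hA] at hBr
    linarith

end IsSphereMap

theorem theoremI {S : Type*} [TopologicalSpace S] [T2Space S] [ConnectedSpace S]
    [NoncompactSpace S] [ChartedSpace ℂ S] [IsManifold 𝓘(ℂ, ℂ) ω S]
    (h : HermitianMetric S) (Φ : HolomorphicForm S) (o : S) (hΦ : Φ.IsExhausted o)
    (γ : ℝ → ℝ) (hγ_nonneg : ∀ r ∈ Φ.radii o, 0 ≤ γ r)
    (hγ_int : LocallyIntegrableOn γ (Φ.radii o))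
    (hγ_infinite : ∫⁻ r in Φ.radii o, ENNReal.ofReal (γ r) = ⊤)
    (f : S → OnePoint ℂ) (hf : IsMeromorphicMap f) (hf_nonconst : ¬ ∃ b, ∀ x, f x = b)
    (q : ℕ) (a : Fin q → OnePoint ℂ) (ha : Function.Injective a)
    (r₀ : ℝ) (hr₀ : r₀ ∈ Φ.radii o) :
    ∃ C : ℝ, 0 < C ∧ ∀ δ : ℝ, 0 < δ →
      ∃ E : Set ℝ, MeasurableSet E ∧ E ⊆ Φ.radii o ∧
        ∫⁻ r in E, ENNReal.ofReal (γ r) < ⊤ ∧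
        ∀ r ∈ Φ.radii o, r₀ < r → r ∉ E →
          ((q : ℝ) - 2) * Φ.characteristic o r₀ (fubiniStudyPullback f) r
              + Φ.characteristic o r₀ h.ricciForm r
            ≤ ∑ j, Φ.simpleCounting o r₀ f (a j) r
              + C * (Real.log (Φ.characteristic o r₀ (fubiniStudyPullback f) r)
                + Real.log (Φ.supNorm o h r) + Real.posLog (γ r) + δ * Real.log r) := by
  have hI : IsRadii (Φ.radii o) := HolomorphicForm.isRadii_radii
  have hK := hΦ.exists_sphereDensity_ne_zero ⟨r₀, hr₀⟩ hf hf_nonconst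
  have hsm := IsHolomorphicToSphere.isSphereMap hI
    (fun ρ hρ => hΦ.isHolomorphicToSphere hρ hf) hK a
  -- The main estimate needs `q + 2` copies of `log T_f`; the extra one gives room for additive
  -- constants. Everything depending on `δ` sits in the exceptional set.
  refine ⟨q + 3, by positivity, fun δ hδ => ?_⟩
  obtain ⟨E, hEm, hEI, hEfin, hE⟩ := hsm.exists_second_main_theorem hI
    (fun i j hij => formDet_sphereForm_ne_zero (ha.ne hij)) hK hr₀ hγ_int
    (hΦ.supNorm_pos h hr₀) (fun r hr hle => hΦ.supNorm_mono h hr (hI.pos _ hr₀) hle)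
    (fun r hr hle => hΦ.characteristic_ricciForm_le h hr₀ hr hle) hδ
  refine ⟨E, hEm, hEI, hEfin, fun r hr h0r hrE => ?_⟩
  rw [hΦ.characteristic_fubiniStudyPullback hf hf_nonconst hr₀ hr h0r.le,
    Finset.sum_congr rfl fun j _ => hΦ.simpleCounting_eq f (a j) hr₀ hr h0r.le]
  exact hE r hr h0r hrE
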